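/- **Setting.** Let $\mathbb T^2=\mathbb C/\Lambda$ be an oriented flat torus ($\Lambda\subset\mathbb C$ a lattice), and let $G$ be a finite graph (loops and multiple edges allowed) embedded in $\mathbb T^2$ so that its edges are straight segments and its faces are topological (open) discs. Let $x=(x_e)_{e\in E(G)}$ be weights with $0<x_e<1$, and write $x_e=\tan(\theta_e/2)$ with $\theta_e\in(0,\pi/2)$. Let $\mathbb E$ be the set of oriented edges of $G$; for $e\in\mathbb E$, let $o(e)$ and $t(e)$ be its origin and terminus, $\bar e$ the same edge with the opposite orientation, and $R(e)$ the next oriented edge after $e$ in the counterclockwise cyclic order of the oriented edges with origin $o(e)$. A 1-*cocycle* on a graph whose faces in $\mathbb T^2$ are discs is a map $\varphi$ from its oriented edges to $\mathbb C^*$ such that $\varphi(\bar e)=\varphi(e)^{-1}$ for all $e$, and $\prod_{e\in\partial f}\varphi(e)=1$ for each face $f$. Such cocycles on $G$ represent the classes in $H^1(\mathbb T^2;\mathbb C^*)$. *Kac–Ward determinant.* For a 1-cocycle $\varphi$ on $G$, let $P^\varphi(G,x)=\det(I-T^\varphi)$, where $T^\varphi$ is the $\mathbb E\times\mathbb E$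 matrix with $T^\varphi_{e,e'}=\varphi(e)\exp\!\big(\tfrac i2\alpha(e,e')\big)x_e$ if $t(e)=o(e')$ and $e'\neq\bar e$, and $T^\varphi_{e,e'}=0$ otherwise; $\alpha(e,e')\in(-\pi,\pi)$ is the angle from $e$ to $e'$. *The graph $C_G$.* $(C_G,y)\subset\mathbb T^2$ is the weighted bipartite graph (considered by Fan–Wu) obtained as follows. Replace each edge $e$ of $G$ by a rectangle whose two sides parallel to $e$ have weight $\sin\theta_e$ and whose two other sides have weight $\cos\theta_e$; then join the two vertices lying in each corner of each face of $G$ by an edge of weight $1$. Thus each $e\in\mathbb E$ gives a white vertex $w_e$ immediately to the left of $e$ near $o(e)$ and a black vertex $b_e$ immediately to the right of $e$ near $o(e)$, and the edges of $C_G$ are, for each $e\in\mathbb E$: $w_eb_e$ with weight $\cos\theta_e$, $w_eb_{\bar e}$ with weight $\sin\theta_e$, and $w_eb_{R(e)}$ with weight $1$. *Kasteleyn determinant.* A Kasteleyn orientation on $C_G$ is a map $\omega\colon E(C_G)\to\{\pm1\}$ with $\prod_{c\in\partial f}\omega(c)=(-1)^{|\partial f|/2+1}$ for each face $f$ of $C_G\subset\mathbb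 T^2$. A 1-cocycle $\varphi$ on $G$ induces the map $\tilde\varphi$ on oriented edges of $C_G$ given by $\tilde\varphi(w_e,b_{\bar e})=\varphi(e)$, $\tilde\varphi(b_{\bar e},w_e)=\varphi(e)^{-1}$ (for the edge $w_eb_{\bar e}$ of weight $\sin\theta_e$ parallel to $e$), and $\tilde\varphi=1$ on all other oriented edges. Let $K^\varphi(C_G,y)$ be the matrix with rows indexed by the white and columns by the black vertices, and entries $K^\varphi_{wb}=\sum_{c}\omega(c)\,y_c\,\tilde\varphi(c)$, the sum being over all edges $c$ joining $w$ to $b$, oriented from $w$ to $b$. Its determinant is taken with respect to the bijection $w_e\leftrightarrow b_e$. **Theorem.** For any such $(G,x)$ there is a Kasteleyn orientation on $C_G\subset\mathbb T^2$ such that, for every 1-cocycle $\varphi$ on $G$ (hence for every class in $H^1(\mathbb T^2;\mathbb C^*)$), $\tilde\varphi$ is a 1-cocycle on $C_G$ and $$P^\varphi(G,x)=2^{-|V(G)|}\prod_{e\in E(G)}(1+x_e^2)\,\det K^\varphi(C_G,y).$$ -/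

import Mathlib

/-- A combinatorial description of a graph drawn on an oriented closed surface with all faces
discs: `D` is the set of oriented edges, `rev` reverses the orientation, and `rot d` is the next
oriented edge after `d`, counterclockwise, among the oriented edges with the same origin as `d`
(so the vertices are the cycles of `rot`). -/
structure RotationSystem (D : Type*) where
  rev : Equiv.Perm D
  rot : Equiv.Perm D
  rev_rev : ∀ d, rev (rev d) = d
  rev_ne : ∀ d, rev d ≠ d

namespace RotationSystem

variable {D : Type*} (M : RotationSystem D)

/-- The oriented edge that follows `d` on the boundary of the face on the left of `d`: at the
terminus of `d`, it is the oriented edge that comes just before `rev d` counterclockwise. -/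
def facePerm : Equiv.Perm D := M.rot⁻¹ * M.rev

/-- The boundary `∂f` of the face `f` on the left of `d`, as the set of oriented edges having
`f` on their left. (An edge with `f` on both of its sides appears with both orientations.) -/
noncomputable def faceBoundary [Fintype D] (d : D) : Finset D := by
  classical exact Finset.univ.filter fun d' => M.facePerm.SameCycle d d'

/-- `φ` is a 1-cocycle with values in `ℂ*`: a map on oriented edges, inverted when the
orientation is reversed, whose product along the boundary of each face is 1. -/
def IsCocycle [Fintype D] (φ : D → ℂˣ) : Prop :=
  (∀ d, φ (M.rev d) = (φ d)⁻¹) ∧ ∀ d, ∏ d' ∈ M.faceBoundary d, φ d' = 1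

/-- `ω` is a Kasteleyn orientation of a bipartite graph: a sign for each unoriented edge such
that the product along `∂f` is `(-1) ^ (|∂f| / 2 + 1)` for each face `f`. (In a bipartite graph
`|∂f|` is even.) -/
def IsKasteleyn [Fintype D] (ω : D → ℤˣ) : Prop :=
  (∀ d, ω (M.rev d) = ω d) ∧
    ∀ d, ∏ d' ∈ M.faceBoundary d, ω d' = (-1) ^ ((M.faceBoundary d).card / 2 + 1)

end RotationSystem

/-- The counterclockwise angle, in `(0, 2π]`, from the direction of `z` to that of `w`. -/
noncomputable def ccwAngle (z w : ℂ) : ℝ :=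
  toIocMod Real.two_pi_pos 0 (w.arg - z.arg)

/-- A graph with vertex set `V` and edge set `E` (loops and multiple edges are allowed), embedded
in the flat torus `ℂ ⧸ Λ` so that its edges are straight segments and its faces are topological
discs. Each edge `e` carries an arbitrary reference orientation; with it, `e` is the
projection to the torus of a segment `[z, z + vec e]`, from `src e` to `tgt e`. -/
structure ToricGraph (Λ : Submodule ℤ ℂ) (V E : Type*) where
  pos : V → ℂ ⧸ Λ
  src : E → V
  tgt : E → V
  vec : E → ℂ
  pos_tgt : ∀ e, pos (tgt e) = pos (src e) + Submodule.Quotient.mk (vec e)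
  pos_injective : Function.Injective pos
  /-- The interior of an edge contains no vertex. -/
  edge_ne_vertex : ∀ (e : E) (v : V), ∀ s ∈ Set.Ioo (0 : ℝ) 1,
    pos (src e) + Submodule.Quotient.mk (s * vec e) ≠ pos v
  /-- The interiors of edges are simple and pairwise disjoint. -/
  edge_injective : ∀ (e e' : E), ∀ s ∈ Set.Ioo (0 : ℝ) 1, ∀ s' ∈ Set.Ioo (0 : ℝ) 1,
    pos (src e) + Submodule.Quotient.mk (s * vec e) =
      pos (src e') + Submodule.Quotient.mk (s' * vec e') → e = e' ∧ s = s'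
  /-- The faces, that is, the connected components of the complement of the graph, are open
  discs. -/
  face_disc : ∀ p ∈ (Set.range pos ∪ {q : ℂ ⧸ Λ | ∃ (e : E) (s : ℝ), s ∈ Set.Icc (0 : ℝ) 1 ∧
      q = pos (src e) + Submodule.Quotient.mk (s * vec e)})ᶜ,
    Nonempty (connectedComponentIn (Set.range pos ∪ {q : ℂ ⧸ Λ | ∃ (e : E) (s : ℝ),
      s ∈ Set.Icc (0 : ℝ) 1 ∧ q = pos (src e) + Submodule.Quotient.mk (s * vec e)})ᶜ p
        ≃ₜ Metric.ball (0 : ℂ) 1)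

namespace ToricGraph

variable {Λ : Submodule ℤ ℂ} {V E : Type*} (G : ToricGraph Λ V E)

/-- The oriented edges of a graph with edge set `E`: `(e, true)` is `e` with its reference
orientation, `(e, false)` is `e` with the opposite orientation. -/
abbrev Dart (E : Type*) := E × Bool

/-- The oriented edge `e` with its orientation reversed. -/
def rev : Equiv.Perm (Dart E) where
  toFun d := (d.1, !d.2)
  invFun d := (d.1, !d.2)
  left_inv d := by simp
  right_inv d := by simp

/-- The origin of an oriented edge. -/
def origin (d : Dart E) : V := if d.2 then G.src d.1 else G.tgt d.1

/-- The terminus of an oriented edge. -/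
def terminus (d : Dart E) : V := G.origin (rev d)

/-- The vector from the origin to the terminus of a lift of an oriented edge to `ℂ`. -/
def dvec (d : Dart E) : ℂ := if d.2 then G.vec d.1 else -G.vec d.1

lemma dvec_ne_zero (d : Dart E) : G.dvec d ≠ 0 := by
  have h : G.vec d.1 ≠ 0 := by
    intro h
    refine G.edge_ne_vertex d.1 (G.src d.1) (1 / 2) (by norm_num) ?_
    simp [h]
  unfold dvec
  split_ifs
  · exact h
  · exact neg_ne_zero.mpr h

lemma dart_point (d : Dart E) (s : ℝ) :
    G.pos (G.origin d) + Submodule.Quotient.mk (s * G.dvec d) =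
      G.pos (G.src d.1) + Submodule.Quotient.mk
        (((if d.2 then s else 1 - s : ℝ) : ℂ) * G.vec d.1) := by
  obtain ⟨e, b⟩ := d
  cases b
  · simp only [origin, dvec, Bool.false_eq_true, if_false, G.pos_tgt]
    rw [add_assoc, ← Submodule.Quotient.mk_add]
    congr 2
    push_cast
    ring
  · simp [origin, dvec]

/-- Distinct oriented edges with the same origin leave it in distinct directions. -/
lemma eq_of_arg_eq {a b : Dart E} (ho : G.origin a = G.origin b)
    (harg : (G.dvec a).arg = (G.dvec b).arg) : a = b := by
  have ha := norm_pos_iff.mpr (G.dvec_ne_zero a)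
  have hb := norm_pos_iff.mpr (G.dvec_ne_zero b)
  obtain ⟨s, t, hs, ht, hs2, ht2, hst⟩ : ∃ s t : ℝ, 0 < s ∧ 0 < t ∧ s < 1 / 2 ∧ t < 1 / 2 ∧
      (s : ℂ) * G.dvec a = t * G.dvec b := by
    refine ⟨‖G.dvec b‖ / (2 * (‖G.dvec a‖ + ‖G.dvec b‖)),
      ‖G.dvec a‖ / (2 * (‖G.dvec a‖ + ‖G.dvec b‖)), by positivity, by positivity, ?_, ?_, ?_⟩
    · rw [div_lt_div_iff₀ (by positivity) (by norm_num)]; linarith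
    · rw [div_lt_div_iff₀ (by positivity) (by norm_num)]; linarith
    · have h := (Complex.arg_eq_arg_iff (G.dvec_ne_zero a) (G.dvec_ne_zero b)).mp harg
      have ha' : (‖G.dvec a‖ : ℂ) ≠ 0 := by exact_mod_cast ha.ne'
      have h2 : (‖G.dvec b‖ : ℂ) * G.dvec a = ‖G.dvec a‖ * G.dvec b := by
        calc (‖G.dvec b‖ : ℂ) * G.dvec a
            = ‖G.dvec a‖ * (‖G.dvec b‖ / ‖G.dvec a‖ * G.dvec a) := by field_simp
          _ = ‖G.dvec a‖ * G.dvec b := by rw [h]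
      push_cast
      rw [div_mul_eq_mul_div, div_mul_eq_mul_div, h2]
  have hp := G.dart_point a s
  rw [hst, ho, G.dart_point b t] at hp
  obtain ⟨a1, a2⟩ := a
  obtain ⟨b1, b2⟩ := b
  have key := G.edge_injective b1 a1 (if b2 then t else 1 - t)
    (by split_ifs <;> constructor <;> linarith) (if a2 then s else 1 - s)
    (by split_ifs <;> constructor <;> linarith) hp
  obtain ⟨h1, h2⟩ := key
  refine Prod.ext h1.symm ?_
  cases a2 <;> cases b2 <;> simp at h2 ⊢ <;> linarith

lemma exists_next [Fintype E] (d : Dart E) : ∃ d' : Dart E, G.origin d' = G.origin d ∧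
    ∀ c, G.origin c = G.origin d →
      ccwAngle (G.dvec d) (G.dvec d') ≤ ccwAngle (G.dvec d) (G.dvec c) := by
  classical
  obtain ⟨m, hm, h⟩ := Finset.exists_min_image
    (Finset.univ.filter fun c : Dart E => G.origin c = G.origin d)
    (fun c => ccwAngle (G.dvec d) (G.dvec c)) ⟨d, by simp⟩
  exact ⟨m, by simpa using hm, fun c hc => h c (by simpa using hc)⟩

/-- The next oriented edge after `d`, turning counterclockwise around the origin of `d`. (It is
`d` itself if `d` is the only oriented edge with this origin.) -/
noncomputable def next [Fintype E] (d : Dart E) : Dart E := (G.exists_next d).choose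

lemma origin_next [Fintype E] (d : Dart E) : G.origin (G.next d) = G.origin d :=
  (G.exists_next d).choose_spec.1

lemma next_le [Fintype E] (d : Dart E) {c : Dart E} (hc : G.origin c = G.origin d) :
    ccwAngle (G.dvec d) (G.dvec (G.next d)) ≤ ccwAngle (G.dvec d) (G.dvec c) :=
  (G.exists_next d).choose_spec.2 c hc

lemma ccwAngle_mem (z w : ℂ) : 0 < ccwAngle z w ∧ ccwAngle z w ≤ 2 * Real.pi := by
  have h := toIocMod_mem_Ioc Real.two_pi_pos 0 (w.arg - z.arg)
  rw [zero_add] at h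
  exact h

lemma ccwAngle_eq (z w : ℂ) : ∃ k : ℤ, w.arg - z.arg = ccwAngle z w + k * (2 * Real.pi) :=
  ⟨toIocDiv Real.two_pi_pos 0 (w.arg - z.arg), by
    have := toIocMod_add_toIocDiv_zsmul Real.two_pi_pos 0 (w.arg - z.arg)
    rw [zsmul_eq_mul] at this
    exact this.symm⟩

lemma arg_eq_of_angle {z w : ℂ} (k : ℤ) (h : w.arg - z.arg = k * (2 * Real.pi)) :
    z.arg = w.arg := by
  have hpi := Real.pi_pos
  have h1 := Complex.neg_pi_lt_arg z
  have h2 := Complex.arg_le_pi z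
  have h3 := Complex.neg_pi_lt_arg w
  have h4 := Complex.arg_le_pi w
  have hk1 : (k : ℝ) < 1 := by nlinarith
  have hk2 : (-1 : ℝ) < k := by nlinarith
  have : k = 0 := by
    have a : k < 1 := by exact_mod_cast hk1
    have b : -1 < k := by exact_mod_cast hk2
    omega
  subst this
  simp at h
  linarith

lemma next_injective [Fintype E] : Function.Injective G.next := by
  intro a b hab
  by_contra hne
  have hpi := Real.pi_pos
  have ho : G.origin a = G.origin b := by
    rw [← G.origin_next a, ← G.origin_next b, hab]
  have h1 := G.next_le a (c := b) ho.symm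
  have h2 := G.next_le b (c := a) ho
  rw [← hab] at h2
  set c := G.next a with hc
  have hoc : G.origin c = G.origin a := G.origin_next a
  obtain ⟨k1, e1⟩ := ccwAngle_eq (G.dvec a) (G.dvec c)
  obtain ⟨k2, e2⟩ := ccwAngle_eq (G.dvec b) (G.dvec c)
  obtain ⟨k3, e3⟩ := ccwAngle_eq (G.dvec a) (G.dvec b)
  obtain ⟨k4, e4⟩ := ccwAngle_eq (G.dvec b) (G.dvec a)
  have m1 := ccwAngle_mem (G.dvec a) (G.dvec c)
  have m2 := ccwAngle_mem (G.dvec b) (G.dvec c)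
  have m3 := ccwAngle_mem (G.dvec a) (G.dvec b)
  have m4 := ccwAngle_mem (G.dvec b) (G.dvec a)
  set α := ccwAngle (G.dvec a) (G.dvec c)
  set β := ccwAngle (G.dvec b) (G.dvec c)
  set γ := ccwAngle (G.dvec a) (G.dvec b)
  set δ := ccwAngle (G.dvec b) (G.dvec a)
  -- the two angles between `a` and `b` add up to a full turn
  have hγ : γ ≠ 2 * Real.pi := fun h => hne (G.eq_of_arg_eq ho
    (arg_eq_of_angle (k3 + 1) (by rw [e3, h]; push_cast; ring)))
  have hγ' : γ < 2 * Real.pi := lt_of_le_of_ne m3.2 hγ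
  have hsum : γ + δ = 2 * Real.pi := by
    have h : γ + δ = ((-k3 - k4 : ℤ) : ℝ) * (2 * Real.pi) := by push_cast; linarith
    have l1 : ((-k3 - k4 : ℤ) : ℝ) < 2 := by nlinarith
    have l2 : (0 : ℝ) < ((-k3 - k4 : ℤ) : ℝ) := by nlinarith
    have l1' : -k3 - k4 < 2 := by exact_mod_cast l1
    have l2' : 0 < -k3 - k4 := by exact_mod_cast l2
    have : -k3 - k4 = 1 := by omega
    rw [h, this]; simp
  have h : α - β - γ = ((k2 + k3 - k1 : ℤ) : ℝ) * (2 * Real.pi) := by push_cast; linarith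
  have l1 : ((k2 + k3 - k1 : ℤ) : ℝ) < 0 := by nlinarith
  have l1' : k2 + k3 - k1 ≤ -1 := by
    have : k2 + k3 - k1 < 0 := by exact_mod_cast l1
    omega
  have l2 : ((k2 + k3 - k1 : ℤ) : ℝ) ≤ -1 := by exact_mod_cast l1'
  nlinarith

/-- The counterclockwise cyclic order of the oriented edges around their origins. -/
noncomputable def rot [Fintype E] : Equiv.Perm (Dart E) :=
  Equiv.ofBijective G.next (Finite.injective_iff_bijective.mp G.next_injective)

/-- The rotation system of `G ⊂ ℂ ⧸ Λ`. -/
noncomputable def toRotationSystem [Fintype E] : RotationSystem (Dart E) where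
  rev := rev
  rot := G.rot
  rev_rev d := by simp [rev]
  rev_ne d := by
    intro h
    have := congrArg Prod.snd h
    simp [rev] at this

/-- The entry of the matrix `T^φ`. As `e` is straight, the angle from `e` to `e'` at the terminus
of `e` is the argument of the quotient of their vectors. -/
noncomputable def transition [DecidableEq V] [DecidableEq E] (x : E → ℝ) (φ : Dart E → ℂˣ) :
    Matrix (Dart E) (Dart E) ℂ := fun e e' =>
  if G.terminus e = G.origin e' ∧ e' ≠ rev e then
    (φ e : ℂ) * Complex.exp (Complex.I / 2 * (G.dvec e' / G.dvec e).arg) * x e.1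
  else 0

/-- The Kac-Ward determinant `P^φ(G,x) = det (I - T^φ)`. -/
noncomputable def kacWardDet [Fintype E] [DecidableEq V] [DecidableEq E] (x : E → ℝ)
    (φ : Dart E → ℂˣ) : ℂ :=
  (1 - G.transition x φ).det

/-! ### The bipartite graph `C_G`

Each oriented edge `e` of `G` gives one white vertex of `C_G`, immediately to the left of `e` and
close to its origin, and one black vertex, immediately to the right of `e` and close to its
origin. Both the set `W` of white vertices and the set `B` of black vertices are
therefore indexed by `Dart E`. The rectangle that replaces an unoriented edge has as corners the
white and black vertices of its two orientations. -/

/-- The edges of `C_G`, with their white and black ends: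
* `perp e` joins the white vertex of `e` to the black vertex of `e` (it is the side of the
  rectangle of `e` perpendicular to `e` at the origin of `e`);
* `par e` joins the white vertex of `e` to the black vertex of `rev e` (it is the side of the
  rectangle of `e` parallel to `e` on the left of `e`);
* `corner e` joins the white vertex of `e` to the black vertex of the next oriented edge after
  `e` (it lies in the corner of the face between `e` and this next oriented edge). -/
inductive CEdge (E : Type*) where
  | perp (e : Dart E)
  | par (e : Dart E)
  | corner (e : Dart E)

/-- The edges of `C_G` as three copies of the set of oriented edges of `G`. -/
def CEdge.equivSum : CEdge E ≃ Dart E ⊕ Dart E ⊕ Dart E where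
  toFun
    | .perp e => .inl e
    | .par e => .inr (.inl e)
    | .corner e => .inr (.inr e)
  invFun
    | .inl e => .perp e
    | .inr (.inl e) => .par e
    | .inr (.inr e) => .corner e
  left_inv c := by cases c <;> rfl
  right_inv c := by rcases c with _ | _ | _ <;> rfl

instance instFintypeCEdge [Fintype E] : Fintype (CEdge E) := Fintype.ofEquiv _ CEdge.equivSum.symm

/-- The white end of an edge of `C_G`. -/
def white : CEdge E → Dart E
  | .perp e => e
  | .par e => e
  | .corner e => e

/-- The black end of an edge of `C_G`. -/
noncomputable def black [Fintype E] : CEdge E → Dart E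
  | .perp e => e
  | .par e => rev e
  | .corner e => G.rot e

/-- The weights of `C_G`, where `θ_e = 2 arctan x_e`, that is, `x_e = tan (θ_e / 2)`. -/
noncomputable def weight (x : E → ℝ) : CEdge E → ℝ
  | .perp e => Real.cos (2 * Real.arctan (x e.1))
  | .par e => Real.sin (2 * Real.arctan (x e.1))
  | .corner _ => 1

/-- The oriented edges of `C_G`: `(c, true)` is `c` oriented from white to black, and
`(c, false)` is `c` oriented from black to white. -/
abbrev CDart (E : Type*) := CEdge E × Bool

/-- The counterclockwise cyclic order of the oriented edges of `C_G` around their origins. Around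
the white vertex of `e`, it is `par e`, `corner e`, `perp e`; around the black vertex of `e`, it
is `par (rev e)`, `perp e`, `corner f`, where `f` is the oriented edge just before `e` around the
origin of `e`. -/
noncomputable def crot [Fintype E] : Equiv.Perm (CDart E) where
  toFun
    | (.par e, true) => (.corner e, true)
    | (.corner e, true) => (.perp e, true)
    | (.perp e, true) => (.par e, true)
    | (.par e, false) => (.perp (rev e), false)
    | (.perp e, false) => (.corner (G.rot.symm e), false)
    | (.corner e, false) => (.par (rev (G.rot e)), false)
  invFun
    | (.corner e, true) => (.par e, true)
    | (.perp e, true) => (.corner e, true)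
    | (.par e, true) => (.perp e, true)
    | (.perp e, false) => (.par (rev e), false)
    | (.corner e, false) => (.perp (G.rot e), false)
    | (.par e, false) => (.corner (G.rot.symm (rev e)), false)
  left_inv := by rintro ⟨_ | _ | _, _ | _⟩ <;> simp [rev]
  right_inv := by rintro ⟨_ | _ | _, _ | _⟩ <;> simp [rev]

/-- The rotation system of `C_G ⊂ ℂ ⧸ Λ`. -/
noncomputable def cRotationSystem [Fintype E] : RotationSystem (CDart E) where
  rev :=
    { toFun := fun d => (d.1, !d.2)
      invFun := fun d => (d.1, !d.2)
      left_inv := fun d => by simp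
      right_inv := fun d => by simp }
  rot := G.crot
  rev_rev d := by simp
  rev_ne d := by
    intro h
    have := congrArg Prod.snd h
    simp at this

/-- The 1-cochain on `C_G` induced by a 1-cochain `φ` on `G`: its value is `φ e` on the edge that
runs parallel to `e` on its left, oriented from white to black (hence in the direction of `e`),
and 1 on the edges that stay close to a vertex of `G`. -/
def inducedCochain (φ : Dart E → ℂˣ) : CDart E → ℂˣ
  | (.par e, true) => φ e
  | (.par e, false) => (φ e)⁻¹
  | (.perp _, _) => 1
  | (.corner _, _) => 1

/-- The matrix of the Kasteleyn operator `K^φ(C_G, y) : ℂ^B → ℂ^W` of a sign function `ω`, edge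
weights `y`, and a map `φ` on the oriented edges of `C_G`: the coefficient at `(w, b)` is the sum
over all edges `c` from `w` to `b` of `ω c * y c * φ c`, with `c` oriented from white to black. -/
noncomputable def kasteleynMatrix [Fintype E] [DecidableEq E] (ω : CDart E → ℤˣ) (y : CEdge E → ℝ)
    (φ : CDart E → ℂˣ) : Matrix (Dart E) (Dart E) ℂ := fun w b =>
  ∑ c : CEdge E, if white c = w ∧ G.black c = b then
    ((ω (c, true) : ℤ) : ℂ) * y c * φ (c, true) else 0

end ToricGraph

/-! The identity is a factorization of matrices indexed by oriented edges. Let R be `rotMatrix` (e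
to the next edge, with the square root of the rotation), J be `revMatrix` (e to its reverse, with
entry i φ(e) x_e) and S be `turnMatrix` (all rotations at a vertex, by square roots). Angles around
a vertex add up until a full turn is completed, and the square root of a full turn is -1; hence (1 -
R) S = 2. The angle from e to e' is the counterclockwise angle from the reverse of e to e', minus π;
hence T = -J (S - 1). Therefore (1 - T)(1 - R) = (1 + J) - (1 - J) R. Since J² is diagonal with
entries -x_e², the half-angle formulas identify the Cayley transform C of J, defined by (1 - J) C =
1 + J, with `rectMatrix`, whose entries are cos θ_e and i φ(e) sin θ_e. So (1 - T)(1 - R) = (1 -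
J)(C - R). Here det (1 - R) = 2^|V|, with a factor 1 - (-1) for each vertex, and det (1 - J) is the
product of the 1 + x_e². Conjugating C - R by the diagonal matrix of square roots of edge directions
turns the phases into signs and gives K for the orientation `kasteleynSign`.

It remains to see that these signs are Kasteleyn. At the rectangle of an edge the product is i² =
-1; at a vertex, the corners add up to one full turn. At a face of G the square roots of directions
cancel along the boundary and leave the product of the half turns at its corners, which must be -1:
the boundary makes an odd number of full turns (`prod_cornerTurn_face`). This is Hopf's theorem, but
the boundary may run along an edge twice and lies in a torus. It is therefore pushed by ε into the
face. As the face is a disc, the pushed walk lifts to a closed simple polygon in the plane, to which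
the discrete Hopf theorem `prod_halfTurn_polygon` applies, and then ε tends to 0. The disc
hypothesis also excludes isolated vertices (`exists_origin_eq`), which would spoil the power of 2.
-/

open Topology

/-! ### Lifting discs and paths from the torus to the plane -/

/-- A subset of the torus homeomorphic to a disc lifts to the plane. -/
lemma exists_section_of_homeomorph_ball (Λ : Submodule ℤ ℂ) [DiscreteTopology Λ]
    (S : Set (ℂ ⧸ Λ)) (h : S ≃ₜ Metric.ball (0 : ℂ) 1) :
    ∃ s : S → ℂ, Continuous s ∧ ∀ q, (Submodule.Quotient.mk (s q) : ℂ ⧸ Λ) = q := by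
  have cov : IsCoveringMap (fun z : ℂ => (Submodule.Quotient.mk z : ℂ ⧸ Λ)) :=
    (AddSubgroup.isAddQuotientCoveringMap_of_comm Λ.toAddSubgroup
      (isDiscrete_iff_discreteTopology.mpr ‹_›)).isCoveringMap
  have hc : Convex ℝ (Metric.ball (0 : ℂ) 1) := convex_ball 0 1
  have : ContractibleSpace (Metric.ball (0 : ℂ) 1) := hc.contractibleSpace ⟨0, by simp⟩
  have : LocallyPathConnectedSpace (Metric.ball (0 : ℂ) 1) :=
    Metric.isOpen_ball.locallyPathConnectedSpace
  let a₀ : Metric.ball (0 : ℂ) 1 := ⟨0, by simp⟩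
  obtain ⟨e₀, he⟩ := Submodule.Quotient.mk_surjective Λ (h.symm a₀ : ℂ ⧸ Λ)
  obtain ⟨F, ⟨-, hF⟩, -⟩ := cov.existsUnique_continuousMap_lifts
    ⟨fun a => (h.symm a : ℂ ⧸ Λ), by fun_prop⟩ a₀ e₀ he
  refine ⟨fun q => F (h q), by fun_prop, fun q => ?_⟩
  have := congrFun hF (h q)
  simpa using this

/-- A nowhere zero function on a topological disc has a continuous logarithm. -/
lemma exists_log_of_homeomorph_ball {X : Type*} [TopologicalSpace X]
    (h : X ≃ₜ Metric.ball (0 : ℂ) 1) (f : X → ℂ) (hf : Continuous f) (h0 : ∀ x, f x ≠ 0) :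
    ∃ g : X → ℂ, Continuous g ∧ ∀ x, Complex.exp (g x) = f x := by
  have hc : Convex ℝ (Metric.ball (0 : ℂ) 1) := convex_ball 0 1
  have : ContractibleSpace (Metric.ball (0 : ℂ) 1) := hc.contractibleSpace ⟨0, by simp⟩
  have : LocallyPathConnectedSpace (Metric.ball (0 : ℂ) 1) :=
    Metric.isOpen_ball.locallyPathConnectedSpace
  let a₀ : Metric.ball (0 : ℂ) 1 := ⟨0, by simp⟩
  obtain ⟨F, ⟨-, hF⟩, -⟩ := Complex.isCoveringMapOn_exp.existsUnique_continuousMap_lifts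
    ⟨fun a => f (h.symm a), by fun_prop⟩ (a₀ := a₀) (e₀ := Complex.log (f (h.symm a₀)))
    (Complex.exp_log (h0 _)) (fun a => h0 _)
  refine ⟨fun q => F (h q), by fun_prop, fun q => ?_⟩
  have := congrFun hF (h q)
  simpa using this

/-- Two lifts of a connected set differ by a constant. -/
lemma sub_eq_sub_of_mk_eq (Λ : Submodule ℤ ℂ) [DiscreteTopology Λ] {X : Type*}
    [TopologicalSpace X] [PreconnectedSpace X] (f g : X → ℂ) (hf : Continuous f)
    (hg : Continuous g)
    (h : ∀ x, (Submodule.Quotient.mk (f x) : ℂ ⧸ Λ) = Submodule.Quotient.mk (g x)) (x y : X) :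
    f x - g x = f y - g y := by
  have hm : ∀ x, f x - g x ∈ Λ := fun x => (Submodule.Quotient.eq Λ).mp (h x)
  have hcont : Continuous (fun x => (⟨f x - g x, hm x⟩ : Λ)) := by fun_prop
  exact congrArg Subtype.val (PreconnectedSpace.constant ‹_› hcont (x := x) (y := y))

lemma continuous_torus_mk (Λ : Submodule ℤ ℂ) :
    Continuous (fun z : ℂ => (Submodule.Quotient.mk z : ℂ ⧸ Λ)) :=
  continuous_quot_mk

lemma mk_mem_connectedComponentIn {Λ : Submodule ℤ ℂ} {U : Set (ℂ ⧸ Λ)} {X : Type*}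
    [TopologicalSpace X] [PreconnectedSpace X] (f : X → ℂ) (hf : Continuous f)
    (h : ∀ x, (Submodule.Quotient.mk (f x) : ℂ ⧸ Λ) ∈ U) (x y : X) :
    (Submodule.Quotient.mk (f x) : ℂ ⧸ Λ) ∈ connectedComponentIn U (Submodule.Quotient.mk (f y)) := by
  have hc : Continuous (fun x => (Submodule.Quotient.mk (f x) : ℂ ⧸ Λ)) :=
    (continuous_torus_mk Λ).comp hf
  exact (isPreconnected_range hc).subset_connectedComponentIn ⟨y, rfl⟩
    (Set.range_subset_iff.mpr h) ⟨x, rfl⟩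

/-- If the components of `U` are discs, a path in the plane over `U` whose projection is closed is
closed. -/
lemma eq_of_path_over_discs (Λ : Submodule ℤ ℂ) [DiscreteTopology Λ] (U : Set (ℂ ⧸ Λ))
    (hU : ∀ p ∈ U, Nonempty (connectedComponentIn U p ≃ₜ Metric.ball (0 : ℂ) 1))
    {X : Type*} [TopologicalSpace X] [PreconnectedSpace X] (f : X → ℂ) (hf : Continuous f)
    (h : ∀ x, (Submodule.Quotient.mk (f x) : ℂ ⧸ Λ) ∈ U) {x y : X}
    (hxy : (Submodule.Quotient.mk (f x) : ℂ ⧸ Λ) = Submodule.Quotient.mk (f y)) : f x = f y := by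
  obtain ⟨e⟩ := hU _ (h x)
  obtain ⟨s, hs, hs'⟩ := exists_section_of_homeomorph_ball Λ _ e
  let r : X → connectedComponentIn U (Submodule.Quotient.mk (f x)) :=
    fun t => ⟨Submodule.Quotient.mk (f t), mk_mem_connectedComponentIn f hf h t x⟩
  have hr : Continuous r := ((continuous_torus_mk Λ).comp hf).subtype_mk _
  -- The section over the disc gives a second lift of the projected path; unlike `f`, it obviously
  -- takes equal values at `x` and `y`.
  have key := sub_eq_sub_of_mk_eq Λ f (fun t => s (r t)) hf (hs.comp hr)
    (fun t => (hs' (r t)).symm) x y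
  have : r x = r y := Subtype.ext hxy
  rw [this] at key
  exact sub_left_injective key

/-- If the components of `U` are discs, the complement of `U` has no isolated point. -/
lemma not_isolated_of_discs (Λ : Submodule ℤ ℂ) [DiscreteTopology Λ] (U : Set (ℂ ⧸ Λ))
    (hU : ∀ p ∈ U, Nonempty (connectedComponentIn U p ≃ₜ Metric.ball (0 : ℂ) 1))
    (w : ℂ) (hw : (Submodule.Quotient.mk w : ℂ ⧸ Λ) ∉ U) (r : ℝ) (hr : 0 < r)
    (h : ∀ z : ℂ, ‖z‖ = r → (Submodule.Quotient.mk (w + z) : ℂ ⧸ Λ) ∈ U) : False := by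
  let f : ℝ → ℂ := fun t => w + r * Complex.exp (t * Complex.I)
  have hf : Continuous f := by fun_prop
  have hfU : ∀ t, (Submodule.Quotient.mk (f t) : ℂ ⧸ Λ) ∈ U := fun t => by
    refine h _ ?_
    rw [norm_mul, Complex.norm_exp_ofReal_mul_I, Complex.norm_real, Real.norm_of_nonneg hr.le,
      mul_one]
  obtain ⟨e⟩ := hU _ (hfU 0)
  obtain ⟨s, hs, hs'⟩ := exists_section_of_homeomorph_ball Λ _ e
  let ρ : ℝ → connectedComponentIn U (Submodule.Quotient.mk (f 0)) :=
    fun t => ⟨Submodule.Quotient.mk (f t), mk_mem_connectedComponentIn f hf hfU t 0⟩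
  have hρ : Continuous ρ := ((continuous_torus_mk Λ).comp hf).subtype_mk _
  have key := sub_eq_sub_of_mk_eq Λ (fun t => s (ρ t)) f (hs.comp hρ) hf
    (fun t => hs' (ρ t))
  set c := s (ρ 0) - f 0 with hc
  have hcΛ : c ∈ Λ := (Submodule.Quotient.eq Λ).mp (hs' (ρ 0))
  -- The lifted disc avoids `w + c`, because `w` does not project into `U`. A logarithm of the
  -- difference exists on the disc, hence along the circle, around which it should increase by 2πi.
  obtain ⟨g, hg, hg'⟩ := exists_log_of_homeomorph_ball e (fun q => s q - (w + c)) (by fun_prop)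
    (fun q hq => hw (by
      have h1 : s q = w + c := sub_eq_zero.mp hq
      have h2 := hs' q
      rw [h1, Submodule.Quotient.mk_add, (Submodule.Quotient.mk_eq_zero Λ).mpr hcΛ, add_zero] at h2
      rw [h2]
      exact connectedComponentIn_subset _ _ q.2))
  have hexp : ∀ t : ℝ, Complex.exp (g (ρ t)) = r * Complex.exp (t * Complex.I) := fun t => by
    rw [hg']
    have := key t 0
    simp only [← hc] at this
    have : s (ρ t) = f t + c := by rw [← this]; ring
    simp only [this, f]
    ring
  -- the function `g (ρ t) - t * I` takes values in a discrete set and is constant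
  have hr' : (r : ℂ) ≠ 0 := by exact_mod_cast hr.ne'
  have hval : ∀ t : ℝ, ∃ n : ℤ, g (ρ t) - t * Complex.I - Complex.log r
      = n * (2 * Real.pi * Complex.I) := fun t => by
    rw [← Complex.exp_eq_one_iff, Complex.exp_sub, Complex.exp_sub, hexp, Complex.exp_log hr']
    field_simp [Complex.exp_ne_zero]
  have hdisc : DiscreteTopology (AddSubgroup.zmultiples (2 * Real.pi : ℝ)) := inferInstance
  have hmem : ∀ t : ℝ, (g (ρ t) - t * Complex.I - Complex.log r).im ∈
      AddSubgroup.zmultiples (2 * Real.pi : ℝ) := fun t => by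
    obtain ⟨n, hn⟩ := hval t
    refine AddSubgroup.mem_zmultiples_iff.mpr ⟨n, ?_⟩
    rw [hn]
    simp
  have hcont : Continuous fun t : ℝ => (⟨_, hmem t⟩ : AddSubgroup.zmultiples (2 * Real.pi : ℝ)) := by
    fun_prop
  have hcst := congrArg Subtype.val
    (PreconnectedSpace.constant inferInstance hcont (x := 0) (y := 2 * Real.pi))
  have hper : ρ 0 = ρ (2 * Real.pi) := by
    refine Subtype.ext ?_
    simp only [ρ, f]
    congr 3
    push_cast
    rw [Complex.exp_two_pi_mul_I]
    simp
  simp only [← hper] at hcst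
  simp at hcst
  linarith [Real.pi_pos]

/-! ### Half turns and Hopf's theorem for polygons -/

/-- The unit complex number whose argument is half of the argument of `z`. -/
noncomputable def halfTurn (z : ℂ) : ℂ := Complex.exp ((z.arg / 2 : ℝ) * Complex.I)

lemma halfTurn_ne_zero (z : ℂ) : halfTurn z ≠ 0 := Complex.exp_ne_zero _

lemma halfTurn_sq (z : ℂ) : halfTurn z ^ 2 * ‖z‖ = z := by
  rw [halfTurn, ← Complex.exp_nat_mul]
  conv_rhs => rw [← Complex.norm_mul_exp_arg_mul_I z]
  rw [mul_comm]
  congr 2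
  push_cast
  ring

/-- In the right half plane arguments have absolute value below π/2, so their difference does not
wrap around. -/
lemma halfTurn_div {x y : ℂ} (hx : 0 < x.re) (hy : 0 < y.re) :
    halfTurn (x / y) = halfTurn x / halfTurn y := by
  have hx' := abs_lt.mp (Complex.abs_arg_lt_pi_div_two_iff.mpr (Or.inl hx))
  have hy' := abs_lt.mp (Complex.abs_arg_lt_pi_div_two_iff.mpr (Or.inl hy))
  have hx0 : x ≠ 0 := by rintro rfl; simp at hx
  have hy0 : y ≠ 0 := by rintro rfl; simp at hy
  have hinv : (y⁻¹).arg = -y.arg := by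
    rw [Complex.arg_inv, if_neg]
    intro h
    linarith [Real.pi_pos]
  have harg : (x / y).arg = x.arg - y.arg := by
    rw [div_eq_mul_inv, Complex.arg_mul hx0 (inv_ne_zero hy0), hinv, sub_eq_add_neg]
    rw [hinv]
    constructor <;> linarith
  rw [halfTurn, halfTurn, halfTurn, harg, ← Complex.exp_sub]
  congr 1
  push_cast
  ring

lemma halfTurn_div_of_mul {m a b : ℂ} (hm : m ≠ 0) (ha : 0 < (a * m).re) (hb : 0 < (b * m).re) :
    halfTurn (b / a) = halfTurn (b * m) / halfTurn (a * m) := by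
  rw [← halfTurn_div hb ha, mul_div_mul_right _ _ hm]

/-- Half turns are multiplicative only up to sign in general; no sign appears when the three vectors
lie in a common open half plane, here given by its normal `m`. -/
lemma halfTurn_trans {m a b c : ℂ} (hm : m ≠ 0) (ha : 0 < (a * m).re) (hb : 0 < (b * m).re)
    (hc : 0 < (c * m).re) : halfTurn (b / a) * halfTurn (c / b) = halfTurn (c / a) := by
  rw [halfTurn_div_of_mul hm ha hb, halfTurn_div_of_mul hm hb hc, halfTurn_div_of_mul hm ha hc]
  field_simp [halfTurn_ne_zero]

/-- Disjoint segments are separated by a line. -/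
lemma exists_mul_re_pos {a b c d : ℂ} (h : Disjoint (segment ℝ a b) (segment ℝ c d)) :
    ∃ m : ℂ, m ≠ 0 ∧ ∀ x ∈ segment ℝ a b, ∀ y ∈ segment ℝ c d, 0 < ((y - x) * m).re := by
  have hcomp : ∀ u v : ℂ, IsCompact (segment ℝ u v) := fun u v => by
    rw [segment_eq_image]
    exact isCompact_Icc.image (by fun_prop)
  obtain ⟨f, u, v, hu, huv, hv⟩ := geometric_hahn_banach_compact_closed (convex_segment a b)
    (hcomp a b) (convex_segment c d) (hcomp c d).isClosed h
  -- Every real linear functional on ℂ is the real part of multiplication by a fixed complex number.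
  have hf : ∀ z : ℂ, (z * (f 1 - f Complex.I * Complex.I)).re = f z := fun z => by
    conv_rhs => rw [← Complex.re_add_im z]
    have : (z.re : ℂ) + z.im * Complex.I = z.re • (1 : ℂ) + z.im • Complex.I := by simp
    rw [this, map_add, map_smul, map_smul]
    simp
  have hpos : ∀ x ∈ segment ℝ a b, ∀ y ∈ segment ℝ c d,
      0 < ((y - x) * (f 1 - f Complex.I * Complex.I)).re := fun x hx y hy => by
    rw [hf, map_sub]
    linarith [hu x hx, hv y hy]
  refine ⟨_, fun h0 => ?_, hpos⟩
  have := hpos a (left_mem_segment ℝ a b) c (left_mem_segment ℝ c d)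
  simp [h0] at this

/-- The vectors `a`, `a + c` and `c` lie in the open half plane around the bisector of `a` and `c`.
The normal used is 1/(aσ), which rotates them symmetrically about the positive real axis. -/
lemma halfTurn_corner {a c : ℂ} (h : c / a ∈ Complex.slitPlane) :
    halfTurn ((a + c) / a) * halfTurn (c / (a + c)) = halfTurn (c / a) := by
  have h0 : c / a ≠ 0 := Complex.slitPlane_ne_zero h
  have ha : a ≠ 0 := by rintro rfl; simp at h0
  have harg : (c / a).arg ≠ Real.pi := (Complex.mem_slitPlane_iff_arg.mp h).1
  have hlt : (c / a).arg < Real.pi := lt_of_le_of_ne (Complex.arg_le_pi _) harg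
  have hgt := Complex.neg_pi_lt_arg (c / a)
  set σ := halfTurn (c / a) with hσ
  have hσ0 : σ ≠ 0 := halfTurn_ne_zero _
  have hcos : 0 < Real.cos ((c / a).arg / 2) :=
    Real.cos_pos_of_mem_Ioo ⟨by linarith, by linarith⟩
  have hre : σ.re = Real.cos ((c / a).arg / 2) := by
    rw [hσ, halfTurn, Complex.exp_ofReal_mul_I_re]
  have h1 : 0 < (a * (σ / a * (σ⁻¹ ^ 2))).re := by
    have : a * (σ / a * (σ⁻¹ ^ 2)) = σ⁻¹ := by field_simp
    rw [this, hσ, halfTurn, ← Complex.exp_neg, ← neg_mul, ← Complex.ofReal_neg,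
      Complex.exp_ofReal_mul_I_re, Real.cos_neg]
    exact hcos
  have h2 : 0 < (c * (σ / a * (σ⁻¹ ^ 2))).re := by
    have : c * (σ / a * (σ⁻¹ ^ 2)) = (‖c / a‖ : ℝ) * σ := by
      have h3 : c = σ ^ 2 * ‖c / a‖ * a := by
        rw [hσ, halfTurn_sq]; field_simp
      conv_lhs => rw [h3]
      field_simp
    rw [this, Complex.re_ofReal_mul, hre]
    exact mul_pos (norm_pos_iff.mpr h0) hcos
  refine halfTurn_trans (m := σ / a * (σ⁻¹ ^ 2)) (by simp [ha, hσ0]) h1 ?_ h2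
  rw [add_mul, Complex.add_re]
  exact add_pos h1 h2

lemma prod_range_shift {f : ℕ → ℂ} {N : ℕ} (h : f N = f 0) (h0 : f 0 ≠ 0) :
    ∏ i ∈ Finset.range N, f (i + 1) = ∏ i ∈ Finset.range N, f i := by
  have h1 := Finset.prod_range_succ f N
  rw [Finset.prod_range_succ', h] at h1
  exact mul_right_cancel₀ h0 h1

lemma prod_range_div_succ {f : ℕ → ℂ} (h : ∀ i, f i ≠ 0) (n : ℕ) :
    ∏ i ∈ Finset.range n, f (i + 1) / f i = f n / f 0 := by
  induction n with
  | zero => simp [h 0]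
  | succ n ih =>
    rw [Finset.prod_range_succ, ih]
    have := h n
    field_simp

/-- **Hopf's theorem** on the rotation of simple closed polygons, modulo two full turns. -/
theorem prod_halfTurn_polygon (n : ℕ) (hn : 2 ≤ n) (q : ℕ → ℂ) (hper : ∀ i, q (i + 2 * n) = q i)
    (hdisj : ∀ i k, 2 ≤ k → k ≤ n →
      Disjoint (segment ℝ (q i) (q (i + 1))) (segment ℝ (q (i + k)) (q (i + k + 1))))
    (hturn : ∀ i, (q (i + 2) - q (i + 1)) / (q (i + 1) - q i) ∈ Complex.slitPlane) :
    ∏ i ∈ Finset.range (2 * n), halfTurn ((q (i + 2) - q (i + 1)) / (q (i + 1) - q i)) = -1 := by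
  -- The chords from `q i` to `q j` form a grid: `h` is the half turn when the end of the chord
  -- advances, `v` when its start does. The sides opposed in a cell are disjoint, so the four chords
  -- of the cell lie in a half plane, and the two ways across it give the same half turn.
  let h : ℕ → ℕ → ℂ := fun i j => halfTurn ((q (j + 1) - q i) / (q j - q i))
  let v : ℕ → ℕ → ℂ := fun i j => halfTurn ((q j - q (i + 1)) / (q j - q i))
  have cell : ∀ i k, 2 ≤ k → k ≤ n →
      h i (i + k) * v i (i + k + 1) = v i (i + k) * h (i + 1) (i + k) := by
    intro i k h2 hk
    obtain ⟨m, hm, hpos⟩ := exists_mul_re_pos (hdisj i k h2 hk)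
    have p00 := hpos _ (left_mem_segment ..) _ (left_mem_segment ..)
    have p01 := hpos _ (left_mem_segment ..) _ (right_mem_segment ..)
    have p10 := hpos _ (right_mem_segment ..) _ (left_mem_segment ..)
    have p11 := hpos _ (right_mem_segment ..) _ (right_mem_segment ..)
    simp only [h, v]
    rw [halfTurn_trans hm p00 p01 p11, halfTurn_trans hm p00 p10 p11]
  -- This is the half turn along the staircase from the chord (i, i + j) to (i + 1, i + j + 1), over
  -- a whole period. For j = 1 it is the turning of the polygon itself.
  let R : ℕ → ℂ := fun j => ∏ i ∈ Finset.range (2 * n), h i (i + j) * v i (i + j + 1)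
  have hR1 : R 1 = ∏ i ∈ Finset.range (2 * n),
      halfTurn ((q (i + 2) - q (i + 1)) / (q (i + 1) - q i)) := by
    refine Finset.prod_congr rfl fun i _ => ?_
    have := halfTurn_corner (hturn i)
    rw [sub_add_sub_cancel'] at this
    exact this
  have hstep : ∀ j, 1 ≤ j → j + 1 ≤ n → R (j + 1) = R j := by
    intro j h1 hj
    -- Crossing every cell the other way moves the staircase from span j + 1 to span j, after a
    -- shift of one index over the period.
    have e1 : R (j + 1) = ∏ i ∈ Finset.range (2 * n),
        v i (i + (j + 1)) * h (i + 1) (i + (j + 1)) :=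
      Finset.prod_congr rfl fun i _ => cell i (j + 1) (by omega) hj
    have e2 : ∏ i ∈ Finset.range (2 * n), h (i + 1) (i + 1 + j) =
        ∏ i ∈ Finset.range (2 * n), h i (i + j) := by
      refine prod_range_shift (f := fun i => h i (i + j)) ?_ (halfTurn_ne_zero _)
      simp only [h]
      have a1 : q (2 * n) = q 0 := by simpa using hper 0
      have a2 : q (2 * n + j) = q (0 + j) := by rw [add_comm, hper, zero_add]
      have a3 : q (2 * n + j + 1) = q (0 + j + 1) := by
        rw [show 2 * n + j + 1 = (0 + j + 1) + 2 * n by ring, hper]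
      rw [a1, a2, a3]
    rw [e1, Finset.prod_mul_distrib]
    simp only [R]
    rw [Finset.prod_mul_distrib, ← e2, mul_comm]
    congr 1
    refine Finset.prod_congr rfl fun i _ => ?_
    rw [show i + (j + 1) = i + 1 + j by ring]
  have hRn : ∀ j, 1 ≤ j → j ≤ n → R j = R 1 := by
    intro j h1
    induction j, h1 using Nat.le_induction with
    | base => intro _; rfl
    | succ j h1 ih => intro hj; rw [hstep j h1 hj, ih (by omega)]
  rw [← hR1, ← hRn n (by omega) le_rfl]
  -- antipodal symmetry
  let s : ℕ → ℂ := fun i => q (i + n) - q i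
  have hs0 : ∀ i, s i ≠ 0 := fun i h0 => by
    have := Set.disjoint_left.mp (hdisj i n hn le_rfl) (left_mem_segment ..)
    rw [← sub_eq_zero.mp h0] at this
    exact this (left_mem_segment ..)
  -- The direction of a chord determines a half turn only up to sign, but its square exactly. The
  -- squares arise by pairing the chord at `i` with its reverse at `i + n`; they telescope to the
  -- ratio of two opposite directions, which is -1.
  have hD2 : ∀ i, (h i (i + n) * v i (i + n + 1)) ^ 2 = (s (i + 1) / ‖s (i + 1)‖) / (s i / ‖s i‖) := by
    intro i
    have hb0 : q (i + n + 1) - q i ≠ 0 := fun h0 => by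
      have := Set.disjoint_left.mp (hdisj i n hn le_rfl) (left_mem_segment ..)
      rw [← sub_eq_zero.mp h0] at this
      exact this (right_mem_segment ..)
    have e1 := halfTurn_sq ((q (i + n + 1) - q i) / (q (i + n) - q i))
    have e2 := halfTurn_sq ((q (i + n + 1) - q (i + 1)) / (q (i + n + 1) - q i))
    have hs1 : s (i + 1) = q (i + n + 1) - q (i + 1) := by
      simp only [s]; rw [show i + 1 + n = i + n + 1 by ring]
    have hsi : s i = q (i + n) - q i := rfl
    have n0 : (‖s i‖ : ℂ) ≠ 0 := by exact_mod_cast (norm_pos_iff.mpr (hs0 i)).ne'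
    have n1 : (‖s (i + 1)‖ : ℂ) ≠ 0 := by exact_mod_cast (norm_pos_iff.mpr (hs0 (i + 1))).ne'
    have nb : (‖q (i + n + 1) - q i‖ : ℂ) ≠ 0 := by exact_mod_cast (norm_pos_iff.mpr hb0).ne'
    have := hs0 i
    rw [← hs1] at e2
    rw [← hsi] at e1
    rw [norm_div] at e1 e2
    push_cast at e1 e2
    simp only [h, v]
    rw [← hs1, ← hsi, mul_pow]
    set x := halfTurn ((q (i + n + 1) - q i) / s i)
    set y := halfTurn (s (i + 1) / (q (i + n + 1) - q i))
    set b := q (i + n + 1) - q i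
    have e1' : x ^ 2 = b / s i * (‖s i‖ / ‖b‖) := by
      rw [← e1]; field_simp
    have e2' : y ^ 2 = s (i + 1) / b * (‖b‖ / ‖s (i + 1)‖) := by
      rw [← e2]; field_simp
    rw [e1', e2']
    field_simp
  have hDper : ∀ i, h (n + i) (n + i + n) * v (n + i) (n + i + n + 1) =
      h i (i + n) * v i (i + n + 1) := by
    intro i
    simp only [h, v]
    have a1 : q (n + i + n) = q i := by rw [show n + i + n = i + 2 * n by ring, hper]
    have a2 : q (n + i + n + 1) = q (i + 1) := by
      rw [show n + i + n + 1 = i + 1 + 2 * n by ring, hper]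
    rw [a1, a2, show n + i = i + n by ring]
    have hm : ∀ z w u t : ℂ, (z - w) / (u - t) = (w - z) / (t - u) := fun z w u t => by
      rw [← neg_sub w z, ← neg_sub t u, neg_div_neg_eq]
    -- the two corners of the cell are exchanged
    have hc := cell i n hn le_rfl
    simp only [h, v] at hc
    rw [hc, hm (q (i + 1)), hm (q (i + 1)), mul_comm (halfTurn _), mul_comm (halfTurn _)]
  have hsplit : R n = ∏ i ∈ Finset.range n, (h i (i + n) * v i (i + n + 1)) ^ 2 := by
    simp only [R]
    rw [two_mul, Finset.prod_range_add, ← Finset.prod_mul_distrib]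
    refine Finset.prod_congr rfl fun i _ => ?_
    rw [hDper, sq]
  have hu : ∀ i, s i / ‖s i‖ ≠ 0 := fun i =>
    div_ne_zero (hs0 i) (by exact_mod_cast (norm_pos_iff.mpr (hs0 i)).ne')
  have hsn : s n = -s 0 := by
    simp only [s]
    rw [← two_mul, show q (2 * n) = q 0 by simpa using hper 0]
    simp
  rw [hsplit, Finset.prod_congr rfl fun i _ => hD2 i,
    prod_range_div_succ (f := fun i => s i / ‖s i‖) hu]
  simp only [hsn, norm_neg, neg_div]
  rw [div_self (hu 0)]

/-! ### Counterclockwise angles, corners and sectors -/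

/-- The two sides agree modulo 2π, and all three angles lie in (0, 2π]. -/
lemma ccwAngle_add (a b c : ℂ) : ccwAngle a b + ccwAngle b c = ccwAngle a c ∨
    ccwAngle a b + ccwAngle b c = ccwAngle a c + 2 * Real.pi := by
  have hpi := Real.pi_pos
  obtain ⟨k1, e1⟩ := ToricGraph.ccwAngle_eq a b
  obtain ⟨k2, e2⟩ := ToricGraph.ccwAngle_eq b c
  obtain ⟨k3, e3⟩ := ToricGraph.ccwAngle_eq a c
  have m1 := ToricGraph.ccwAngle_mem a b
  have m2 := ToricGraph.ccwAngle_mem b c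
  have m3 := ToricGraph.ccwAngle_mem a c
  have h : ccwAngle a b + ccwAngle b c = ccwAngle a c + ((k3 - k1 - k2 : ℤ) : ℝ) * (2 * Real.pi) := by
    push_cast; linarith
  have l1 : (-1 : ℝ) < ((k3 - k1 - k2 : ℤ) : ℝ) := by nlinarith
  have l2 : ((k3 - k1 - k2 : ℤ) : ℝ) < 2 := by nlinarith
  have l1' : -1 < k3 - k1 - k2 := by exact_mod_cast l1
  have l2' : k3 - k1 - k2 < 2 := by exact_mod_cast l2
  rw [h]
  rcases (by omega : k3 - k1 - k2 = 0 ∨ k3 - k1 - k2 = 1) with h0 | h0 <;> rw [h0] <;> simp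

lemma ccwAngle_self (a : ℂ) : ccwAngle a a = 2 * Real.pi := by
  have m := ToricGraph.ccwAngle_mem a a
  rcases ccwAngle_add a a a with h | h <;> linarith

lemma arg_eq_of_ccwAngle_eq {a b : ℂ} (h : ccwAngle a b = 2 * Real.pi) : a.arg = b.arg := by
  obtain ⟨k, e⟩ := ToricGraph.ccwAngle_eq a b
  exact ToricGraph.arg_eq_of_angle (k + 1) (by rw [e, h]; push_cast; ring)

lemma eq_of_exp_eq {α θ : ℝ} (hα : 0 < α ∧ α ≤ 2 * Real.pi) (hθ : 0 < θ ∧ θ ≤ 2 * Real.pi)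
    (h : Complex.exp (α * Complex.I) = Complex.exp (θ * Complex.I)) : α = θ := by
  have hpi := Real.pi_pos
  obtain ⟨n, hn⟩ := Complex.exp_eq_exp_iff_exists_int.mp h
  have hn' : α = θ + n * (2 * Real.pi) := by
    have := congrArg Complex.im hn
    simpa using this
  have l1 : (-1 : ℝ) < n := by nlinarith
  have l2 : (n : ℝ) < 1 := by nlinarith
  have l1' : -1 < n := by exact_mod_cast l1
  have l2' : n < 1 := by exact_mod_cast l2
  have : n = 0 := by omega
  simpa [this] using hn'

lemma eq_mul_exp_ccwAngle {z : ℂ} (hz : z ≠ 0) (w : ℂ) :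
    w = z * ((‖w‖ / ‖z‖ : ℝ) * Complex.exp (ccwAngle z w * Complex.I)) := by
  obtain ⟨k, e⟩ := ToricGraph.ccwAngle_eq z w
  have h1 : ccwAngle z w = w.arg - z.arg - k * (2 * Real.pi) := by linarith
  have h2 : Complex.exp (ccwAngle z w * Complex.I) =
      Complex.exp (w.arg * Complex.I) / Complex.exp (z.arg * Complex.I) := by
    rw [h1, ← Complex.exp_sub]
    push_cast
    rw [show ((w.arg : ℂ) - z.arg - k * (2 * Real.pi)) * Complex.I =
      w.arg * Complex.I - z.arg * Complex.I - k * (2 * Real.pi * Complex.I) by ring,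
      Complex.exp_sub _ (k * (2 * Real.pi * Complex.I)), Complex.exp_int_mul_two_pi_mul_I, div_one]
  have hz' : (‖z‖ : ℂ) ≠ 0 := by exact_mod_cast (norm_pos_iff.mpr hz).ne'
  rw [h2]
  conv_rhs =>
    enter [1]
    rw [← Complex.norm_mul_exp_arg_mul_I z]
  conv_lhs => rw [← Complex.norm_mul_exp_arg_mul_I w]
  push_cast
  field_simp [Complex.exp_ne_zero]

lemma ccwAngle_mul_exp {z : ℂ} (hz : z ≠ 0) {r θ : ℝ} (hr : 0 < r)
    (hθ : 0 < θ ∧ θ ≤ 2 * Real.pi) : ccwAngle z (z * (r * Complex.exp (θ * Complex.I))) = θ := by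
  have h := eq_mul_exp_ccwAngle hz (z * (r * Complex.exp (θ * Complex.I)))
  refine eq_of_exp_eq (ToricGraph.ccwAngle_mem _ _) hθ ?_
  have hz' : ‖z‖ ≠ 0 := (norm_pos_iff.mpr hz).ne'
  rw [norm_mul, norm_mul, Complex.norm_exp_ofReal_mul_I, Complex.norm_real,
    Real.norm_of_nonneg hr.le, mul_one, mul_div_cancel_left₀ _ hz'] at h
  have hr' : (r : ℂ) ≠ 0 := by exact_mod_cast hr.ne'
  exact (mul_left_cancel₀ hr' (mul_left_cancel₀ hz h)).symm

lemma ccwAngle_real_mul (z w : ℂ) {s : ℝ} (hs : 0 < s) : ccwAngle z (s * w) = ccwAngle z w := by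
  rw [ccwAngle, ccwAngle, Complex.arg_real_mul w hs]

namespace ToricGraph

variable {Λ : Submodule ℤ ℂ} {V E : Type*} (G : ToricGraph Λ V E)

lemma rev_rev (d : Dart E) : rev (rev d) = d := by simp [rev]

lemma dvec_rev (d : Dart E) : G.dvec (rev d) = -G.dvec d := by
  obtain ⟨e, b⟩ := d
  cases b <;> simp [rev, dvec]

lemma origin_rev (d : Dart E) : G.origin (rev d) = G.terminus d := rfl

lemma pos_terminus (d : Dart E) :
    G.pos (G.terminus d) = G.pos (G.origin d) + Submodule.Quotient.mk (G.dvec d) := by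
  have := G.dart_point d 1
  obtain ⟨e, b⟩ := d
  cases b
  · simp [terminus, rev, origin, dvec, G.pos_tgt]
  · simp [terminus, rev, origin, dvec, G.pos_tgt]

lemma eq_of_ccwAngle_eq {a b : Dart E} (ho : G.origin a = G.origin b)
    (h : ccwAngle (G.dvec a) (G.dvec b) = 2 * Real.pi) : a = b :=
  G.eq_of_arg_eq ho (arg_eq_of_ccwAngle_eq h)

variable [Fintype E]

@[simp] lemma origin_rot (d : Dart E) : G.origin (G.rot d) = G.origin d := G.origin_next d

/-- The angle of the corner between `d` and the next oriented edge around the origin of `d`. -/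
noncomputable def cornerAngle (d : Dart E) : ℝ := ccwAngle (G.dvec d) (G.dvec (G.rot d))

lemma cornerAngle_le (d : Dart E) {c : Dart E} (hc : G.origin c = G.origin d) :
    G.cornerAngle d ≤ ccwAngle (G.dvec d) (G.dvec c) := G.next_le d hc

lemma cornerAngle_mem (d : Dart E) : 0 < G.cornerAngle d ∧ G.cornerAngle d ≤ 2 * Real.pi :=
  ccwAngle_mem _ _

lemma cornerAngle_eq_two_pi {d : Dart E} (h : G.cornerAngle d = 2 * Real.pi) : G.rot d = d :=
  (G.eq_of_ccwAngle_eq (G.origin_rot d).symm h).symm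

lemma dvec_rot (d : Dart E) : G.dvec (G.rot d) = G.dvec d *
    ((‖G.dvec (G.rot d)‖ / ‖G.dvec d‖ : ℝ) * Complex.exp (G.cornerAngle d * Complex.I)) :=
  eq_mul_exp_ccwAngle (G.dvec_ne_zero d) _

/-- `p` is in the open sector of the corner following `d`. -/
def InSector (d : Dart E) (p : ℂ) : Prop := ccwAngle (G.dvec d) p < G.cornerAngle d ∧ p ≠ 0

/-- The ray of `d` itself has angle 2π rather than 0, so it is excluded even when the corner is a
full turn and its sector is a slit plane. -/
lemma not_inSector_of_dart {d c : Dart E} (hc : G.origin c = G.origin d) {s : ℝ} (hs : 0 ≤ s) :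
    ¬ G.InSector d (s * G.dvec c) := by
  rintro ⟨h, h0⟩
  rcases hs.eq_or_lt with rfl | hs
  · simp at h0
  · rw [ccwAngle_real_mul _ _ hs] at h
    exact absurd (G.cornerAngle_le d hc) (not_le.mpr h)

/-- The sectors at a vertex are disjoint. -/
lemma InSector.eq {d c : Dart E} (hc : G.origin c = G.origin d) {p : ℂ} (hd : G.InSector d p)
    (hc' : G.InSector c p) : c = d := by
  have h1 := G.cornerAngle_le d hc
  have h2 := G.cornerAngle_le c hc.symm
  have m1 := ccwAngle_mem (G.dvec d) (G.dvec c)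
  have m2 := ccwAngle_mem (G.dvec c) (G.dvec d)
  have m3 := ccwAngle_mem (G.dvec c) p
  have m4 := ccwAngle_mem (G.dvec d) p
  have l1 := hd.1
  have l2 := hc'.1
  refine G.eq_of_ccwAngle_eq hc ?_
  rcases ccwAngle_add (G.dvec d) (G.dvec c) p with a1 | a1 <;>
    rcases ccwAngle_add (G.dvec c) (G.dvec d) p with a2 | a2 <;> linarith

lemma inSector_mul_exp {d : Dart E} {r θ : ℝ} (hr : 0 < r) (h0 : 0 < θ)
    (h1 : θ < G.cornerAngle d) : G.InSector d (G.dvec d * (r * Complex.exp (θ * Complex.I))) := by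
  refine ⟨?_, by simp [hr.ne', G.dvec_ne_zero d]⟩
  rwa [ccwAngle_mul_exp (G.dvec_ne_zero d) hr ⟨h0, (h1.trans_le (G.cornerAngle_mem d).2).le⟩]

end ToricGraph

/-! ### Legs: segments pushed off the half edges into a corner -/

open Filter

/-- A segment from a point at distance `κ * ε` of 0 and argument `b` to a point close to `1 / 2`,
in the upper half plane. -/
noncomputable def legCoord (κ b ε t : ℝ) : ℂ :=
  (1 - t) * (κ * ε * Complex.exp (b * Complex.I)) + t * (1 / 2 + ε * Complex.I)

lemma legCoord_im (κ b ε t : ℝ) :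
    (legCoord κ b ε t).im = (1 - t) * (κ * ε * Real.sin b) + t * ε := by
  rw [legCoord, Complex.exp_mul_I]
  simp [← Complex.ofReal_cos, ← Complex.ofReal_sin]

lemma legCoord_re (κ b ε t : ℝ) :
    (legCoord κ b ε t).re = (1 - t) * (κ * ε * Real.cos b) + t * (1 / 2) := by
  rw [legCoord, Complex.exp_mul_I]
  simp [← Complex.ofReal_cos, ← Complex.ofReal_sin]

lemma continuous_legCoord (κ b : ℝ) : Continuous fun p : ℝ × ℝ => legCoord κ b p.1 p.2 := by
  unfold legCoord
  fun_prop

lemma legCoord_zero (κ b t : ℝ) : legCoord κ b 0 t = ((t / 2 : ℝ) : ℂ) := by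
  rw [legCoord]; push_cast; ring

/-- The alternative says that the argument lies in (0, π]. The negative real axis is reached only at
t = 0 and b = π, the corner of a vertex with a single oriented edge. -/
lemma legCoord_half_plane {κ b ε t : ℝ} (hκ : 0 < κ) (hb : 0 < b ∧ b ≤ Real.pi) (hε : 0 < ε)
    (ht : t ∈ Set.Icc (0 : ℝ) 1) :
    0 < (legCoord κ b ε t).im ∨ (legCoord κ b ε t).im = 0 ∧ (legCoord κ b ε t).re < 0 := by
  rw [legCoord_im, legCoord_re]
  have h1 : 0 ≤ 1 - t := by linarith [ht.2]
  rcases ht.1.eq_or_lt with rfl | h0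
  · rcases hb.2.eq_or_lt with rfl | hlt
    · right
      simp only [Real.sin_pi, Real.cos_pi]
      constructor
      · ring
      · have := mul_pos hκ hε
        linarith
    · left
      have := mul_pos (mul_pos hκ hε) (Real.sin_pos_of_pos_of_lt_pi hb.1 hlt)
      linarith
  · left
    have h2 : 0 ≤ κ * ε * Real.sin b :=
      mul_nonneg (mul_pos hκ hε).le (Real.sin_nonneg_of_nonneg_of_le_pi hb.1.le hb.2)
    have := mul_nonneg h1 h2
    have := mul_pos h0 hε
    linarith

lemma eventually_legCoord {κ b : ℝ} (hκ : 0 < κ) (hb : 0 < b ∧ b ≤ Real.pi) :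
    ∀ᶠ ε in 𝓝[>] (0 : ℝ), ∀ t ∈ Set.Icc (0 : ℝ) 1, ∃ r θ : ℝ, 0 < r ∧ 0 < θ ∧ θ ≤ b ∧
      legCoord κ b ε t = r * Complex.exp (θ * Complex.I) := by
  -- The second inequality says that the end point 1/2 + εi is not beyond the ray of argument `b`;
  -- then the whole segment stays on the near side.
  have hev : ∀ᶠ ε in 𝓝[>] (0 : ℝ), 0 < ε ∧ ε * Real.cos b ≤ 1 / 2 * Real.sin b := by
    rcases hb.2.eq_or_lt with rfl | hlt
    · filter_upwards [self_mem_nhdsWithin] with ε (hε : 0 < ε)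
      refine ⟨hε, ?_⟩
      simp only [Real.sin_pi, Real.cos_pi]
      linarith
    · have hs := Real.sin_pos_of_pos_of_lt_pi hb.1 hlt
      filter_upwards [Ioo_mem_nhdsGT (show (0 : ℝ) < 1 / 2 * Real.sin b by linarith)] with ε hε
      refine ⟨hε.1, ?_⟩
      have := mul_le_of_le_one_right hε.1.le (Real.cos_le_one b)
      linarith [hε.2]
  filter_upwards [hev] with ε hε t ht
  set ζ := legCoord κ b ε t with hζ
  have hhp := legCoord_half_plane hκ hb hε.1 ht
  rw [← hζ] at hhp
  have hζ0 : ζ ≠ 0 := by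
    intro h
    rw [h] at hhp
    simp at hhp
  have hpos : 0 < ζ.arg := by
    refine lt_of_le_of_ne (Complex.arg_nonneg_iff.mpr ?_) fun h => ?_
    · rcases hhp with h | h
      · exact h.le
      · exact h.1.ge
    · have := Complex.arg_eq_zero_iff.mp h.symm
      rcases hhp with h | h <;> linarith
  have hr : 0 < ‖ζ‖ := norm_pos_iff.mpr hζ0
  refine ⟨‖ζ‖, ζ.arg, hr, hpos, ?_, (Complex.norm_mul_exp_arg_mul_I ζ).symm⟩
  by_contra! hlt
  have hsin : 0 < Real.sin (ζ.arg - b) :=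
    Real.sin_pos_of_pos_of_lt_pi (by linarith) (by linarith [Complex.arg_le_pi ζ])
  have hre : ζ.re = ‖ζ‖ * Real.cos ζ.arg := (Complex.norm_mul_cos_arg ζ).symm
  have him : ζ.im = ‖ζ‖ * Real.sin ζ.arg := (Complex.norm_mul_sin_arg ζ).symm
  have h1 : 0 < ζ.im * Real.cos b - ζ.re * Real.sin b := by
    rw [hre, him]
    rw [Real.sin_sub] at hsin
    nlinarith
  rw [hζ, legCoord_re, legCoord_im] at h1
  have h2 : 0 ≤ t * (1 / 2 * Real.sin b - ε * Real.cos b) :=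
    mul_nonneg ht.1 (by linarith [hε.2])
  linarith

namespace ToricGraph

variable {Λ : Submodule ℤ ℂ} {V E : Type*} (G : ToricGraph Λ V E)

lemma norm_ratio_pos (a b : Dart E) : 0 < ‖G.dvec a‖ / ‖G.dvec b‖ :=
  div_pos (norm_pos_iff.mpr (G.dvec_ne_zero _)) (norm_pos_iff.mpr (G.dvec_ne_zero _))

variable [Fintype E]

/-- `L ε`, for small positive `ε`, is a path in the sector of the corner `f` based at `z`, and it
tends to the half of the edge `g` based at `z`. -/
structure IsLeg (z : ℂ) (f g : Dart E) (L : ℝ → ℝ → ℂ) : Prop where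
  continuous : Continuous fun p : ℝ × ℝ => L p.1 p.2
  zero : ∀ t, L 0 t = z + ((t / 2 : ℝ) : ℂ) * G.dvec g
  inSector : ∀ᶠ ε in 𝓝[>] (0 : ℝ), ∀ t ∈ Set.Icc (0 : ℝ) 1, G.InSector f (L ε t - z)

lemma half_cornerAngle_mem (d : Dart E) :
    0 < G.cornerAngle d / 2 ∧ G.cornerAngle d / 2 ≤ Real.pi := by
  have := G.cornerAngle_mem d
  constructor <;> linarith

/-- The leg on the left of `d`. -/
noncomputable def leftLeg (z : ℂ) (d : Dart E) (ε t : ℝ) : ℂ :=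
  z + G.dvec d * legCoord 1 (G.cornerAngle d / 2) ε t

/-- The leg on the right of `rot f`. -/
noncomputable def rightLeg (z : ℂ) (f : Dart E) (ε t : ℝ) : ℂ :=
  z + G.dvec (G.rot f) * (starRingEnd ℂ)
    (legCoord (‖G.dvec f‖ / ‖G.dvec (G.rot f)‖) (G.cornerAngle f / 2) ε t)

lemma isLeg_leftLeg (z : ℂ) (d : Dart E) : G.IsLeg z d d (G.leftLeg z d) where
  continuous := by
    have := continuous_legCoord 1 (G.cornerAngle d / 2)
    unfold leftLeg
    fun_prop
  zero t := by rw [leftLeg, legCoord_zero, mul_comm]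
  inSector := by
    filter_upwards [eventually_legCoord one_pos (G.half_cornerAngle_mem d)] with ε hε t ht
    obtain ⟨r, θ, hr, hθ, hθb, h⟩ := hε t ht
    rw [leftLeg, add_sub_cancel_left, h]
    exact G.inSector_mul_exp hr hθ (by linarith [(G.cornerAngle_mem d).1])

lemma isLeg_rightLeg (z : ℂ) (f : Dart E) : G.IsLeg z f (G.rot f) (G.rightLeg z f) where
  continuous := by
    have := continuous_legCoord (‖G.dvec f‖ / ‖G.dvec (G.rot f)‖) (G.cornerAngle f / 2)
    unfold rightLeg
    exact continuous_const.add (continuous_const.mul (Complex.continuous_conj.comp this))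
  zero t := by rw [rightLeg, legCoord_zero, mul_comm, Complex.conj_ofReal]
  inSector := by
    filter_upwards [eventually_legCoord (G.norm_ratio_pos f (G.rot f))
      (G.half_cornerAngle_mem f)] with ε hε t ht
    obtain ⟨r, θ, hr, hθ, hθb, h⟩ := hε t ht
    have hr0 := G.norm_ratio_pos (G.rot f) f
    have h2 : G.rightLeg z f ε t - z = G.dvec f * ((‖G.dvec (G.rot f)‖ / ‖G.dvec f‖ * r : ℝ) *
        Complex.exp ((G.cornerAngle f - θ : ℝ) * Complex.I)) := by
      rw [rightLeg, add_sub_cancel_left, h, map_mul, Complex.conj_ofReal, ← Complex.exp_conj]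
      nth_rewrite 1 [G.dvec_rot f]
      simp only [map_mul, Complex.conj_ofReal, Complex.conj_I]
      push_cast
      rw [sub_mul, sub_eq_add_neg, Complex.exp_add, ← mul_neg]
      ring
    rw [h2]
    exact G.inSector_mul_exp (mul_pos hr0 hr) (by linarith [(G.cornerAngle_mem f).1])
      (by linarith)

variable {G}

/-- At ε = 0 the leg is a half edge, which avoids the closed set; compactness of [0, 1] makes the
choice of ε uniform in `t`. -/
lemma IsLeg.eventually_notMem {z : ℂ} {f g : Dart E} {L : ℝ → ℝ → ℂ} (h : G.IsLeg z f g L)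
    {X : Set ℂ} (hX : IsClosed X)
    (hd : ∀ s ∈ Set.Icc (0 : ℝ) (1 / 2), z + (s : ℂ) * G.dvec g ∉ X) :
    ∀ᶠ ε in 𝓝[>] (0 : ℝ), ∀ t ∈ Set.Icc (0 : ℝ) 1, L ε t ∉ X := by
  refine Filter.Eventually.filter_mono nhdsWithin_le_nhds ?_
  refine isCompact_Icc.eventually_forall_of_forall_eventually fun t ht => ?_
  refine (h.continuous.tendsto (0, t)).eventually (hX.isOpen_compl.mem_nhds ?_)
  rw [h.zero]
  exact hd _ ⟨by linarith [ht.1], by linarith [ht.2]⟩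

lemma IsLeg.eventually_ne {z z' : ℂ} {f g f' g' : Dart E} {L L' : ℝ → ℝ → ℂ}
    (h : G.IsLeg z f g L) (h' : G.IsLeg z' f' g' L')
    (hd : ∀ s ∈ Set.Icc (0 : ℝ) (1 / 2), ∀ s' ∈ Set.Icc (0 : ℝ) (1 / 2),
      z + (s : ℂ) * G.dvec g ≠ z' + (s' : ℂ) * G.dvec g') :
    ∀ᶠ ε in 𝓝[>] (0 : ℝ), ∀ t ∈ Set.Icc (0 : ℝ) 1, ∀ s ∈ Set.Icc (0 : ℝ) 1, L ε t ≠ L' ε s := by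
  have key : ∀ᶠ ε in 𝓝[>] (0 : ℝ), ∀ p ∈ Set.Icc (0 : ℝ) 1 ×ˢ Set.Icc (0 : ℝ) 1,
      L ε p.1 ≠ L' ε p.2 := by
    refine Filter.Eventually.filter_mono nhdsWithin_le_nhds ?_
    refine (isCompact_Icc.prod isCompact_Icc).eventually_forall_of_forall_eventually fun p hp => ?_
    have hc : Continuous fun x : ℝ × ℝ × ℝ => L x.1 x.2.1 - L' x.1 x.2.2 :=
      (h.continuous.comp (by fun_prop : Continuous fun x : ℝ × ℝ × ℝ => (x.1, x.2.1))).sub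
        (h'.continuous.comp (by fun_prop : Continuous fun x : ℝ × ℝ × ℝ => (x.1, x.2.2)))
    have h0 : L 0 p.1 - L' 0 p.2 ≠ 0 := by
      rw [h.zero, h'.zero, sub_ne_zero]
      exact hd _ ⟨by linarith [hp.1.1], by linarith [hp.1.2]⟩ _
        ⟨by linarith [hp.2.1], by linarith [hp.2.2]⟩
    filter_upwards [(hc.tendsto (0, p)).eventually (isOpen_ne.mem_nhds h0)] with x hx
    exact sub_ne_zero.mp hx
  filter_upwards [key] with ε hε t ht s hs
  exact hε (t, s) ⟨ht, hs⟩

lemma IsLeg.eventually_ne_of_inSector {z : ℂ} {f g f' g' : Dart E} {L L' : ℝ → ℝ → ℂ}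
    (h : G.IsLeg z f g L) (h' : G.IsLeg z f' g' L') (ho : G.origin f = G.origin f')
    (hne : f ≠ f') :
    ∀ᶠ ε in 𝓝[>] (0 : ℝ), ∀ t ∈ Set.Icc (0 : ℝ) 1, ∀ s ∈ Set.Icc (0 : ℝ) 1, L ε t ≠ L' ε s := by
  filter_upwards [h.inSector, h'.inSector] with ε h1 h2 t ht s hs heq
  refine hne (InSector.eq G ho (h2 s hs) ?_)
  rw [← heq]
  exact h1 t ht

end ToricGraph

/-! ### The lifted graph in the plane and its complement -/

/-- Any subset of a translate of a discrete subgroup is closed. This keeps infinite families of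
lifted vertices or edges at a positive distance from a given point. -/
lemma isClosed_of_mk_eq {Λ : Submodule ℤ ℂ} [DiscreteTopology Λ] {P : Set ℂ} {a : ℂ ⧸ Λ}
    (hP : ∀ p ∈ P, Submodule.Quotient.mk p = a) : IsClosed P := by
  have hΛ : IsClosed (Λ : Set ℂ) := AddSubgroup.isClosed_of_discrete (H := Λ.toAddSubgroup)
  obtain ⟨w, rfl⟩ := Submodule.Quotient.mk_surjective Λ a
  have h : P = (fun z => z + w) '' (Subtype.val '' {l : Λ | (l : ℂ) + w ∈ P}) := by
    ext p
    constructor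
    · intro hp
      have hm : p - w ∈ Λ := (Submodule.Quotient.eq Λ).mp (hP p hp)
      exact ⟨p - w, ⟨⟨p - w, hm⟩, by simpa using hp, rfl⟩, by simp⟩
    · rintro ⟨_, ⟨l, hl, rfl⟩, rfl⟩
      exact hl
  rw [h]
  exact (Homeomorph.addRight w).isClosedMap _
    (hΛ.isClosedEmbedding_subtypeVal.isClosedMap _ (isClosed_discrete _))

lemma isClosed_segments {Λ : Submodule ℤ ℂ} [DiscreteTopology Λ] {P : Set ℂ} {a : ℂ ⧸ Λ}
    (hP : ∀ p ∈ P, Submodule.Quotient.mk p = a) (v : ℂ) :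
    IsClosed {p : ℂ | ∃ w ∈ P, ∃ s ∈ Set.Icc (0 : ℝ) 1, p = w + s * v} := by
  have hK : IsCompact ((fun s : ℝ => (s : ℂ) * v) '' Set.Icc 0 1) :=
    isCompact_Icc.image (by fun_prop)
  have h := (isClosed_of_mk_eq hP).add_right_of_isCompact hK
  convert h using 1
  ext p
  simp only [Set.mem_ofPred_eq, Set.mem_add, Set.mem_image]
  constructor
  · rintro ⟨w, hw, s, hs, rfl⟩
    exact ⟨w, hw, _, ⟨s, hs, rfl⟩, rfl⟩
  · rintro ⟨w, hw, _, ⟨s, hs, rfl⟩, rfl⟩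
    exact ⟨w, hw, s, hs, rfl⟩

namespace ToricGraph

variable {Λ : Submodule ℤ ℂ} {V E : Type*} (G : ToricGraph Λ V E)

/-- The union of the vertices and edges of `G`. -/
def support : Set (ℂ ⧸ Λ) := Set.range G.pos ∪ {q : ℂ ⧸ Λ | ∃ (e : E) (s : ℝ),
  s ∈ Set.Icc (0 : ℝ) 1 ∧ q = G.pos (G.src e) + Submodule.Quotient.mk (s * G.vec e)}

lemma component_disc : ∀ p ∈ G.supportᶜ,
    Nonempty (connectedComponentIn G.supportᶜ p ≃ₜ Metric.ball (0 : ℂ) 1) := G.face_disc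

/-- Every vertex of `G` has an edge. -/
lemma exists_origin_eq [Fintype V] [Fintype E] [DiscreteTopology Λ] (v : V) :
    ∃ d : Dart E, G.origin d = v := by
  by_contra! hv
  obtain ⟨w, hw⟩ := Submodule.Quotient.mk_surjective Λ (G.pos v)
  let P : E → Set ℂ := fun e => {p | (Submodule.Quotient.mk p : ℂ ⧸ Λ) = G.pos (G.src e)}
  -- The whole lifted graph except the point `w`. If no edge ends at `v`, then `w` is off this
  -- closed set, and a small circle around `w` lies in the complement of the graph.
  let X : Set ℂ := (⋃ e, {p : ℂ | ∃ w ∈ P e, ∃ s ∈ Set.Icc (0 : ℝ) 1, p = w + s * G.vec e}) ∪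
    ⋃ v' : V, {p : ℂ | (Submodule.Quotient.mk p : ℂ ⧸ Λ) = G.pos v' ∧ p ≠ w}
  have hX : IsClosed X := by
    refine IsClosed.union (isClosed_iUnion_of_finite fun e => ?_)
      (isClosed_iUnion_of_finite fun v' => ?_)
    · exact isClosed_segments (a := G.pos (G.src e)) (fun p hp => hp) _
    · exact isClosed_of_mk_eq (a := G.pos v') (fun p hp => hp.1)
  have hwX : w ∉ X := by
    rintro (h | h)
    · obtain ⟨e, u, hu, s, hs, rfl⟩ := Set.mem_iUnion.mp h
      rw [Submodule.Quotient.mk_add, show (Submodule.Quotient.mk u : ℂ ⧸ Λ) = _ from hu] at hw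
      rcases hs.1.eq_or_lt with rfl | h0
      · refine hv (e, true) (G.pos_injective ?_)
        simpa [origin] using hw
      rcases hs.2.eq_or_lt with rfl | h1
      · refine hv (e, false) (G.pos_injective ?_)
        simpa [origin, G.pos_tgt] using hw
      · exact G.edge_ne_vertex e v s ⟨h0, h1⟩ hw
    · obtain ⟨v', h⟩ := Set.mem_iUnion.mp h
      exact h.2 rfl
  obtain ⟨r, hr, hball⟩ := Metric.isOpen_iff.mp hX.isOpen_compl w hwX
  refine not_isolated_of_discs Λ G.supportᶜ G.component_disc w
    (fun h => h (Or.inl ⟨v, hw.symm⟩)) (r / 2) (by linarith) fun z hz hmem => ?_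
  have hwz : w + z ∉ X := hball (by simp [hz]; linarith)
  rcases hmem with ⟨v', h⟩ | ⟨e, s, hs, h⟩
  · refine hwz (Or.inr (Set.mem_iUnion.mpr ⟨v', h.symm, fun h0 => ?_⟩))
    have : z = 0 := by simpa using h0
    rw [this] at hz
    simp at hz
    linarith
  · refine hwz (Or.inl (Set.mem_iUnion.mpr ⟨e, w + z - s * G.vec e, ?_, s, hs, by ring⟩))
    change (Submodule.Quotient.mk _ : ℂ ⧸ Λ) = _
    rw [Submodule.Quotient.mk_sub, h, add_sub_cancel_right]

/-- The set of lifts of the origin of `d` to the plane. -/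
def lifts (d : Dart E) : Set ℂ := {z | (Submodule.Quotient.mk z : ℂ ⧸ Λ) = G.pos (G.origin d)}

variable {G}

lemma mem_lifts {d : Dart E} {z : ℂ} :
    z ∈ G.lifts d ↔ (Submodule.Quotient.mk z : ℂ ⧸ Λ) = G.pos (G.origin d) := Iff.rfl

lemma add_dvec_mem_lifts {d : Dart E} {z : ℂ} (hz : z ∈ G.lifts d) :
    z + G.dvec d ∈ G.lifts (rev d) := by
  rw [mem_lifts] at *
  rw [Submodule.Quotient.mk_add, hz, origin_rev, pos_terminus]

lemma mem_lifts_congr {d c : Dart E} (h : G.origin d = G.origin c) {z : ℂ} :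
    z ∈ G.lifts d ↔ z ∈ G.lifts c := by
  rw [mem_lifts, mem_lifts, h]

lemma origin_eq_of_mem_lifts {d c : Dart E} {z : ℂ} (hd : z ∈ G.lifts d) (hc : z ∈ G.lifts c) :
    G.origin d = G.origin c :=
  G.pos_injective (hd.symm.trans hc)

lemma exists_of_mk_mem_support [Fintype V] [Fintype E] [DiscreteTopology Λ] {p : ℂ}
    (hp : (Submodule.Quotient.mk p : ℂ ⧸ Λ) ∈ G.support) :
    ∃ d, ∃ w ∈ G.lifts d, ∃ s ∈ Set.Icc (0 : ℝ) 1, p = w + s * G.dvec d := by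
  rcases hp with ⟨v, h⟩ | ⟨e, s, hs, h⟩
  · obtain ⟨d, rfl⟩ := G.exists_origin_eq v
    exact ⟨d, p, h.symm, 0, by simp, by simp⟩
  · refine ⟨(e, true), p - s * G.vec e, ?_, s, hs, by simp [dvec]⟩
    rw [mem_lifts, Submodule.Quotient.mk_sub, h, add_sub_cancel_right]
    rfl

/-- A point in the interior of two lifted edges. -/
lemma eq_of_interior {d d' : Dart E} {z z' : ℂ} (hz : z ∈ G.lifts d) (hz' : z' ∈ G.lifts d')
    {s s' : ℝ} (hs : s ∈ Set.Ioo (0 : ℝ) 1) (hs' : s' ∈ Set.Ioo (0 : ℝ) 1)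
    (h : z + s * G.dvec d = z' + s' * G.dvec d') :
    d = d' ∧ s = s' ∧ z = z' ∨ d' = rev d ∧ s + s' = 1 ∧ z' = z + G.dvec d := by
  have hm := congrArg (Submodule.Quotient.mk : ℂ → ℂ ⧸ Λ) h
  rw [Submodule.Quotient.mk_add, Submodule.Quotient.mk_add, hz, hz', G.dart_point,
    G.dart_point] at hm
  have hI : ∀ (b : Bool) (s : ℝ), s ∈ Set.Ioo (0 : ℝ) 1 →
      (if b then s else 1 - s) ∈ Set.Ioo (0 : ℝ) 1 := by
    rintro (_ | _) s ⟨h1, h2⟩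
    · simp [h1, h2]
    · simp [h1, h2]
  obtain ⟨he, hst⟩ := G.edge_injective _ _ _ (hI _ _ hs) _ (hI _ _ hs') hm
  obtain ⟨e, b⟩ := d
  obtain ⟨e', b'⟩ := d'
  obtain rfl : e = e' := he
  cases b <;> cases b' <;> simp at hst
  · subst hst
    left
    exact ⟨rfl, rfl, by simpa using h⟩
  · right
    have hd : G.dvec (e, true) = -G.dvec (e, false) := by simp [dvec]
    refine ⟨rfl, by linarith, ?_⟩
    have hz1 : z' = z + s * G.dvec (e, false) - s' * G.dvec (e, true) := by rw [h]; ring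
    rw [hz1, hd, ← hst]; push_cast; ring
  · right
    have hd : G.dvec (e, false) = -G.dvec (e, true) := by simp [dvec]
    refine ⟨rfl, by linarith, ?_⟩
    have hz1 : z' = z + s * G.dvec (e, true) - s' * G.dvec (e, false) := by rw [h]; ring
    rw [hz1, hd, hst]; push_cast; ring
  · subst hst
    left
    exact ⟨rfl, rfl, by simpa using h⟩

lemma interior_notMem_lifts {d d' : Dart E} {z z' : ℂ} (hz : z ∈ G.lifts d) (hz' : z' ∈ G.lifts d')
    {s : ℝ} (hs : s ∈ Set.Ioo (0 : ℝ) 1) : z + s * G.dvec d ≠ z' := by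
  intro h
  have hm := congrArg (Submodule.Quotient.mk : ℂ → ℂ ⧸ Λ) h
  rw [Submodule.Quotient.mk_add, hz, hz', G.dart_point] at hm
  refine G.edge_ne_vertex d.1 (G.origin d') _ ?_ hm
  obtain ⟨e, b⟩ := d
  obtain ⟨h1, h2⟩ := hs
  cases b <;> simp [h1, h2]

/-- Half edges with distinct origins meet only if they are the halves of an edge. -/
lemma half_edges_ne {d d' : Dart E} {z z' : ℂ} (hz : z ∈ G.lifts d) (hz' : z' ∈ G.lifts d')
    (hne : z ≠ z') (hrev : ¬ (d' = rev d ∧ z' = z + G.dvec d)) {s s' : ℝ}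
    (hs : s ∈ Set.Icc (0 : ℝ) (1 / 2)) (hs' : s' ∈ Set.Icc (0 : ℝ) (1 / 2)) :
    z + s * G.dvec d ≠ z' + s' * G.dvec d' := by
  intro h
  rcases hs.1.eq_or_lt with rfl | h0
  · rcases hs'.1.eq_or_lt with rfl | h0'
    · exact hne (by simpa using h)
    · exact interior_notMem_lifts hz' hz ⟨h0', by linarith [hs'.2]⟩ (by rw [← h]; simp)
  · rcases hs'.1.eq_or_lt with rfl | h0'
    · exact interior_notMem_lifts hz hz' ⟨h0, by linarith [hs.2]⟩ (by rw [h]; simp)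
    · rcases eq_of_interior hz hz' ⟨h0, by linarith [hs.2]⟩ ⟨h0', by linarith [hs'.2]⟩ h with h1 | h1
      · exact hne h1.2.2
      · exact hrev ⟨h1.1, h1.2.2⟩

lemma half_edge_notMem {d d' : Dart E} {z w : ℂ} (hz : z ∈ G.lifts d) (hw : w ∈ G.lifts d')
    (h1 : w ≠ z) (h2 : w + G.dvec d' ≠ z) {s s' : ℝ}
    (hs : s ∈ Set.Icc (0 : ℝ) (1 / 2)) (hs' : s' ∈ Set.Icc (0 : ℝ) 1) :
    z + s * G.dvec d ≠ w + s' * G.dvec d' := by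
  intro h
  rcases hs.1.eq_or_lt with rfl | h0
  · simp only [Complex.ofReal_zero, zero_mul, add_zero] at h
    rcases hs'.1.eq_or_lt with rfl | h0'
    · exact h1 (by simpa using h.symm)
    rcases hs'.2.eq_or_lt with rfl | h1'
    · exact h2 (by simpa using h.symm)
    · exact interior_notMem_lifts hw hz ⟨h0', h1'⟩ h.symm
  · have hI : s ∈ Set.Ioo (0 : ℝ) 1 := ⟨h0, by linarith [hs.2]⟩
    rcases hs'.1.eq_or_lt with rfl | h0'
    · exact interior_notMem_lifts hz hw hI (by rw [h]; simp)
    rcases hs'.2.eq_or_lt with rfl | h1'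
    · exact interior_notMem_lifts hz (add_dvec_mem_lifts hw) hI (by rw [h]; simp)
    · rcases eq_of_interior hz hw hI ⟨h0', h1'⟩ h with h3 | h3
      · exact h1 h3.2.2.symm
      · refine h2 ?_
        rw [h3.2.2, h3.1, dvec_rev]; ring

/-- Legs close to the graph are disjoint from it. -/
lemma IsLeg.eventually_notMem_support [Fintype V] [Fintype E] [DiscreteTopology Λ] {z : ℂ}
    {f g : Dart E} {L : ℝ → ℝ → ℂ} (h : G.IsLeg z f g L) (hf : z ∈ G.lifts f)
    (hg : z ∈ G.lifts g) :
    ∀ᶠ ε in 𝓝[>] (0 : ℝ), ∀ t ∈ Set.Icc (0 : ℝ) 1,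
      (Submodule.Quotient.mk (L ε t) : ℂ ⧸ Λ) ∈ G.supportᶜ := by
  -- Lifted edges without an end at `z` form a closed set disjoint from the limiting half edge.
  -- Those with an end at `z` are radial there, hence avoid the open sector.
  let P : Dart E → Set ℂ := fun d => {w | w ∈ G.lifts d ∧ w ≠ z ∧ w + G.dvec d ≠ z}
  let X : Set ℂ := ⋃ d, {p : ℂ | ∃ w ∈ P d, ∃ s ∈ Set.Icc (0 : ℝ) 1, p = w + s * G.dvec d}
  have hX : IsClosed X := isClosed_iUnion_of_finite fun d =>
    isClosed_segments (a := G.pos (G.origin d)) (fun p hp => hp.1) _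
  filter_upwards [h.inSector, h.eventually_notMem hX fun s hs hmem => by
    obtain ⟨d, w, hw, s', hs', h⟩ := Set.mem_iUnion.mp hmem
    exact half_edge_notMem hg hw.1 hw.2.1 hw.2.2 hs hs' h] with ε h1 h2 t ht hmem
  obtain ⟨d, w, hw, s, hs, hp⟩ := exists_of_mk_mem_support hmem
  by_cases hwz : w = z
  · refine G.not_inSector_of_dart (d := f) (c := d) ?_ hs.1 ?_
    · exact origin_eq_of_mem_lifts (hwz ▸ hw) hf
    · have := h1 t ht
      rwa [hp, hwz, add_sub_cancel_left] at this
  by_cases hwz' : w + G.dvec d = z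
  · refine G.not_inSector_of_dart (d := f) (c := rev d) (s := 1 - s) ?_ (by linarith [hs.2]) ?_
    · exact origin_eq_of_mem_lifts (hwz' ▸ add_dvec_mem_lifts hw) hf
    · have := h1 t ht
      rw [hp, ← hwz'] at this
      convert this using 1
      rw [dvec_rev]; push_cast; ring
  · exact h2 t ht (Set.mem_iUnion.mpr ⟨d, w, ⟨hw, hwz, hwz'⟩, s, hs, hp⟩)

end ToricGraph

/-! ### The polygon close to the boundary of a face -/

lemma halfTurn_mul_exp {r θ : ℝ} (hr : 0 < r) (hθ : θ ∈ Set.Ioc (-Real.pi) Real.pi) :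
    halfTurn (r * Complex.exp (θ * Complex.I)) = Complex.exp ((θ / 2 : ℝ) * Complex.I) := by
  rw [halfTurn, Complex.exp_mul_I (θ : ℂ), Complex.arg_mul_cos_add_sin_mul_I hr hθ]

lemma mul_exp_mem_slitPlane {r θ : ℝ} (hr : 0 < r) (hθ : θ ∈ Set.Ioo (-Real.pi) Real.pi) :
    r * Complex.exp (θ * Complex.I) ∈ Complex.slitPlane := by
  rw [Complex.mem_slitPlane_iff_arg, Complex.exp_mul_I,
    Complex.arg_mul_cos_add_sin_mul_I hr ⟨hθ.1, hθ.2.le⟩, ← Complex.exp_mul_I]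
  exact ⟨hθ.2.ne, mul_ne_zero (by exact_mod_cast hr.ne') (Complex.exp_ne_zero _)⟩

lemma continuousAt_halfTurn {z : ℂ} (hz : z ∈ Complex.slitPlane) : ContinuousAt halfTurn z := by
  have h := Complex.continuousAt_arg hz
  have h2 : ContinuousAt (fun z : ℂ => ((z.arg / 2 : ℝ) : ℂ) * Complex.I) z :=
    (Complex.continuous_ofReal.continuousAt.comp (h.div_const 2)).mul continuousAt_const
  exact Complex.continuous_exp.continuousAt.comp h2

lemma exists_isPreconnected_chain {A : Set ℂ} (q : ℕ → ℂ) (h0 : q 0 ∈ A) (m : ℕ)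
    (h : ∀ k < m, segment ℝ (q k) (q (k + 1)) ⊆ A) :
    ∃ S ⊆ A, IsPreconnected S ∧ q 0 ∈ S ∧ q m ∈ S := by
  induction m with
  | zero => exact ⟨{q 0}, by simpa using h0, isPreconnected_singleton, rfl, rfl⟩
  | succ m ih =>
    obtain ⟨S, hSA, hS, h1, h2⟩ := ih fun k hk => h k (by omega)
    exact ⟨S ∪ segment ℝ (q m) (q (m + 1)), Set.union_subset hSA (h m (by omega)),
      hS.union (q m) h2 (left_mem_segment ..) (convex_segment _ _).isPreconnected, Or.inl h1,
      Or.inr (right_mem_segment ..)⟩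

lemma prod_range_two_mul' (f : ℕ → ℂ) (n : ℕ) :
    ∏ i ∈ Finset.range (2 * n), f i = ∏ i ∈ Finset.range n, f (2 * i) * f (2 * i + 1) := by
  induction n with
  | zero => simp
  | succ n ih =>
    rw [show 2 * (n + 1) = 2 * n + 1 + 1 by ring, Finset.prod_range_succ, Finset.prod_range_succ,
      Finset.prod_range_succ, ih, mul_assoc]

namespace ToricGraph

variable {Λ : Submodule ℤ ℂ} {V E : Type*} (G : ToricGraph Λ V E) [Fintype E]

lemma legCoord_affine (κ b ε t : ℝ) :
    legCoord κ b ε t = (1 - t) * legCoord κ b ε 0 + t * legCoord κ b ε 1 := by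
  simp only [legCoord]; push_cast; ring

lemma exists_leftLeg {z : ℂ} {d : Dart E} {ε : ℝ} {p : ℂ}
    (hp : p ∈ segment ℝ (G.leftLeg z d ε 0) (G.leftLeg z d ε 1)) :
    ∃ t ∈ Set.Icc (0 : ℝ) 1, p = G.leftLeg z d ε t := by
  rw [segment_eq_image] at hp
  obtain ⟨t, ht, rfl⟩ := hp
  refine ⟨t, ht, ?_⟩
  simp only [leftLeg, Complex.real_smul]
  rw [legCoord_affine _ _ _ t]
  push_cast
  ring

lemma exists_rightLeg {z : ℂ} {f : Dart E} {ε : ℝ} {p : ℂ}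
    (hp : p ∈ segment ℝ (G.rightLeg z f ε 0) (G.rightLeg z f ε 1)) :
    ∃ t ∈ Set.Icc (0 : ℝ) 1, p = G.rightLeg z f ε t := by
  rw [segment_eq_image] at hp
  obtain ⟨t, ht, rfl⟩ := hp
  refine ⟨t, ht, ?_⟩
  simp only [rightLeg, Complex.real_smul]
  rw [legCoord_affine _ _ _ t, map_add, map_mul, map_mul, map_sub, map_one, Complex.conj_ofReal]
  push_cast
  ring

/-- A point close to the corner following `d`. -/
noncomputable def cornerPoint (z : ℂ) (d : Dart E) (ε : ℝ) : ℂ :=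
  z + G.dvec d * (ε * Complex.exp ((G.cornerAngle d / 2 : ℝ) * Complex.I))

/-- A point on the left of the midpoint of `d`. -/
noncomputable def middlePoint (z : ℂ) (d : Dart E) (ε : ℝ) : ℂ :=
  z + G.dvec d * (1 / 2 + ε * Complex.I)

lemma leftLeg_zero (z : ℂ) (d : Dart E) (ε : ℝ) : G.leftLeg z d ε 0 = G.cornerPoint z d ε := by
  simp [leftLeg, cornerPoint, legCoord]

lemma leftLeg_one (z : ℂ) (d : Dart E) (ε : ℝ) : G.leftLeg z d ε 1 = G.middlePoint z d ε := by
  simp [leftLeg, middlePoint, legCoord]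

/-- The ratio of lengths in the right leg is chosen for this: both legs of a corner must start at
the same point on its bisector, although each is written in the frame of its own edge. -/
lemma rightLeg_zero (z : ℂ) (f : Dart E) (ε : ℝ) : G.rightLeg z f ε 0 = G.cornerPoint z f ε := by
  have h1 : (‖G.dvec f‖ : ℂ) ≠ 0 := by exact_mod_cast (norm_pos_iff.mpr (G.dvec_ne_zero _)).ne'
  have h2 : (‖G.dvec (G.rot f)‖ : ℂ) ≠ 0 := by
    exact_mod_cast (norm_pos_iff.mpr (G.dvec_ne_zero _)).ne'
  have h3 : Complex.exp (G.cornerAngle f * Complex.I) =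
      Complex.exp ((G.cornerAngle f / 2 : ℝ) * Complex.I) ^ 2 := by
    rw [← Complex.exp_nat_mul]; congr 1; push_cast; ring
  have h4 : (starRingEnd ℂ) (Complex.exp ((G.cornerAngle f / 2 : ℝ) * Complex.I)) =
      (Complex.exp ((G.cornerAngle f / 2 : ℝ) * Complex.I))⁻¹ := by
    rw [← Complex.exp_conj, ← Complex.exp_neg, map_mul, Complex.conj_ofReal, Complex.conj_I,
      mul_neg]
  rw [rightLeg, cornerPoint]
  nth_rewrite 1 [G.dvec_rot f]
  rw [h3]
  simp only [legCoord, Complex.ofReal_zero, sub_zero, one_mul, zero_mul, add_zero, map_mul,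
    Complex.conj_ofReal, h4]
  set u := Complex.exp ((G.cornerAngle f / 2 : ℝ) * Complex.I) with hu
  have hu0 : u ≠ 0 := Complex.exp_ne_zero _
  push_cast
  field_simp

lemma rightLeg_one {z : ℂ} {f d : Dart E} (hf : G.rot f = rev d) (ε : ℝ) :
    G.rightLeg (z + G.dvec d) f ε 1 = G.middlePoint z d ε := by
  simp only [rightLeg, middlePoint, legCoord, hf, dvec_rev]
  simp only [sub_self, zero_mul, one_mul, zero_add, map_add, map_mul, Complex.conj_ofReal,
    Complex.conj_I, map_div₀, map_one, Complex.conj_ofNat, Complex.ofReal_one]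
  ring

variable {G}

/-- The legs on the left of the two orientations of an edge are disjoint. -/
lemma leftLeg_ne_opposite {z : ℂ} {d : Dart E} {ε : ℝ} (hε : 0 < ε) {t s : ℝ}
    (ht : t ∈ Set.Icc (0 : ℝ) 1) (hs : s ∈ Set.Icc (0 : ℝ) 1) :
    G.leftLeg z d ε t ≠ G.leftLeg (z + G.dvec d) (rev d) ε s := by
  intro h
  -- In the frame of the edge, the reversed leg is the image of a leg under ζ ↦ 1 - ζ. A meeting
  -- point would force both imaginary parts to vanish and two negative real parts to have sum 1.
  simp only [leftLeg, dvec_rev] at h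
  have h1 := legCoord_half_plane one_pos (G.half_cornerAngle_mem d) hε ht
  have h2 := legCoord_half_plane one_pos (G.half_cornerAngle_mem (rev d)) hε hs
  set x := legCoord 1 (G.cornerAngle d / 2) ε t
  set y := legCoord 1 (G.cornerAngle (rev d) / 2) ε s
  have h3 : x = 1 - y := by
    refine mul_left_cancel₀ (G.dvec_ne_zero d) ?_
    linear_combination h
  have hre := congrArg Complex.re h3
  have him := congrArg Complex.im h3
  simp at hre him
  rcases h1 with h1 | h1 <;> rcases h2 with h2 | h2 <;> linarith

lemma rightLeg_ne_opposite {z : ℂ} {f f' g : Dart E} (hf : G.rot f = g) (hf' : G.rot f' = rev g)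
    {ε : ℝ} (hε : 0 < ε) {t s : ℝ}
    (ht : t ∈ Set.Icc (0 : ℝ) 1) (hs : s ∈ Set.Icc (0 : ℝ) 1) :
    G.rightLeg z f ε t ≠ G.rightLeg (z + G.dvec g) f' ε s := by
  intro h
  simp only [rightLeg, hf, hf', dvec_rev] at h
  have h1 := legCoord_half_plane (G.norm_ratio_pos f g) (G.half_cornerAngle_mem f) hε ht
  have h2 := legCoord_half_plane (G.norm_ratio_pos f' (rev g)) (G.half_cornerAngle_mem f') hε hs
  rw [dvec_rev] at h2
  set x := legCoord (‖G.dvec f‖ / ‖G.dvec g‖) (G.cornerAngle f / 2) ε t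
  set y := legCoord (‖G.dvec f'‖ / ‖-G.dvec g‖) (G.cornerAngle f' / 2) ε s
  have h3 : (starRingEnd ℂ) x = 1 - (starRingEnd ℂ) y := by
    refine mul_left_cancel₀ (G.dvec_ne_zero g) ?_
    linear_combination h
  have hre := congrArg Complex.re h3
  have him := congrArg Complex.im h3
  simp at hre him
  rcases h1 with h1 | h1 <;> rcases h2 with h2 | h2 <;> linarith

/-- Legs with the same base lie in different sectors. With different bases, their limiting half
edges are disjoint, except for the two halves of one edge, which share its midpoint. -/
lemma IsLeg.eventually_ne_of_not_opposite {z z' : ℂ} {f g f' g' : Dart E} {L L' : ℝ → ℝ → ℂ}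
    (h : G.IsLeg z f g L) (h' : G.IsLeg z' f' g' L') (hf : z ∈ G.lifts f) (hg : z ∈ G.lifts g)
    (hf' : z' ∈ G.lifts f') (hg' : z' ∈ G.lifts g') (hne : f ≠ f')
    (hop : ¬ (g' = rev g ∧ z' = z + G.dvec g)) :
    ∀ᶠ ε in 𝓝[>] (0 : ℝ), ∀ t ∈ Set.Icc (0 : ℝ) 1, ∀ s ∈ Set.Icc (0 : ℝ) 1, L ε t ≠ L' ε s := by
  by_cases hz : z = z'
  · subst hz
    exact h.eventually_ne_of_inSector h' (origin_eq_of_mem_lifts hf hf') hne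
  · exact h.eventually_ne h' fun s hs s' hs' => half_edges_ne hg hg' hz hop hs hs'

variable (G) in
/-- A lift to the plane of the walk along the boundary of the face on the left of `d 0`. -/
structure IsFaceWalk (d : ℕ → Dart E) (z : ℕ → ℂ) : Prop where
  mem_lifts : ∀ i, z i ∈ G.lifts (d i)
  rot_succ : ∀ i, G.rot (d (i + 1)) = rev (d i)
  step : ∀ i, z (i + 1) = z i + G.dvec (d i)

variable (G) in
/-- The vertices of a polygon close to a face walk. -/
noncomputable def polygon (d : ℕ → Dart E) (z : ℕ → ℂ) (ε : ℝ) (k : ℕ) : ℂ :=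
  if Even k then G.cornerPoint (z (k / 2)) (d (k / 2)) ε
  else G.middlePoint (z (k / 2)) (d (k / 2)) ε

lemma polygon_even (d : ℕ → Dart E) (z : ℕ → ℂ) (ε : ℝ) (i : ℕ) :
    G.polygon d z ε (2 * i) = G.cornerPoint (z i) (d i) ε := by
  rw [polygon, if_pos (by simp), Nat.mul_div_cancel_left _ (by norm_num)]

lemma polygon_odd (d : ℕ → Dart E) (z : ℕ → ℂ) (ε : ℝ) (i : ℕ) :
    G.polygon d z ε (2 * i + 1) = G.middlePoint (z i) (d i) ε := by
  rw [polygon, if_neg (by simp), show (2 * i + 1) / 2 = i by omega]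

lemma exists_of_mem_polygon_even {d : ℕ → Dart E} {z : ℕ → ℂ} {ε : ℝ} {i : ℕ} {p : ℂ}
    (hp : p ∈ segment ℝ (G.polygon d z ε (2 * i)) (G.polygon d z ε (2 * i + 1))) :
    ∃ t ∈ Set.Icc (0 : ℝ) 1, p = G.leftLeg (z i) (d i) ε t := by
  rw [polygon_even, polygon_odd, ← leftLeg_zero, ← leftLeg_one] at hp
  exact G.exists_leftLeg hp

namespace IsFaceWalk

variable {d : ℕ → Dart E} {z : ℕ → ℂ} (hw : G.IsFaceWalk d z)
include hw

lemma shift (j : ℕ) : G.IsFaceWalk (fun i => d (i + j)) (fun i => z (i + j)) where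
  mem_lifts i := hw.mem_lifts _
  rot_succ i := by rw [show i + 1 + j = i + j + 1 by ring]; exact hw.rot_succ _
  step i := by rw [show i + 1 + j = i + j + 1 by ring]; exact hw.step _

lemma isLeg_right (i : ℕ) :
    G.IsLeg (z (i + 1)) (d (i + 1)) (rev (d i)) (G.rightLeg (z (i + 1)) (d (i + 1))) := by
  rw [← hw.rot_succ]; exact G.isLeg_rightLeg _ _

lemma mem_lifts_rev (i : ℕ) : z (i + 1) ∈ G.lifts (rev (d i)) := by
  rw [hw.step]; exact add_dvec_mem_lifts (hw.mem_lifts i)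

lemma exists_of_mem_odd {ε : ℝ} {i : ℕ} {p : ℂ}
    (hp : p ∈ segment ℝ (G.polygon d z ε (2 * i + 1)) (G.polygon d z ε (2 * i + 1 + 1))) :
    ∃ t ∈ Set.Icc (0 : ℝ) 1, p = G.rightLeg (z (i + 1)) (d (i + 1)) ε t := by
  rw [show 2 * i + 1 + 1 = 2 * (i + 1) by ring, polygon_even, polygon_odd, ← rightLeg_zero,
    ← G.rightLeg_one (hw.rot_succ i), ← hw.step, segment_symm] at hp
  exact G.exists_rightLeg hp

lemma eventually_subset_support [Fintype V] [DiscreteTopology Λ] (k : ℕ) :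
    ∀ᶠ ε in 𝓝[>] (0 : ℝ), segment ℝ (G.polygon d z ε k) (G.polygon d z ε (k + 1)) ⊆
      {p | (Submodule.Quotient.mk p : ℂ ⧸ Λ) ∈ G.supportᶜ} := by
  obtain ⟨i, rfl | rfl⟩ := k.even_or_odd'
  · filter_upwards [(G.isLeg_leftLeg (z i) (d i)).eventually_notMem_support (hw.mem_lifts i)
      (hw.mem_lifts i)] with ε hε p hp
    obtain ⟨t, ht, rfl⟩ := exists_of_mem_polygon_even hp
    exact hε t ht
  · filter_upwards [(hw.isLeg_right i).eventually_notMem_support (hw.mem_lifts _)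
      (hw.mem_lifts_rev i)] with ε hε p hp
    obtain ⟨t, ht, rfl⟩ := hw.exists_of_mem_odd hp
    exact hε t ht

/-- As faces are discs, their boundary walks lift to closed walks. -/
lemma closed [Fintype V] [DiscreteTopology Λ] {n : ℕ} (hn : d n = d 0) : z n = z 0 := by
  have hev : ∀ᶠ ε in 𝓝[>] (0 : ℝ), ∀ k ∈ Finset.range (2 * n + 1),
      segment ℝ (G.polygon d z ε k) (G.polygon d z ε (k + 1)) ⊆
        {p | (Submodule.Quotient.mk p : ℂ ⧸ Λ) ∈ G.supportᶜ} :=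
    (Finset.eventually_all _).mpr fun k _ => hw.eventually_subset_support k
  obtain ⟨ε, hε⟩ := hev.exists
  obtain ⟨S, hSA, hS, h0, h1⟩ := exists_isPreconnected_chain (G.polygon d z ε)
    (hε 0 (by simp) (left_mem_segment ..)) (2 * n) fun k hk => hε k (by simp; omega)
  have : PreconnectedSpace S := Subtype.preconnectedSpace hS
  have e0 : G.polygon d z ε 0 = G.cornerPoint (z 0) (d 0) ε := polygon_even d z ε 0
  have e1 := polygon_even (G := G) d z ε n
  have hmk : (Submodule.Quotient.mk (G.polygon d z ε 0) : ℂ ⧸ Λ) =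
      Submodule.Quotient.mk (G.polygon d z ε (2 * n)) := by
    rw [e0, e1, cornerPoint, cornerPoint, hn, Submodule.Quotient.mk_add,
      Submodule.Quotient.mk_add, hw.mem_lifts n, hn, hw.mem_lifts 0]
  -- The polygonal path stays over the complement of the graph and its ends have the same
  -- projection, so the disc hypothesis makes them equal.
  have hcl : G.polygon d z ε 0 = G.polygon d z ε (2 * n) :=
    eq_of_path_over_discs Λ G.supportᶜ G.component_disc (X := S) Subtype.val
      continuous_subtype_val (fun x => hSA x.2) (x := ⟨_, h0⟩) (y := ⟨_, h1⟩) hmk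
  rw [e0, e1, cornerPoint, cornerPoint, hn] at hcl
  exact (add_right_cancel hcl).symm

/-- Sides are left or right legs, whence four cases by parity. Two legs of the same kind can come
from the two sides of one edge, and explicit half planes separate them. For legs of different kinds,
being opposite halves would make two oriented edges of a period equal. -/
lemma eventually_disjoint {n : ℕ} (hinj : ∀ i j, i < j → j < i + n → d i ≠ d j)
    (i k : ℕ) (h2 : 2 ≤ k) (hk : k ≤ n) :
    ∀ᶠ ε in 𝓝[>] (0 : ℝ), Disjoint (segment ℝ (G.polygon d z ε i) (G.polygon d z ε (i + 1)))
      (segment ℝ (G.polygon d z ε (i + k)) (G.polygon d z ε (i + k + 1))) := by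
  have rev_inj : ∀ {a b : Dart E}, rev a = rev b → a = b := fun h => rev.injective h
  obtain ⟨a, rfl | rfl⟩ := i.even_or_odd'
  · obtain ⟨b, hb | hb⟩ := (2 * a + k).even_or_odd'
    · rw [hb]
      have hne : d a ≠ d b := hinj a b (by omega) (by omega)
      have hev : ∀ᶠ ε in 𝓝[>] (0 : ℝ), ∀ t ∈ Set.Icc (0 : ℝ) 1, ∀ s ∈ Set.Icc (0 : ℝ) 1,
          G.leftLeg (z a) (d a) ε t ≠ G.leftLeg (z b) (d b) ε s := by
        by_cases hop : d b = rev (d a) ∧ z b = z a + G.dvec (d a)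
        · rw [hop.1, hop.2]
          filter_upwards [self_mem_nhdsWithin] with ε hε t ht s hs
          exact leftLeg_ne_opposite hε ht hs
        · exact (G.isLeg_leftLeg _ _).eventually_ne_of_not_opposite (G.isLeg_leftLeg _ _)
            (hw.mem_lifts _) (hw.mem_lifts _) (hw.mem_lifts _) (hw.mem_lifts _) hne hop
      filter_upwards [hev] with ε hε
      refine Set.disjoint_left.mpr fun p hp hp' => ?_
      obtain ⟨t, ht, rfl⟩ := exists_of_mem_polygon_even hp
      obtain ⟨s, hs, hp'⟩ := exists_of_mem_polygon_even hp'
      exact hε t ht s hs hp'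
    · rw [hb]
      filter_upwards [(G.isLeg_leftLeg _ _).eventually_ne_of_not_opposite (hw.isLeg_right b)
        (hw.mem_lifts a) (hw.mem_lifts a) (hw.mem_lifts _) (hw.mem_lifts_rev b)
        (hinj a (b + 1) (by omega) (by omega))
        (fun h => hinj a b (by omega) (by omega) (rev_inj h.1).symm)] with ε hε
      refine Set.disjoint_left.mpr fun p hp hp' => ?_
      obtain ⟨t, ht, rfl⟩ := exists_of_mem_polygon_even hp
      obtain ⟨s, hs, hp'⟩ := hw.exists_of_mem_odd hp'
      exact hε t ht s hs hp'
  · obtain ⟨b, hb | hb⟩ := (2 * a + 1 + k).even_or_odd'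
    · rw [hb]
      filter_upwards [(hw.isLeg_right a).eventually_ne_of_not_opposite (G.isLeg_leftLeg _ _)
        (hw.mem_lifts _) (hw.mem_lifts_rev a) (hw.mem_lifts b) (hw.mem_lifts b)
        (hinj (a + 1) b (by omega) (by omega))
        (fun h => hinj a b (by omega) (by omega) (by rw [h.1, rev_rev]))] with ε hε
      refine Set.disjoint_left.mpr fun p hp hp' => ?_
      obtain ⟨t, ht, rfl⟩ := hw.exists_of_mem_odd hp
      obtain ⟨s, hs, hp'⟩ := exists_of_mem_polygon_even hp'
      exact hε t ht s hs hp'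
    · rw [hb]
      have hne : d (a + 1) ≠ d (b + 1) := hinj _ _ (by omega) (by omega)
      have hev : ∀ᶠ ε in 𝓝[>] (0 : ℝ), ∀ t ∈ Set.Icc (0 : ℝ) 1, ∀ s ∈ Set.Icc (0 : ℝ) 1,
          G.rightLeg (z (a + 1)) (d (a + 1)) ε t ≠ G.rightLeg (z (b + 1)) (d (b + 1)) ε s := by
        by_cases hop : rev (d b) = rev (rev (d a)) ∧ z (b + 1) = z (a + 1) + G.dvec (rev (d a))
        · rw [hop.2]
          filter_upwards [self_mem_nhdsWithin] with ε hε t ht s hs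
          exact rightLeg_ne_opposite (hw.rot_succ a) (by rw [hw.rot_succ b, hop.1]) hε ht hs
        · exact (hw.isLeg_right a).eventually_ne_of_not_opposite (hw.isLeg_right b)
            (hw.mem_lifts _) (hw.mem_lifts_rev _) (hw.mem_lifts _) (hw.mem_lifts_rev _) hne hop
      filter_upwards [hev] with ε hε
      refine Set.disjoint_left.mpr fun p hp hp' => ?_
      obtain ⟨t, ht, rfl⟩ := hw.exists_of_mem_odd hp
      obtain ⟨s, hs, hp'⟩ := hw.exists_of_mem_odd hp'
      exact hε t ht s hs hp'

end IsFaceWalk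

end ToricGraph

/-! ### Limits of the turns and the turning number of a face -/

lemma halfTurn_limit {a b c e : ℝ → ℂ} (ha : Continuous a) (hb : Continuous b)
    (hc : Continuous c) (he : Continuous e) {x y : ℂ} (hx : a 0 - b 0 = x) (hy : c 0 - e 0 = y)
    (hy0 : y ≠ 0) (h : x / y ∈ Complex.slitPlane) :
    (∀ᶠ ε in 𝓝[>] (0 : ℝ), (a ε - b ε) / (c ε - e ε) ∈ Complex.slitPlane) ∧
      Tendsto (fun ε => halfTurn ((a ε - b ε) / (c ε - e ε))) (𝓝[>] 0) (𝓝 (halfTurn (x / y))) := by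
  subst hx hy
  have hcont : ContinuousAt (fun ε => (a ε - b ε) / (c ε - e ε)) 0 :=
    (ha.sub hb).continuousAt.div (hc.sub he).continuousAt hy0
  have ht : Tendsto (fun ε => (a ε - b ε) / (c ε - e ε)) (𝓝[>] 0)
      (𝓝 ((a 0 - b 0) / (c 0 - e 0))) := hcont.tendsto.mono_left nhdsWithin_le_nhds
  exact ⟨ht.eventually (Complex.isOpen_slitPlane.mem_nhds h),
    (continuousAt_halfTurn h).tendsto.comp ht⟩

/-- The limit of the turn around an end point of an edge. -/
lemma halfTurn_u_turn {w : ℂ} (hre : 0 < w.re) (him : 0 < w.im) :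
    -w / (starRingEnd ℂ) w ∈ Complex.slitPlane ∧
      halfTurn (-w / (starRingEnd ℂ) w) =
        Complex.exp ((w.arg - Real.pi / 2 : ℝ) * Complex.I) := by
  have hpi := Real.pi_pos
  have h1 := abs_lt.mp (Complex.abs_arg_lt_pi_div_two_iff.mpr (Or.inl hre))
  have h2 : 0 < w.arg := by
    refine lt_of_le_of_ne (Complex.arg_nonneg_iff.mpr him.le) fun h => ?_
    have := (Complex.arg_eq_zero_iff.mp h.symm).2
    linarith
  have hw : w ≠ 0 := by rintro rfl; simp at hre
  have heq : -w / (starRingEnd ℂ) w = (1 : ℝ) * Complex.exp ((2 * w.arg - Real.pi : ℝ) * Complex.I) := by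
    have hn : (‖w‖ : ℂ) ≠ 0 := by exact_mod_cast (norm_pos_iff.mpr hw).ne'
    have h3 : (starRingEnd ℂ) w = ‖w‖ * Complex.exp (-(w.arg * Complex.I)) := by
      conv_lhs => rw [← Complex.norm_mul_exp_arg_mul_I w]
      rw [map_mul, Complex.conj_ofReal, ← Complex.exp_conj, map_mul, Complex.conj_ofReal,
        Complex.conj_I, mul_neg]
    rw [h3]
    conv_lhs =>
      enter [1]
      rw [← Complex.norm_mul_exp_arg_mul_I w]
    have h4 : Complex.exp ((2 * w.arg - Real.pi : ℝ) * Complex.I) =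
        -Complex.exp (w.arg * Complex.I) ^ 2 := by
      rw [← Complex.exp_nat_mul]
      push_cast
      rw [sub_mul, Complex.exp_sub, Complex.exp_pi_mul_I, mul_assoc, div_neg, div_one]
    rw [h4, Complex.exp_neg]
    field_simp [Complex.exp_ne_zero]
    simp
  rw [heq]
  refine ⟨mul_exp_mem_slitPlane one_pos ⟨by linarith, by linarith⟩, ?_⟩
  rw [halfTurn_mul_exp one_pos ⟨by linarith, by linarith⟩]
  congr 3
  ring

namespace ToricGraph

variable {Λ : Submodule ℤ ℂ} {V E : Type*} {G : ToricGraph Λ V E}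

lemma continuous_middlePoint (z : ℂ) (d : Dart E) : Continuous (G.middlePoint z d) := by
  unfold middlePoint; fun_prop

lemma middlePoint_at_zero (z : ℂ) (d : Dart E) : G.middlePoint z d 0 = z + G.dvec d * (1 / 2) := by
  simp [middlePoint]

variable [Fintype E]

lemma continuous_cornerPoint (z : ℂ) (d : Dart E) : Continuous (G.cornerPoint z d) := by
  unfold cornerPoint; fun_prop

lemma cornerPoint_at_zero (z : ℂ) (d : Dart E) : G.cornerPoint z d 0 = z := by
  simp [cornerPoint]

variable (G) in
/-- The unit complex number whose argument is half of the angle, between `-π` and `π`, by which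
the boundary of the face on the left of `d` turns to the left at the origin of `d`. -/
noncomputable def cornerTurn (d : Dart E) : ℂ :=
  Complex.exp (((Real.pi - G.cornerAngle d) / 2 : ℝ) * Complex.I)

namespace IsFaceWalk

variable {d : ℕ → Dart E} {z : ℕ → ℂ} (hw : G.IsFaceWalk d z)
include hw

/-- At a midpoint the polygon becomes straight in the limit. -/
lemma turn_even (i : ℕ) :
    (∀ᶠ ε in 𝓝[>] (0 : ℝ),
      (G.polygon d z ε (2 * i + 2) - G.polygon d z ε (2 * i + 1)) /
        (G.polygon d z ε (2 * i + 1) - G.polygon d z ε (2 * i)) ∈ Complex.slitPlane) ∧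
    Tendsto (fun ε => halfTurn ((G.polygon d z ε (2 * i + 2) - G.polygon d z ε (2 * i + 1)) /
        (G.polygon d z ε (2 * i + 1) - G.polygon d z ε (2 * i)))) (𝓝[>] 0) (𝓝 1) := by
  simp only [show 2 * i + 2 = 2 * (i + 1) by ring, polygon_even, polygon_odd]
  have hd := G.dvec_ne_zero (d i)
  have e2 : G.middlePoint (z i) (d i) 0 - G.cornerPoint (z i) (d i) 0 = G.dvec (d i) * (1 / 2) := by
    rw [cornerPoint_at_zero, middlePoint_at_zero]; ring
  have e1 : G.cornerPoint (z (i + 1)) (d (i + 1)) 0 - G.middlePoint (z i) (d i) 0 =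
      G.dvec (d i) * (1 / 2) := by
    rw [cornerPoint_at_zero, middlePoint_at_zero, hw.step]; ring
  have h0 : G.dvec (d i) * (1 / 2) ≠ 0 := mul_ne_zero hd (by norm_num)
  have h := halfTurn_limit
    (continuous_cornerPoint (z (i + 1)) (d (i + 1))) (continuous_middlePoint (z i) (d i))
    (continuous_middlePoint (z i) (d i)) (continuous_cornerPoint (z i) (d i)) e1 e2 h0
    (by rw [div_self h0]; exact Complex.one_mem_slitPlane)
  rw [div_self h0] at h
  simpa [halfTurn] using h

lemma turn_odd (i : ℕ) :
    (∀ᶠ ε in 𝓝[>] (0 : ℝ),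
      (G.polygon d z ε (2 * i + 1 + 2) - G.polygon d z ε (2 * i + 1 + 1)) /
        (G.polygon d z ε (2 * i + 1 + 1) - G.polygon d z ε (2 * i + 1)) ∈ Complex.slitPlane) ∧
    Tendsto (fun ε => halfTurn ((G.polygon d z ε (2 * i + 1 + 2) -
        G.polygon d z ε (2 * i + 1 + 1)) /
        (G.polygon d z ε (2 * i + 1 + 1) - G.polygon d z ε (2 * i + 1)))) (𝓝[>] 0)
      (𝓝 (G.cornerTurn (d (i + 1)))) := by
  have hpi := Real.pi_pos
  simp only [show 2 * i + 1 + 2 = 2 * (i + 1) + 1 by ring, show 2 * i + 1 + 1 = 2 * (i + 1) by ring,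
    polygon_even, polygon_odd]
  have hd := G.dvec_ne_zero (d (i + 1))
  have hm := G.cornerAngle_mem (d (i + 1))
  have hrot : G.dvec (d i) = -G.dvec (G.rot (d (i + 1))) := by
    rw [hw.rot_succ, dvec_rev, neg_neg]
  -- For a corner of less than a full turn the limiting quotient is off the cut, and continuity
  -- suffices. At a full turn the limit is -1, where the half turn is discontinuous; there the side
  -- from which -1 is approached decides, and the quotient is computed exactly.
  rcases hm.2.lt_or_eq with hlt | heq
  · have e1 : G.middlePoint (z (i + 1)) (d (i + 1)) 0 - G.cornerPoint (z (i + 1)) (d (i + 1)) 0 =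
        G.dvec (d (i + 1)) * (1 / 2) := by
      rw [cornerPoint_at_zero, middlePoint_at_zero]; ring
    have e2 : G.cornerPoint (z (i + 1)) (d (i + 1)) 0 - G.middlePoint (z i) (d i) 0 =
        G.dvec (d i) * (1 / 2) := by
      rw [cornerPoint_at_zero, middlePoint_at_zero, hw.step]; ring
    have h0 : G.dvec (d i) * (1 / 2) ≠ 0 := mul_ne_zero (G.dvec_ne_zero _) (by norm_num)
    have hr := G.norm_ratio_pos (d (i + 1)) (G.rot (d (i + 1)))
    have hq : G.dvec (d (i + 1)) * (1 / 2) / (G.dvec (d i) * (1 / 2)) =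
        (‖G.dvec (d (i + 1))‖ / ‖G.dvec (G.rot (d (i + 1)))‖ : ℝ) *
          Complex.exp ((Real.pi - G.cornerAngle (d (i + 1)) : ℝ) * Complex.I) := by
      have n1 : (‖G.dvec (d (i + 1))‖ : ℂ) ≠ 0 := by exact_mod_cast (norm_pos_iff.mpr hd).ne'
      have n2 : (‖G.dvec (G.rot (d (i + 1)))‖ : ℂ) ≠ 0 := by
        exact_mod_cast (norm_pos_iff.mpr (G.dvec_ne_zero _)).ne'
      rw [mul_div_mul_right _ _ (by norm_num : (1 / 2 : ℂ) ≠ 0), hrot]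
      nth_rewrite 1 [G.dvec_rot]
      push_cast
      rw [sub_mul, Complex.exp_sub, Complex.exp_pi_mul_I]
      field_simp [Complex.exp_ne_zero]
    have h := halfTurn_limit
      (continuous_middlePoint (z (i + 1)) (d (i + 1))) (continuous_cornerPoint (z (i + 1)) (d (i + 1)))
      (continuous_cornerPoint (z (i + 1)) (d (i + 1))) (continuous_middlePoint (z i) (d i)) e1 e2 h0
      (by rw [hq]; exact mul_exp_mem_slitPlane hr ⟨by linarith, by linarith [hm.1]⟩)
    rw [hq, halfTurn_mul_exp hr ⟨by linarith, by linarith [hm.1]⟩] at h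
    exact h
  · have hdi : G.dvec (d i) = -G.dvec (d (i + 1)) := by
      rw [hrot, G.cornerAngle_eq_two_pi heq]
    have hexp : Complex.exp ((G.cornerAngle (d (i + 1)) / 2 : ℝ) * Complex.I) = -1 := by
      rw [heq, mul_div_cancel_left₀ _ two_ne_zero, Complex.exp_pi_mul_I]
    let w : ℝ → ℂ := fun ε => 1 / 2 + ε + ε * Complex.I
    have hq : ∀ ε : ℝ, (G.middlePoint (z (i + 1)) (d (i + 1)) ε -
        G.cornerPoint (z (i + 1)) (d (i + 1)) ε) /
        (G.cornerPoint (z (i + 1)) (d (i + 1)) ε - G.middlePoint (z i) (d i) ε) =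
        -w ε / (starRingEnd ℂ) (w ε) := fun ε => by
      have hc : (starRingEnd ℂ) (w ε) = 1 / 2 + ε - ε * Complex.I := by
        simp only [w, map_add, map_mul, Complex.conj_ofReal, Complex.conj_I, map_div₀, map_one,
          Complex.conj_ofNat]
        ring
      rw [hc, middlePoint, cornerPoint, middlePoint, hw.step, hexp, hdi]
      have e1 : z i + -G.dvec (d (i + 1)) + G.dvec (d (i + 1)) * (1 / 2 + ε * Complex.I) -
          (z i + -G.dvec (d (i + 1)) + G.dvec (d (i + 1)) * (ε * -1)) =
          -G.dvec (d (i + 1)) * -w ε := by simp only [w]; ring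
      have e2 : z i + -G.dvec (d (i + 1)) + G.dvec (d (i + 1)) * (ε * -1) -
          (z i + -G.dvec (d (i + 1)) * (1 / 2 + ε * Complex.I)) =
          -G.dvec (d (i + 1)) * (1 / 2 + ε - ε * Complex.I) := by ring
      rw [e1, e2, mul_div_mul_left _ _ (neg_ne_zero.mpr hd)]
    simp only [hq]
    have hpos : ∀ᶠ ε in 𝓝[>] (0 : ℝ), 0 < (w ε).re ∧ 0 < (w ε).im := by
      filter_upwards [self_mem_nhdsWithin] with ε (hε : 0 < ε)
      constructor
      · simp [w]; linarith
      · simpa [w] using hε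
    refine ⟨hpos.mono fun ε h => (halfTurn_u_turn h.1 h.2).1, ?_⟩
    have hlim : Tendsto (fun ε => Complex.exp (((w ε).arg - Real.pi / 2 : ℝ) * Complex.I))
        (𝓝[>] 0) (𝓝 (Complex.exp (((w 0).arg - Real.pi / 2 : ℝ) * Complex.I))) := by
      have hwc : ContinuousAt w 0 := by
        have : Continuous w := by fun_prop
        exact this.continuousAt
      have hs : w 0 ∈ Complex.slitPlane := by
        left; simp [w]
      have ha : ContinuousAt (fun ε => (w ε).arg) 0 :=
        ContinuousAt.comp (f := w) (g := Complex.arg) (Complex.continuousAt_arg hs) hwc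
      have hb : ContinuousAt (fun ε => (((w ε).arg - Real.pi / 2 : ℝ) : ℂ) * Complex.I) 0 :=
        (Complex.continuous_ofReal.continuousAt.comp (ha.sub continuousAt_const)).mul
          continuousAt_const
      exact (Complex.continuous_exp.continuousAt.comp hb).tendsto.mono_left nhdsWithin_le_nhds
    have hw0 : (w 0).arg = 0 := by
      have : w 0 = ((1 / 2 : ℝ) : ℂ) := by simp [w]
      rw [this, Complex.arg_ofReal_of_nonneg (by norm_num)]
    rw [hw0] at hlim
    have hct : G.cornerTurn (d (i + 1)) = Complex.exp ((0 - Real.pi / 2 : ℝ) * Complex.I) := by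
      rw [cornerTurn, heq]; congr 3; ring
    rw [hct]
    refine hlim.congr' (hpos.mono fun ε h => ?_)
    exact (halfTurn_u_turn h.1 h.2).2.symm

/-- The boundary of a face makes an odd number of full turns. -/
theorem prod_cornerTurn [Fintype V] [DiscreteTopology Λ] {n : ℕ} (hn : 0 < n)
    (hper : ∀ i, d (i + n) = d i) (hinj : ∀ i j, i < j → j < i + n → d i ≠ d j) :
    ∏ i ∈ Finset.range n, G.cornerTurn (d i) = -1 := by
  have hz : ∀ i, z (i + n) = z i := fun i => by
    have := (hw.shift i).closed (n := n) (by rw [zero_add, add_comm, hper])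
    rwa [zero_add, add_comm] at this
  -- A face with a single boundary edge would be closed up in the plane by one nonzero vector.
  have hn2 : 2 ≤ n := by
    by_contra! h
    obtain rfl : n = 1 := by omega
    have h1 := hz 0
    rw [zero_add, show (1 : ℕ) = 0 + 1 by rfl, hw.step] at h1
    exact G.dvec_ne_zero (d 0) (by simpa using h1)
  have hqper : ∀ ε i, G.polygon d z ε (i + 2 * n) = G.polygon d z ε i := fun ε i => by
    obtain ⟨a, rfl | rfl⟩ := i.even_or_odd'
    · rw [← mul_add, polygon_even, polygon_even, hper, hz]
    · rw [show 2 * a + 1 + 2 * n = 2 * (a + n) + 1 by ring, polygon_odd, polygon_odd, hper, hz]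
  -- Periodicity reduces the conditions on the polygon to finitely many, so that one ε serves for
  -- all.
  have hmod : ∀ ε i, G.polygon d z ε i = G.polygon d z ε (i % (2 * n)) := fun ε i =>
    (Function.Periodic.map_mod_nat (hqper ε) i).symm
  have hmod' : ∀ ε i k, G.polygon d z ε (i + k) = G.polygon d z ε (i % (2 * n) + k) :=
    fun ε i k => by rw [hmod ε (i + k), hmod ε (i % (2 * n) + k), Nat.mod_add_mod]
  have hdis : ∀ᶠ ε in 𝓝[>] (0 : ℝ), ∀ i ∈ Finset.range (2 * n), ∀ k ∈ Finset.Icc 2 n,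
      Disjoint (segment ℝ (G.polygon d z ε i) (G.polygon d z ε (i + 1)))
        (segment ℝ (G.polygon d z ε (i + k)) (G.polygon d z ε (i + k + 1))) :=
    (Finset.eventually_all _).mpr fun i _ => (Finset.eventually_all _).mpr fun k hk =>
      hw.eventually_disjoint hinj i k (Finset.mem_Icc.mp hk).1 (Finset.mem_Icc.mp hk).2
  have htur : ∀ᶠ ε in 𝓝[>] (0 : ℝ), ∀ i ∈ Finset.range (2 * n),
      (G.polygon d z ε (i + 2) - G.polygon d z ε (i + 1)) /
        (G.polygon d z ε (i + 1) - G.polygon d z ε i) ∈ Complex.slitPlane := by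
    refine (Finset.eventually_all _).mpr fun i _ => ?_
    obtain ⟨a, rfl | rfl⟩ := i.even_or_odd'
    · exact (hw.turn_even a).1
    · exact (hw.turn_odd a).1
  have hprod : ∀ᶠ ε in 𝓝[>] (0 : ℝ), ∏ i ∈ Finset.range (2 * n),
      halfTurn ((G.polygon d z ε (i + 2) - G.polygon d z ε (i + 1)) /
        (G.polygon d z ε (i + 1) - G.polygon d z ε i)) = -1 := by
    filter_upwards [hdis, htur] with ε h1 h2
    have hlt : ∀ i, i % (2 * n) ∈ Finset.range (2 * n) := fun i =>
      Finset.mem_range.mpr (Nat.mod_lt _ (by omega))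
    refine prod_halfTurn_polygon n hn2 _ (hqper ε) (fun i k hk2 hkn => ?_) fun i => ?_
    · have := h1 _ (hlt i) k (Finset.mem_Icc.mpr ⟨hk2, hkn⟩)
      rwa [← hmod' ε i 1, ← hmod ε i, ← hmod' ε i k, add_assoc (i % _), ← hmod' ε i (k + 1)] at this
    · have := h2 _ (hlt i)
      rwa [← hmod' ε i 1, ← hmod ε i, ← hmod' ε i 2] at this
  have hlim : Tendsto (fun ε => ∏ i ∈ Finset.range (2 * n),
      halfTurn ((G.polygon d z ε (i + 2) - G.polygon d z ε (i + 1)) /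
        (G.polygon d z ε (i + 1) - G.polygon d z ε i))) (𝓝[>] 0)
      (𝓝 (∏ i ∈ Finset.range n, G.cornerTurn (d (i + 1)))) := by
    simp only [prod_range_two_mul']
    refine tendsto_finsetProd _ fun i _ => ?_
    rw [← one_mul (G.cornerTurn _)]
    exact (hw.turn_even i).2.mul (hw.turn_odd i).2
  have := tendsto_nhds_unique hlim (tendsto_const_nhds.congr' (hprod.mono fun ε h => h.symm))
  rw [← this]
  refine (prod_range_shift (f := fun i => G.cornerTurn (d i)) ?_ (Complex.exp_ne_zero _)).symm
  rw [← hper 0, zero_add]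

end IsFaceWalk

end ToricGraph

lemma RotationSystem.mem_faceBoundary {D : Type*} (M : RotationSystem D) [Fintype D] {d d' : D} :
    d' ∈ M.faceBoundary d ↔ M.facePerm.SameCycle d d' := by
  simp [RotationSystem.faceBoundary]

/-! ### Orbits of permutations and products over them -/

section Orbits

variable {α β : Type*} {σ : Equiv.Perm α} {τ : Equiv.Perm β} {u v : α → β}

/-- The permutation `τ` alternates between the two copies and acts as `σ` every second step. Every
face of `C_G` has this form: two kinds of edges alternate along an orbit of the faces, vertices or
edges of `G`. -/
lemma sameCycle_of_double (huv : ∀ a, τ (u a) = v (σ a)) (hvu : ∀ a, τ (v a) = u a) [Finite α]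
    [Finite β] (a : α) (y : β) :
    τ.SameCycle (u a) y ↔ ∃ b, σ.SameCycle a b ∧ (y = u b ∨ y = v b) := by
  constructor
  · intro h
    obtain ⟨k, -, -, rfl⟩ := h.exists_pow_eq'
    clear h
    induction k with
    | zero => exact ⟨a, Equiv.Perm.SameCycle.refl _ _, Or.inl rfl⟩
    | succ k ih =>
      obtain ⟨b, hb, h | h⟩ := ih
      · exact ⟨σ b, hb.trans ⟨1, by simp⟩, Or.inr (by rw [pow_succ', Equiv.Perm.mul_apply, h, huv])⟩
      · exact ⟨b, hb, Or.inl (by rw [pow_succ', Equiv.Perm.mul_apply, h, hvu])⟩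
  · rintro ⟨b, hb, hy⟩
    obtain ⟨k, -, -, rfl⟩ := hb.exists_pow_eq'
    have key : ∀ k : ℕ, τ.SameCycle (u a) (u ((σ ^ k) a)) := fun k => by
      induction k with
      | zero => exact Equiv.Perm.SameCycle.refl _ _
      | succ k ih =>
        refine ih.trans ⟨2, ?_⟩
        rw [pow_succ' σ, Equiv.Perm.mul_apply, ← hvu (σ _), ← huv]
        rfl
    rcases hy with rfl | rfl
    · exact key k
    · refine (key k).trans (Equiv.Perm.SameCycle.symm ⟨1, ?_⟩)
      rw [zpow_one, hvu]

lemma prod_double_orbit [DecidableEq β] (hu : Function.Injective u) (hv : Function.Injective v)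
    (huv' : ∀ a b, u a ≠ v b) (huv : ∀ a, τ (u a) = v (σ a)) (hvu : ∀ a, τ (v a) = u a) [Finite α]
    [Finite β] {a : α} {x : β} (hx : x = u a ∨ x = v a) {S : Finset α} {T : Finset β}
    (hS : ∀ b, b ∈ S ↔ σ.SameCycle a b) (hT : ∀ y, y ∈ T ↔ τ.SameCycle x y) :
    T.card = 2 * S.card ∧ ∀ {R : Type*} [CommMonoid R] (f : β → R),
      ∏ y ∈ T, f y = ∏ b ∈ S, f (u b) * f (v b) := by
  have hT' : ∀ y, y ∈ T ↔ τ.SameCycle (u a) y := fun y => by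
    rw [hT]
    rcases hx with rfl | rfl
    · rfl
    · rw [← hvu a, Equiv.Perm.sameCycle_apply_left]
  have hTS : T = S.image u ∪ S.image v := by
    ext y
    simp only [hT', sameCycle_of_double huv hvu, Finset.mem_union, Finset.mem_image, hS]
    constructor
    · rintro ⟨b, hb, rfl | rfl⟩
      · exact Or.inl ⟨b, hb, rfl⟩
      · exact Or.inr ⟨b, hb, rfl⟩
    · rintro (⟨b, hb, rfl⟩ | ⟨b, hb, rfl⟩)
      · exact ⟨b, hb, Or.inl rfl⟩
      · exact ⟨b, hb, Or.inr rfl⟩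
  have hdisj : Disjoint (S.image u) (S.image v) := by
    rw [Finset.disjoint_left]
    rintro _ h1 h2
    obtain ⟨b, -, rfl⟩ := Finset.mem_image.mp h1
    obtain ⟨c, -, h⟩ := Finset.mem_image.mp h2
    exact huv' b c h.symm
  subst hTS
  refine ⟨?_, fun f => ?_⟩
  · rw [Finset.card_union_of_disjoint hdisj, Finset.card_image_of_injective _ hu,
      Finset.card_image_of_injective _ hv, two_mul]
  · rw [Finset.prod_union hdisj, Finset.prod_image hu.injOn, Finset.prod_image hv.injOn,
      Finset.prod_mul_distrib]

lemma prod_orbit_apply [Finite α] {a : α} {S : Finset α} (hS : ∀ b, b ∈ S ↔ σ.SameCycle a b)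
    {R : Type*} [CommMonoid R] (f : α → R) : ∏ b ∈ S, f (σ b) = ∏ b ∈ S, f b :=
  Finset.prod_equiv σ (fun b => by rw [hS, hS, Equiv.Perm.sameCycle_apply_right])
    fun _ _ => rfl

lemma exists_orbit_enumeration [Fintype α] {a : α} {S : Finset α}
    (hS : ∀ b, b ∈ S ↔ σ.SameCycle a b) :
    ∃ n, 0 < n ∧ (∀ i, (σ ^ (i + n)) a = (σ ^ i) a) ∧
      (∀ i j, i < j → j < i + n → (σ ^ i) a ≠ (σ ^ j) a) ∧
      ∀ f : α → ℂ, ∏ b ∈ S, f b = ∏ i ∈ Finset.range n, f ((σ ^ i) a) := by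
  classical
  have hit : ∀ k : ℕ, (σ ^ k) a = σ^[k] a := fun k => by rw [Equiv.Perm.iterate_eq_pow]
  have hper : a ∈ Function.periodicPts σ :=
    Function.Injective.mem_periodicPts σ.injective a
  have hpos := Function.minimalPeriod_pos_of_mem_periodicPts hper
  set n := Function.minimalPeriod σ a with hn
  have hne : ∀ i j, i < j → j < i + n → (σ ^ i) a ≠ (σ ^ j) a := by
    intro i j hij hj h
    obtain ⟨k, rfl⟩ := Nat.exists_eq_add_of_lt hij
    rw [add_assoc, pow_add, Equiv.Perm.mul_apply, hit] at h
    have h2 : σ^[k + 1] a = a := by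
      rw [← hit]
      rw [← hit] at h
      exact ((σ ^ i).injective h).symm
    have := Function.IsPeriodicPt.minimalPeriod_le (f := σ) (n := k + 1) (by omega) h2
    omega
  refine ⟨n, hpos, fun i => ?_, hne, fun f => ?_⟩
  · rw [pow_add, Equiv.Perm.mul_apply, hit n, Function.iterate_minimalPeriod]
  · have hS' : S = (Finset.range n).image fun i => (σ ^ i) a := by
      ext b
      rw [hS, Finset.mem_image]
      constructor
      · intro h
        obtain ⟨k, -, -, rfl⟩ := h.exists_pow_eq'
        refine ⟨k % n, Finset.mem_range.mpr (Nat.mod_lt _ hpos), ?_⟩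
        rw [hit, hit, Function.iterate_mod_minimalPeriod_eq]
      · rintro ⟨i, -, rfl⟩
        exact ⟨i, by simp⟩
    rw [hS', Finset.prod_image]
    intro i hi j hj h
    simp only [Finset.coe_range, Set.mem_Iio] at hi hj
    by_contra hij
    rcases Nat.lt_or_gt_of_ne hij with hlt | hlt
    · exact hne i j hlt (by omega) h
    · exact hne j i hlt (by omega) h.symm

end Orbits

/-! ### The Kasteleyn signs as ratios of square roots of directions -/

namespace ToricGraph

variable {Λ : Submodule ℤ ℂ} {V E : Type*} (G : ToricGraph Λ V E)

/-- A square root of the direction of an oriented edge. -/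
noncomputable def halfDirection (d : Dart E) : ℂ := halfTurn (G.dvec d)

lemma halfDirection_ne_zero (d : Dart E) : G.halfDirection d ≠ 0 := halfTurn_ne_zero _

lemma arg_dvec_rev (d : Dart E) : (G.dvec (rev d)).arg =
    if 0 < (G.dvec d).arg then (G.dvec d).arg - Real.pi else (G.dvec d).arg + Real.pi := by
  have h0 := G.dvec_ne_zero d
  rw [dvec_rev]
  split_ifs with h
  · rw [Complex.arg_neg_eq_arg_sub_pi_iff]
    have h1 := Complex.arg_nonneg_iff.mp h.le
    have h2 : ¬ (0 ≤ (G.dvec d).re ∧ (G.dvec d).im = 0) := fun h' =>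
      h.ne' (Complex.arg_eq_zero_iff.mpr h')
    rcases h1.lt_or_eq with h3 | h3
    · exact Or.inl h3
    · exact Or.inr ⟨h3.symm, lt_of_not_ge fun h4 => h2 ⟨h4, h3.symm⟩⟩
  · rw [Complex.arg_neg_eq_arg_add_pi_iff]
    rcases (not_lt.mp h).lt_or_eq with h1 | h1
    · exact Or.inl (Complex.arg_neg_iff.mp h1)
    · have h2 := Complex.arg_eq_zero_iff.mp h1
      refine Or.inr ⟨h2.2, lt_of_le_of_ne h2.1 fun h3 => h0 (Complex.ext h3.symm h2.2)⟩

variable [Fintype E]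

lemma rot_facePerm (d : Dart E) : G.rot (G.toRotationSystem.facePerm d) = rev d := by
  simp [RotationSystem.facePerm, toRotationSystem]

lemma exists_isFaceWalk (e : Dart E) :
    ∃ z, G.IsFaceWalk (fun i => (G.toRotationSystem.facePerm ^ i) e) z := by
  obtain ⟨w, hw⟩ := Submodule.Quotient.mk_surjective Λ (G.pos (G.origin e))
  let d : ℕ → Dart E := fun i => (G.toRotationSystem.facePerm ^ i) e
  have hrot : ∀ i, G.rot (d (i + 1)) = rev (d i) := fun i => by
    simp only [d]
    rw [pow_succ', Equiv.Perm.mul_apply, rot_facePerm]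
  refine ⟨fun i => w + ∑ k ∈ Finset.range i, G.dvec (d k), fun i => ?_, hrot, fun i => ?_⟩
  · induction i with
    | zero => simpa [mem_lifts] using hw
    | succ i ih =>
      rw [Finset.sum_range_succ, ← add_assoc]
      refine (mem_lifts_congr ?_).mp (add_dvec_mem_lifts ih)
      exact (congrArg G.origin (hrot i)).symm.trans (G.origin_rot _)
  · rw [Finset.sum_range_succ, ← add_assoc]

theorem prod_cornerTurn_face [Fintype V] [DiscreteTopology Λ] (e : Dart E) :
    ∏ f ∈ G.toRotationSystem.faceBoundary e, G.cornerTurn f = -1 := by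
  obtain ⟨z, hz⟩ := G.exists_isFaceWalk e
  obtain ⟨n, hn, hper, hinj, hprod⟩ := exists_orbit_enumeration
    (fun b => G.toRotationSystem.mem_faceBoundary (d := e) (d' := b))
  rw [hprod]
  exact hz.prod_cornerTurn hn hper hinj

/-- The oriented edges with a given origin form an orbit of the rotation. -/
lemma sameCycle_rot_iff (e e' : Dart E) : G.rot.SameCycle e e' ↔ G.origin e = G.origin e' := by
  classical
  constructor
  · intro h
    obtain ⟨k, -, -, rfl⟩ := h.exists_pow_eq'
    clear h
    induction k with
    | zero => rfl
    | succ k ih => rw [pow_succ', Equiv.Perm.mul_apply, origin_rot, ih]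
  · intro h
    have horig : ∀ c, G.rot.SameCycle e c → G.origin c = G.origin e := by
      intro c hc
      obtain ⟨k, -, -, rfl⟩ := hc.exists_pow_eq'
      clear hc
      induction k with
      | zero => rfl
      | succ k ih => rw [pow_succ', Equiv.Perm.mul_apply, origin_rot, ih]
    -- Among the orbit, `c` is the last edge before `e'`. Its successor cannot overtake `e'`, and by
    -- minimality cannot be strictly nearer, so it is `e'`.
    obtain ⟨c, hc, hmin⟩ := Finset.exists_min_image
      (Finset.univ.filter fun c => G.rot.SameCycle e c)
      (fun c => ccwAngle (G.dvec c) (G.dvec e')) ⟨e, by simp [Equiv.Perm.SameCycle.refl]⟩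
    simp only [Finset.mem_filter, Finset.mem_univ, true_and] at hc hmin
    have hRc : G.rot.SameCycle e (G.rot c) := hc.trans ⟨1, by simp⟩
    have h1 := hmin _ hRc
    have h2 := G.cornerAngle_le c (c := e') (by rw [horig c hc, h])
    have h3 := G.cornerAngle_mem c
    have h4 := ccwAngle_mem (G.dvec (G.rot c)) (G.dvec e')
    unfold cornerAngle at h2 h3
    have h5 : ccwAngle (G.dvec (G.rot c)) (G.dvec e') = 2 * Real.pi := by
      rcases ccwAngle_add (G.dvec c) (G.dvec (G.rot c)) (G.dvec e') with h | h <;> linarith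
    rw [← G.eq_of_ccwAngle_eq (by rw [horig _ hRc, h]) h5]
    exact hRc

/-- At each vertex, exactly one corner contains the direction of argument `π`. -/
lemma exists_arg_rot_le_iff (e : Dart E) : ∃ m, G.origin m = G.origin e ∧
    ∀ f, G.origin f = G.origin e → ((G.dvec (G.rot f)).arg ≤ (G.dvec f).arg ↔ f = m) := by
  classical
  obtain ⟨m, hm, hmax⟩ := Finset.exists_max_image
    (Finset.univ.filter fun c => G.origin c = G.origin e) (fun c => (G.dvec c).arg) ⟨e, by simp⟩
  simp only [Finset.mem_filter, Finset.mem_univ, true_and] at hm hmax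
  refine ⟨m, hm, fun f hf => ⟨fun h => ?_, ?_⟩⟩
  · by_contra hne
    have hpi := Real.pi_pos
    have hlt : (G.dvec f).arg < (G.dvec m).arg :=
      lt_of_le_of_ne (hmax f hf) fun h => hne (G.eq_of_arg_eq (hf.trans hm.symm) h)
    -- The successor of `f` comes no later than `m`, which is reached without crossing the cut of
    -- the argument; so the argument increases from `f` to its successor.
    have h1 := G.cornerAngle_le f (c := m) (hm.trans hf.symm)
    have m1 := ccwAngle_mem (G.dvec f) (G.dvec m)
    have m2 := G.cornerAngle_mem f
    obtain ⟨k, hk⟩ := ccwAngle_eq (G.dvec f) (G.dvec m)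
    obtain ⟨l, hl⟩ := ccwAngle_eq (G.dvec f) (G.dvec (G.rot f))
    change _ = G.cornerAngle f + _ at hl
    have a1 := Complex.neg_pi_lt_arg (G.dvec f)
    have a2 := Complex.neg_pi_lt_arg (G.dvec (G.rot f))
    have a3 := Complex.arg_le_pi (G.dvec m)
    have k1 : (-1 : ℝ) < k := by nlinarith
    have l1 : (l : ℝ) < 0 := by nlinarith
    have k2 : -1 < k := by exact_mod_cast k1
    have l2 : l < 0 := by exact_mod_cast l1
    have k3 : (0 : ℝ) ≤ k := by exact_mod_cast (by omega : 0 ≤ k)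
    have l3 : (l : ℝ) ≤ -1 := by exact_mod_cast (by omega : l ≤ -1)
    nlinarith
  · rintro rfl
    exact hmax _ (by rw [origin_rot, hm])

/-- A Kasteleyn orientation of `C_G`. -/
noncomputable def kasteleynSign : CDart E → ℤˣ
  | (.perp _, _) => 1
  | (.par e, _) => if 0 < (G.dvec e).arg then -1 else 1
  | (.corner e, _) => if (G.dvec (G.rot e)).arg ≤ (G.dvec e).arg then 1 else -1

/-- Reversal shifts the argument by ±π, hence its half by ±π/2, and the sign records which shift
occurs. -/
lemma kasteleynSign_par (d : Dart E) (b : Bool) : ((G.kasteleynSign (.par d, b) : ℤ) : ℂ) =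
    Complex.I * G.halfDirection d / G.halfDirection (rev d) := by
  have hI : Complex.exp ((Real.pi / 2 : ℝ) * Complex.I) = Complex.I := by
    push_cast
    rw [Complex.exp_pi_div_two_mul_I]
  rw [eq_div_iff (G.halfDirection_ne_zero _), halfDirection, halfDirection, halfTurn, halfTurn,
    arg_dvec_rev]
  simp only [kasteleynSign]
  split_ifs
  · rw [sub_div, Complex.ofReal_sub, sub_mul, Complex.exp_sub, hI]
    field_simp
    push_cast
    rw [Complex.I_sq]
  · rw [add_div, Complex.ofReal_add, add_mul, Complex.exp_add, hI]
    push_cast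
    ring

/-- Along a corner the argument grows by the corner angle, minus 2π exactly when the corner crosses
the cut; halving turns that 2π into a sign. -/
lemma kasteleynSign_corner (d : Dart E) (b : Bool) : ((G.kasteleynSign (.corner d, b) : ℤ) : ℂ) =
    -(Complex.exp ((G.cornerAngle d / 2 : ℝ) * Complex.I) * G.halfDirection d /
      G.halfDirection (G.rot d)) := by
  have hpi := Real.pi_pos
  obtain ⟨k, hk⟩ := ccwAngle_eq (G.dvec d) (G.dvec (G.rot d))
  change _ = G.cornerAngle d + _ at hk
  have m := G.cornerAngle_mem d
  have a1 := Complex.neg_pi_lt_arg (G.dvec d)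
  have a2 := Complex.neg_pi_lt_arg (G.dvec (G.rot d))
  have a3 := Complex.arg_le_pi (G.dvec d)
  have a4 := Complex.arg_le_pi (G.dvec (G.rot d))
  have hexp : Complex.exp ((G.cornerAngle d / 2 : ℝ) * Complex.I) * G.halfDirection d /
      G.halfDirection (G.rot d) = Complex.exp ((-(k * Real.pi) : ℝ) * Complex.I) := by
    rw [halfDirection, halfDirection, halfTurn, halfTurn, ← Complex.exp_add, ← Complex.exp_sub,
      ← add_mul, ← sub_mul, ← Complex.ofReal_add, ← Complex.ofReal_sub]
    congr 3
    linarith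
  rw [hexp]
  have k1 : (-2 : ℝ) < k := by nlinarith
  have k2 : (k : ℝ) < 1 := by nlinarith
  have k1' : -2 < k := by exact_mod_cast k1
  have k2' : k < 1 := by exact_mod_cast k2
  simp only [kasteleynSign]
  rcases (by omega : k = 0 ∨ k = -1) with rfl | rfl
  · rw [if_neg]
    · simp
    · simp at hk; linarith [m.1]
  · rw [if_pos]
    · simp
    · push_cast at hk; linarith [m.2]

end ToricGraph

/-! ### The three kinds of faces of `C_G` -/

namespace ToricGraph

variable {Λ : Submodule ℤ ℂ} {V E : Type*} (G : ToricGraph Λ V E)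

lemma ne_rev {E : Type*} (e : Dart E) : e ≠ rev e := by
  intro h
  have := congrArg Prod.snd h
  simp [rev] at this

variable [Fintype E]

lemma cFacePerm_par_true (e : Dart E) : G.cRotationSystem.facePerm (.par e, true) =
    (.corner (G.toRotationSystem.facePerm e), false) := rfl

lemma cFacePerm_corner_false (e : Dart E) : G.cRotationSystem.facePerm (.corner e, false) =
    (.par e, true) := rfl

lemma cFacePerm_corner_true (e : Dart E) : G.cRotationSystem.facePerm (.corner e, true) =
    (.perp (G.rot e), false) := rfl

lemma cFacePerm_perp_false (e : Dart E) : G.cRotationSystem.facePerm (.perp e, false) =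
    (.corner e, true) := rfl

lemma cFacePerm_perp_true (e : Dart E) : G.cRotationSystem.facePerm (.perp e, true) =
    (.par (rev e), false) := rfl

lemma cFacePerm_par_false (e : Dart E) : G.cRotationSystem.facePerm (.par e, false) =
    (.perp e, true) := rfl

/-- The faces of `C_G` corresponding to faces of `G`. -/
lemma prod_face {x : CDart E} {e : Dart E} (hx : x = (.par e, true) ∨ x = (.corner e, false)) :
    (G.cRotationSystem.faceBoundary x).card = 2 * (G.toRotationSystem.faceBoundary e).card ∧
    ∀ {R : Type} [CommMonoid R] (f : CDart E → R), ∏ y ∈ G.cRotationSystem.faceBoundary x, f y =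
      ∏ b ∈ G.toRotationSystem.faceBoundary e, f (.par b, true) * f (.corner b, false) := by
  classical
  have h := prod_double_orbit (σ := G.toRotationSystem.facePerm) (τ := G.cRotationSystem.facePerm)
    (u := fun e => (CEdge.par e, true)) (v := fun e => (CEdge.corner e, false))
    (fun a b h => by simpa using h) (fun a b h => by simpa using h) (fun a b h => by simp at h)
    G.cFacePerm_par_true G.cFacePerm_corner_false hx
    (fun b => G.toRotationSystem.mem_faceBoundary (d' := b))
    (fun b => G.cRotationSystem.mem_faceBoundary (d' := b))
  exact ⟨h.1, fun f => h.2 f⟩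

/-- The faces of `C_G` corresponding to vertices of `G`. -/
lemma prod_vertex_face [DecidableEq V] {x : CDart E} {e : Dart E}
    (hx : x = (.corner e, true) ∨ x = (.perp e, false)) :
    (G.cRotationSystem.faceBoundary x).card =
      2 * (Finset.univ.filter fun b => G.origin e = G.origin b).card ∧
    ∀ {R : Type} [CommMonoid R] (f : CDart E → R), ∏ y ∈ G.cRotationSystem.faceBoundary x, f y =
      ∏ b with G.origin e = G.origin b, f (.corner b, true) * f (.perp b, false) := by
  classical
  have h := prod_double_orbit (σ := G.rot) (τ := G.cRotationSystem.facePerm)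
    (u := fun e => (CEdge.corner e, true)) (v := fun e => (CEdge.perp e, false))
    (fun a b h => by simpa using h) (fun a b h => by simpa using h) (fun a b h => by simp at h)
    G.cFacePerm_corner_true G.cFacePerm_perp_false hx
    (S := Finset.univ.filter fun b => G.origin e = G.origin b)
    (fun b => by simp [sameCycle_rot_iff])
    (fun b => G.cRotationSystem.mem_faceBoundary (d' := b))
  exact ⟨h.1, fun f => h.2 f⟩

lemma sameCycle_rev_iff [DecidableEq E] (e b : Dart E) :
    b ∈ ({e, rev e} : Finset (Dart E)) ↔ rev.SameCycle e b := by
  rw [Finset.mem_insert, Finset.mem_singleton]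
  constructor
  · rintro (rfl | rfl)
    · exact Equiv.Perm.SameCycle.refl _ _
    · exact ⟨1, by simp⟩
  · intro h
    obtain ⟨k, -, -, rfl⟩ := h.exists_pow_eq'
    clear h
    induction k with
    | zero => simp
    | succ k ih =>
      rw [pow_succ', Equiv.Perm.mul_apply]
      rcases ih with h | h <;> rw [h]
      · exact Or.inr rfl
      · exact Or.inl (rev_rev e)

/-- The faces of `C_G` corresponding to edges of `G`. -/
lemma prod_edge_face {x : CDart E} {e : Dart E}
    (hx : x = (.perp e, true) ∨ x = (.par e, false)) :
    (G.cRotationSystem.faceBoundary x).card = 4 ∧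
    ∀ {R : Type} [CommMonoid R] (f : CDart E → R), ∏ y ∈ G.cRotationSystem.faceBoundary x, f y =
      (f (.perp e, true) * f (.par e, false)) *
        (f (.perp (rev e), true) * f (.par (rev e), false)) := by
  classical
  have h := prod_double_orbit (σ := rev) (τ := G.cRotationSystem.facePerm)
    (u := fun e => (CEdge.perp e, true)) (v := fun e => (CEdge.par e, false))
    (fun a b h => by simpa using h) (fun a b h => by simpa using h) (fun a b h => by simp at h)
    G.cFacePerm_perp_true G.cFacePerm_par_false hx (sameCycle_rev_iff e)
    (fun b => G.cRotationSystem.mem_faceBoundary (d' := b))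
  rw [Finset.card_pair (ne_rev e)] at h
  refine ⟨h.1, fun f => ?_⟩
  rw [h.2 f, Finset.prod_pair (ne_rev e)]

lemma units_int_eq_of_cast_eq {a b : ℤˣ} (h : ((a : ℤ) : ℂ) = ((b : ℤ) : ℂ)) : a = b :=
  Units.ext (by exact_mod_cast h)

lemma cast_prod_units {ι : Type*} (s : Finset ι) (f : ι → ℤˣ) :
    (((∏ i ∈ s, f i : ℤˣ) : ℤ) : ℂ) = ∏ i ∈ s, ((f i : ℤ) : ℂ) := by
  push_cast; rfl

/-- The factors for `rev b` and for `rot b` have equal products over the face, since `rot` carries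
the successor of `b` on the boundary to `rev b`. What remains is the product of the inverse corner
turns, up to a sign for each edge. -/
theorem prod_kasteleynSign_face [Fintype V] [DiscreteTopology Λ] (e : Dart E) :
    ∏ b ∈ G.toRotationSystem.faceBoundary e,
      G.kasteleynSign (.par b, true) * G.kasteleynSign (.corner b, false) =
      (-1) ^ ((G.toRotationSystem.faceBoundary e).card + 1) := by
  refine units_int_eq_of_cast_eq ?_
  rw [cast_prod_units]
  -- A sign equals its own inverse, so the formula for it may be inverted; this form is the one that
  -- cancels against the corner sign.
  have hpar : ∀ b, ((G.kasteleynSign (.par b, true) : ℤ) : ℂ) =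
      -Complex.I * G.halfDirection (rev b) / G.halfDirection b := fun b => by
    have h1 := G.kasteleynSign_par b true
    have h2 : ((G.kasteleynSign (.par b, true) : ℤ) : ℂ) * (G.kasteleynSign (.par b, true) : ℤ) = 1 := by
      rw [← Int.cast_mul, ← Units.val_mul, Int.units_mul_self]
      simp
    have hb := G.halfDirection_ne_zero b
    have hb' := G.halfDirection_ne_zero (rev b)
    have h3 : (G.kasteleynSign (.par b, true) : ℤ) *
        (Complex.I * G.halfDirection b / G.halfDirection (rev b)) = 1 := by rw [← h1, h2]
    rw [eq_div_iff hb]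
    have h4 : (G.kasteleynSign (.par b, true) : ℤ) * (Complex.I * G.halfDirection b) =
        G.halfDirection (rev b) := by
      field_simp at h3
      linear_combination h3
    linear_combination (-Complex.I) * h4 +
      ((G.kasteleynSign (.par b, true) : ℤ) * G.halfDirection b) * Complex.I_sq
  have hmul : ∀ b, (((G.kasteleynSign (.par b, true) * G.kasteleynSign (.corner b, false) : ℤˣ) : ℤ) : ℂ) =
      -(G.cornerTurn b)⁻¹ * G.halfDirection (rev b) / G.halfDirection (G.rot b) := fun b => by
    push_cast
    rw [hpar, kasteleynSign_corner]
    have hb := G.halfDirection_ne_zero b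
    have hb' := G.halfDirection_ne_zero (G.rot b)
    have ht : (G.cornerTurn b)⁻¹ =
        -Complex.I * Complex.exp ((G.cornerAngle b / 2 : ℝ) * Complex.I) := by
      have hI : Complex.exp ((Real.pi / 2 : ℝ) * Complex.I) = Complex.I := by
        push_cast
        rw [Complex.exp_pi_div_two_mul_I]
      rw [cornerTurn, sub_div, Complex.ofReal_sub, sub_mul, Complex.exp_sub, hI, inv_div,
        Complex.div_I]
      ring
    rw [ht]
    field_simp
  rw [Finset.prod_congr rfl fun b _ => hmul b, Finset.prod_div_distrib, Finset.prod_mul_distrib]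
  have hreindex : ∏ b ∈ G.toRotationSystem.faceBoundary e, G.halfDirection (rev b) =
      ∏ b ∈ G.toRotationSystem.faceBoundary e, G.halfDirection (G.rot b) := by
    rw [← prod_orbit_apply (fun b => G.toRotationSystem.mem_faceBoundary (d := e) (d' := b))
      (fun b => G.halfDirection (G.rot b))]
    simp only [rot_facePerm]
  have hne : ∏ b ∈ G.toRotationSystem.faceBoundary e, G.halfDirection (G.rot b) ≠ 0 :=
    Finset.prod_ne_zero_iff.mpr fun b _ => G.halfDirection_ne_zero _
  rw [hreindex, mul_div_cancel_right₀ _ hne, Finset.prod_neg, Finset.prod_inv_distrib,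
    prod_cornerTurn_face]
  push_cast
  ring

/-- All corners at a vertex have sign -1, except the one that crosses the cut of the argument. -/
theorem prod_kasteleynSign_vertex [DecidableEq V] (e : Dart E) :
    ∏ b with G.origin e = G.origin b,
      G.kasteleynSign (.corner b, true) * G.kasteleynSign (.perp b, false) =
      (-1) ^ ((Finset.univ.filter fun b => G.origin e = G.origin b).card + 1) := by
  classical
  obtain ⟨m, hm, h⟩ := G.exists_arg_rot_le_iff e
  have h1 : ∀ b ∈ Finset.univ.filter (fun b => G.origin e = G.origin b),
      G.kasteleynSign (.corner b, true) * G.kasteleynSign (.perp b, false) =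
        -1 * if b = m then -1 else 1 := fun b hb => by
    have hb' : G.origin b = G.origin e := by simpa using (Finset.mem_filter.mp hb).2.symm
    simp only [kasteleynSign, h b hb', mul_one]
    split_ifs <;> simp
  rw [Finset.prod_congr rfl h1, Finset.prod_mul_distrib, Finset.prod_const, Finset.prod_ite_eq',
    if_pos (by simp [hm]), pow_succ]

theorem isKasteleyn_kasteleynSign [Fintype V] [DiscreteTopology Λ] :
    G.cRotationSystem.IsKasteleyn G.kasteleynSign := by
  classical
  constructor
  · rintro ⟨_ | _ | _, _⟩ <;> rfl
  · have hface : ∀ x e, (x = (.par e, true) ∨ x = (.corner e, false)) →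
        ∏ d' ∈ G.cRotationSystem.faceBoundary x, G.kasteleynSign d' =
          (-1) ^ ((G.cRotationSystem.faceBoundary x).card / 2 + 1) := fun x e hx => by
      obtain ⟨h1, h2⟩ := G.prod_face hx
      rw [h2, h1, Nat.mul_div_cancel_left _ (by norm_num), prod_kasteleynSign_face]
    have hvertex : ∀ x e, (x = (.corner e, true) ∨ x = (.perp e, false)) →
        ∏ d' ∈ G.cRotationSystem.faceBoundary x, G.kasteleynSign d' =
          (-1) ^ ((G.cRotationSystem.faceBoundary x).card / 2 + 1) := fun x e hx => by
      obtain ⟨h1, h2⟩ := G.prod_vertex_face hx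
      rw [h2, h1, Nat.mul_div_cancel_left _ (by norm_num)]
      exact G.prod_kasteleynSign_vertex e
    have hedge : ∀ x e, (x = (.perp e, true) ∨ x = (.par e, false)) →
        ∏ d' ∈ G.cRotationSystem.faceBoundary x, G.kasteleynSign d' =
          (-1) ^ ((G.cRotationSystem.faceBoundary x).card / 2 + 1) := fun x e hx => by
      obtain ⟨h1, h2⟩ := G.prod_edge_face hx
      rw [h2, h1]
      refine units_int_eq_of_cast_eq ?_
      have e1 : ∀ d, G.kasteleynSign (.perp d, true) = 1 := fun d => rfl
      rw [e1, e1, one_mul, one_mul]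
      push_cast
      rw [kasteleynSign_par, kasteleynSign_par, rev_rev]
      have hb := G.halfDirection_ne_zero e
      have hb' := G.halfDirection_ne_zero (rev e)
      field_simp
      rw [Complex.I_sq]
    rintro ⟨e | e | e, _ | _⟩
    · exact hvertex _ e (Or.inr rfl)
    · exact hedge _ e (Or.inl rfl)
    · exact hedge _ e (Or.inr rfl)
    · exact hface _ e (Or.inl rfl)
    · exact hface _ e (Or.inr rfl)
    · exact hvertex _ e (Or.inl rfl)

/-- Faces coming from faces of `G` repeat the cocycle condition, rectangles express inversion under
reversal, and faces around vertices carry only the value 1. -/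
theorem isCocycle_inducedCochain {φ : Dart E → ℂˣ} (hφ : G.toRotationSystem.IsCocycle φ) :
    G.cRotationSystem.IsCocycle (inducedCochain φ) := by
  classical
  constructor
  · rintro ⟨e | e | e, _ | _⟩ <;>
      simp [cRotationSystem, inducedCochain]
  · have hface : ∀ x e, (x = (.par e, true) ∨ x = (.corner e, false)) →
        ∏ d' ∈ G.cRotationSystem.faceBoundary x, inducedCochain φ d' = 1 := fun x e hx => by
      rw [(G.prod_face hx).2]
      simpa [inducedCochain] using hφ.2 e
    have hvertex : ∀ x e, (x = (.corner e, true) ∨ x = (.perp e, false)) →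
        ∏ d' ∈ G.cRotationSystem.faceBoundary x, inducedCochain φ d' = 1 := fun x e hx => by
      rw [(G.prod_vertex_face hx).2]
      simp [inducedCochain]
    have hedge : ∀ x e, (x = (.perp e, true) ∨ x = (.par e, false)) →
        ∏ d' ∈ G.cRotationSystem.faceBoundary x, inducedCochain φ d' = 1 := fun x e hx => by
      rw [(G.prod_edge_face hx).2]
      have : φ (rev e) = (φ e)⁻¹ := hφ.1 e
      simp [inducedCochain, this]
    rintro ⟨e | e | e, _ | _⟩
    · exact hvertex _ e (Or.inr rfl)
    · exact hedge _ e (Or.inl rfl)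
    · exact hedge _ e (Or.inr rfl)
    · exact hface _ e (Or.inl rfl)
    · exact hface _ e (Or.inr rfl)
    · exact hvertex _ e (Or.inl rfl)

end ToricGraph

/-! ### Determinant and inverse of the rotation matrix -/

open Matrix

/-- Only the identity and the full cycle contribute to the Leibniz expansion: a permutation that
moves one point along the cycle is forced by injectivity to move the next. The signature of the
cycle leaves a single minus sign. -/
lemma det_one_sub_cycle {α : Type*} [Fintype α] [DecidableEq α] [Nonempty α] (σ : Equiv.Perm α)
    (hσ : ∀ a b, σ.SameCycle a b) (w : α → ℂ) :
    (1 - Matrix.of fun a b => if b = σ a then w a else 0).det = 1 - ∏ a, w a := by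
  rcases subsingleton_or_nontrivial α with h | h
  · obtain ⟨a⟩ := ‹Nonempty α›
    rw [Matrix.det_eq_elem_of_subsingleton _ a, Fintype.prod_subsingleton _ a]
    rw [Matrix.sub_apply, Matrix.one_apply_eq, Matrix.of_apply, if_pos (Subsingleton.elim _ _)]
  have hfix : ∀ a, σ a ≠ a := fun a ha => by
    obtain ⟨b, hb⟩ := exists_ne a
    obtain ⟨k, -, -, rfl⟩ := (hσ a b).exists_pow_eq'
    exact hb (Equiv.Perm.pow_apply_eq_self_of_apply_eq_self ha k)
  have hcyc : σ.IsCycle := by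
    obtain ⟨a⟩ := ‹Nonempty α›
    exact ⟨a, hfix a, fun b _ => hσ a b⟩
  have hsupp : σ.support = Finset.univ := by
    ext a; simp [hfix]
  have hσ1 : (1 : Equiv.Perm α) ≠ σ := fun h => by
    obtain ⟨a⟩ := ‹Nonempty α›
    exact hfix a (by rw [← h]; rfl)
  rw [← Matrix.det_transpose, Matrix.det_apply', Fintype.sum_eq_add 1 σ hσ1]
  · have h1 : ∀ a, (1 - Matrix.of fun a b => if b = σ a then w a else 0)ᵀ (σ a) a = -w a := fun a => by
      simp [(hfix a).symm]
    have h2 : ∀ a, (1 - Matrix.of fun a b => if b = σ a then w a else 0)ᵀ a a = 1 := fun a => by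
      simp [(hfix a).symm]
    simp only [Equiv.Perm.one_apply, h1, h2]
    rw [hcyc.sign, hsupp, Finset.prod_neg, Finset.card_univ]
    have : ((-1 : ℂ) ^ Fintype.card α) * (-1) ^ Fintype.card α = 1 := by
      rw [← mul_pow]; simp
    simp only [Equiv.Perm.sign_one, Finset.prod_const_one]
    push_cast
    linear_combination (-∏ a, w a) * this
  · rintro τ ⟨hτ1, hτσ⟩
    by_contra hne
    have hprod := right_ne_zero_of_mul hne
    have hval : ∀ a, τ a = a ∨ τ a = σ a := fun a => by
      by_contra! hcon
      refine (Finset.prod_ne_zero_iff.mp hprod a (Finset.mem_univ a)) ?_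
      simp [hcon.1.symm, hcon.2]
    obtain ⟨a, ha⟩ : ∃ a, τ a ≠ a := by
      by_contra! hcon
      exact hτ1 (Equiv.ext hcon)
    refine hτσ (Equiv.ext fun b => ?_)
    obtain ⟨k, -, -, rfl⟩ := (hσ a b).exists_pow_eq'
    clear hne hprod
    induction k with
    | zero => exact (hval a).resolve_left ha
    | succ k ih =>
      rw [pow_succ', Equiv.Perm.mul_apply]
      refine (hval _).resolve_left fun h => ?_
      rw [← ih] at h
      have h2 := τ.injective h
      rw [ih] at h2
      exact hfix _ h2

namespace ToricGraph

variable {Λ : Submodule ℤ ℂ} {V E : Type*} (G : ToricGraph Λ V E) [Fintype E]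

/-- The corners at a vertex add up to an odd multiple of 2π (in fact to 2π). This is read off the
corner signs, as the square roots of directions cancel around the vertex. -/
lemma prod_exp_cornerAngle [DecidableEq V] (e : Dart E) :
    ∏ b with G.origin e = G.origin b, Complex.exp ((G.cornerAngle b / 2 : ℝ) * Complex.I) = -1 := by
  have h : ∀ b, Complex.exp ((G.cornerAngle b / 2 : ℝ) * Complex.I) =
      -(((G.kasteleynSign (.corner b, true) * G.kasteleynSign (.perp b, false) : ℤˣ) : ℤ) : ℂ) *
        G.halfDirection (G.rot b) / G.halfDirection b := fun b => by
    have h1 : G.kasteleynSign (.perp b, false) = 1 := rfl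
    have hb := G.halfDirection_ne_zero b
    have hb' := G.halfDirection_ne_zero (G.rot b)
    rw [h1, mul_one, kasteleynSign_corner]
    field_simp
  have hre : ∏ b with G.origin e = G.origin b, G.halfDirection (G.rot b) =
      ∏ b with G.origin e = G.origin b, G.halfDirection b :=
    prod_orbit_apply (σ := G.rot) (a := e) (fun b => by simp [sameCycle_rot_iff]) _
  have hne : ∏ b with G.origin e = G.origin b, G.halfDirection b ≠ 0 :=
    Finset.prod_ne_zero_iff.mpr fun b _ => G.halfDirection_ne_zero b
  rw [Finset.prod_congr rfl fun b _ => h b, Finset.prod_div_distrib, Finset.prod_mul_distrib, hre,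
    mul_div_cancel_right₀ _ hne, Finset.prod_neg, ← cast_prod_units, prod_kasteleynSign_vertex]
  push_cast
  rw [← pow_add, Odd.neg_one_pow]
  exact ⟨_, by ring⟩

variable [DecidableEq E]

/-- The square root of the rotation from an oriented edge to the next one. -/
noncomputable def rotMatrix : Matrix (Dart E) (Dart E) ℂ := Matrix.of fun e e' =>
  if e' = G.rot e then Complex.exp ((G.cornerAngle e / 2 : ℝ) * Complex.I) else 0

/-- `i` times the weighted reversal of oriented edges. -/
noncomputable def revMatrix (x : E → ℝ) (φ : Dart E → ℂˣ) : Matrix (Dart E) (Dart E) ℂ :=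
  Matrix.of fun e e' => if e' = rev e then Complex.I * φ e * x e.1 else 0

lemma rotMatrix_mul (A : Matrix (Dart E) (Dart E) ℂ) (e e' : Dart E) : (G.rotMatrix * A) e e' =
    Complex.exp ((G.cornerAngle e / 2 : ℝ) * Complex.I) * A (G.rot e) e' := by
  simp [rotMatrix, Matrix.mul_apply]

lemma revMatrix_mul (x : E → ℝ) (φ : Dart E → ℂˣ) (A : Matrix (Dart E) (Dart E) ℂ)
    (e e' : Dart E) : (revMatrix x φ * A) e e' = Complex.I * φ e * x e.1 * A (rev e) e' := by
  simp [revMatrix, Matrix.mul_apply]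

variable [DecidableEq V]

/-- The square root of the rotation between oriented edges with the same origin, by an angle in
`[0, 2π)`. -/
noncomputable def turnMatrix : Matrix (Dart E) (Dart E) ℂ := Matrix.of fun e e' =>
  if G.origin e = G.origin e' then
    if e = e' then 1 else Complex.exp ((ccwAngle (G.dvec e) (G.dvec e') / 2 : ℝ) * Complex.I)
  else 0

/-- Turning first to the next edge and then on to `e'` is the same as turning directly to `e'`, so
the two terms cancel. They do not when `e'` is `e`: the detour is then a full turn with square root
-1, and 1 - (-1) = 2. -/
lemma one_sub_rotMatrix_mul_turnMatrix : (1 - G.rotMatrix) * G.turnMatrix = (2 : ℂ) • 1 := by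
  ext e e'
  have hexp2 : Complex.exp ((2 * Real.pi / 2 : ℝ) * Complex.I) = -1 := by
    rw [mul_div_cancel_left₀ _ two_ne_zero, Complex.exp_pi_mul_I]
  rw [Matrix.sub_mul, Matrix.one_mul, Matrix.sub_apply, rotMatrix_mul]
  simp only [turnMatrix, Matrix.of_apply, origin_rot, Matrix.smul_apply, Matrix.one_apply,
    smul_eq_mul]
  by_cases ho : G.origin e = G.origin e'
  · simp only [if_pos ho]
    have hadd := ccwAngle_add (G.dvec e) (G.dvec (G.rot e)) (G.dvec e')
    change G.cornerAngle e + _ = _ ∨ G.cornerAngle e + _ = _ at hadd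
    have hle := G.cornerAngle_le e ho.symm
    have hm := G.cornerAngle_mem e
    have hm2 := ccwAngle_mem (G.dvec (G.rot e)) (G.dvec e')
    by_cases h1 : e = e'
    · subst h1
      rw [if_pos rfl, if_pos rfl]
      by_cases h2 : G.rot e = e
      · have : G.cornerAngle e = 2 * Real.pi := by rw [cornerAngle, h2, ccwAngle_self]
        rw [if_pos h2, this, hexp2]; norm_num
      · rw [if_neg h2, ← Complex.exp_add, ← add_mul, ← Complex.ofReal_add, ← add_div]
        have : G.cornerAngle e + ccwAngle (G.dvec (G.rot e)) (G.dvec e) = 2 * Real.pi := by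
          rw [ccwAngle_self] at hadd
          rcases hadd with h | h
          · exact h
          · have h4 : ccwAngle (G.dvec (G.rot e)) (G.dvec e) = 2 * Real.pi := by linarith [hm.2, hm2.2]
            exact absurd (G.eq_of_ccwAngle_eq (G.origin_rot e) h4) h2
        rw [this, hexp2]; norm_num
    · rw [if_neg h1, if_neg h1, mul_zero]
      by_cases h2 : G.rot e = e'
      · rw [if_pos h2, mul_one, cornerAngle, h2, sub_self]
      · rw [if_neg h2, ← Complex.exp_add, ← add_mul, ← Complex.ofReal_add, ← add_div]
        have : G.cornerAngle e + ccwAngle (G.dvec (G.rot e)) (G.dvec e') =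
            ccwAngle (G.dvec e) (G.dvec e') := by
          rcases hadd with h | h
          · exact h
          · have h4 : ccwAngle (G.dvec (G.rot e)) (G.dvec e') = 2 * Real.pi := by linarith [hm2.2]
            exact absurd (G.eq_of_ccwAngle_eq ((G.origin_rot e).trans ho) h4) h2
        rw [this, sub_self]
  · have h1 : e ≠ e' := fun h => ho (by rw [h])
    simp [ho, h1]

lemma turnMatrix_mul_one_sub_rotMatrix : G.turnMatrix * (1 - G.rotMatrix) = (2 : ℂ) • 1 := by
  have h : (1 - G.rotMatrix) * ((2 : ℂ)⁻¹ • G.turnMatrix) = 1 := by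
    rw [Matrix.mul_smul, one_sub_rotMatrix_mul_turnMatrix, smul_smul]; simp
  have h2 := mul_eq_one_comm.mp h
  rw [Matrix.smul_mul] at h2
  exact (inv_smul_eq_iff₀ two_ne_zero).mp h2

/-- The transition matrix in terms of square roots of rotations. -/
lemma transition_eq (x : E → ℝ) (φ : Dart E → ℂˣ) :
    G.transition x φ = -(revMatrix x φ * (G.turnMatrix - 1)) := by
  ext e e'
  rw [Matrix.neg_apply, revMatrix_mul, Matrix.sub_apply]
  simp only [transition, turnMatrix, Matrix.of_apply, Matrix.one_apply]
  by_cases ho : G.origin (rev e) = G.origin e'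
  · by_cases h : e' = rev e
    · simp [h]
    · have h' : rev e ≠ e' := fun h' => h h'.symm
      rw [if_pos ⟨(G.origin_rev e).symm.trans ho, h⟩, if_pos ho, if_neg h', if_neg h', sub_zero]
      have hpi := Real.pi_pos
      have hm := ccwAngle_mem (G.dvec (rev e)) (G.dvec e')
      have hlt : ccwAngle (G.dvec (rev e)) (G.dvec e') < 2 * Real.pi :=
        lt_of_le_of_ne hm.2 fun h2 => h' (G.eq_of_ccwAngle_eq ho h2)
      have hn := eq_mul_exp_ccwAngle (G.dvec_ne_zero (rev e)) (G.dvec e')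
      set β := ccwAngle (G.dvec (rev e)) (G.dvec e') with hβ
      have hr := G.norm_ratio_pos e' (rev e)
      have hq : G.dvec e' / G.dvec e = (‖G.dvec e'‖ / ‖G.dvec (rev e)‖ : ℝ) *
          (Complex.cos (β - Real.pi : ℝ) + Complex.sin (β - Real.pi : ℝ) * Complex.I) := by
        have he := G.dvec_ne_zero e
        rw [← Complex.exp_mul_I]
        rw [div_eq_iff he]
        conv_lhs => rw [hn, dvec_rev]
        rw [Complex.ofReal_sub, sub_mul, Complex.exp_sub, Complex.exp_pi_mul_I, dvec_rev]
        ring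
      rw [hq, Complex.arg_mul_cos_add_sin_mul_I hr ⟨by linarith [hm.1], by linarith⟩]
      -- The angle of the transition is β - π; the half turn thus removed is the factor i in
      -- `revMatrix`.
      have hexp : Complex.exp (Complex.I / 2 * (β - Real.pi : ℝ)) =
          -Complex.I * Complex.exp ((β / 2 : ℝ) * Complex.I) := by
        have hI : Complex.exp ((Real.pi / 2 : ℝ) * Complex.I) = Complex.I := by
          push_cast
          rw [Complex.exp_pi_div_two_mul_I]
        have : Complex.I / 2 * (β - Real.pi : ℝ) =
            (β / 2 : ℝ) * Complex.I - (Real.pi / 2 : ℝ) * Complex.I := by push_cast; ring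
        rw [this, Complex.exp_sub, hI, Complex.div_I]
        ring
      rw [hexp]
      ring
  · have h : e' ≠ rev e := fun h => ho (by rw [h])
    have h' : rev e ≠ e' := fun h' => h h'.symm
    rw [if_neg fun hh => ho hh.1, if_neg ho, if_neg h']
    simp

/-- The matrix splits into one cyclic block per vertex, each of determinant 1 - (-1). An isolated
vertex would have an empty block, contributing 1 instead of 2. -/
lemma det_one_sub_rotMatrix [Fintype V] (hV : ∀ v, ∃ d, G.origin d = v) :
    (1 - G.rotMatrix).det = 2 ^ Fintype.card V := by
  let b : Dart E → Fin (Fintype.card V) := fun d => Fintype.equivFin V (G.origin d)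
  have hb : ∀ d d', b d = b d' ↔ G.origin d = G.origin d' := fun d d' =>
    (Fintype.equivFin V).injective.eq_iff
  have htri : (1 - G.rotMatrix).BlockTriangular b := by
    intro d d' hlt
    have h1 : G.origin d ≠ G.origin d' := fun h => hlt.ne ((hb d d').mpr h).symm
    have h2 : d ≠ d' := fun h => h1 (by rw [h])
    have h3 : d' ≠ G.rot d := fun h => h1 (by rw [h, origin_rot])
    simp [rotMatrix, h2, h3]
  rw [htri.det_fintype, Finset.prod_congr rfl fun k _ => ?_, Finset.prod_const, Finset.card_univ,
    Fintype.card_fin]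
  obtain ⟨v, rfl⟩ := (Fintype.equivFin V).surjective k
  obtain ⟨d, rfl⟩ := hV v
  let σ : Equiv.Perm {d' : Dart E // b d' = b d} :=
    G.rot.subtypePerm fun d' => by rw [hb, hb, origin_rot]
  have hblock : (1 - G.rotMatrix).toSquareBlock b (b d) = 1 - Matrix.of fun a c =>
      if c = σ a then Complex.exp ((G.cornerAngle a.1 / 2 : ℝ) * Complex.I) else 0 := by
    ext a c
    simp [Matrix.toSquareBlock_def, rotMatrix, Matrix.one_apply, σ, Subtype.ext_iff]
  have : Nonempty {d' : Dart E // b d' = b d} := ⟨⟨d, rfl⟩⟩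
  change ((1 - G.rotMatrix).toSquareBlock b (b d)).det = 2
  rw [hblock, det_one_sub_cycle σ (fun a c => ?_)]
  · rw [← Finset.prod_subtype (Finset.univ.filter fun c => G.origin d = G.origin c)
      (fun c => by rw [hb]; simp [eq_comm])
      (fun c => Complex.exp ((G.cornerAngle c / 2 : ℝ) * Complex.I)), prod_exp_cornerAngle]
    norm_num
  · rw [Equiv.Perm.sameCycle_subtypePerm, sameCycle_rot_iff, ← hb, a.2, c.2]

end ToricGraph

/-! ### Rectangles, Cayley transform and comparison of the determinants -/

namespace ToricGraph

variable {Λ : Submodule ℤ ℂ} {V E : Type*} (G : ToricGraph Λ V E) [Fintype E] [DecidableEq E]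

/-- The two orientations of an edge form a 2 × 2 block in which φ cancels between the off-diagonal
entries, whose product is -x². -/
lemma det_one_sub_revMatrix (x : E → ℝ) {φ : Dart E → ℂˣ} (hφ : ∀ d, φ (rev d) = (φ d)⁻¹) :
    (1 - revMatrix x φ).det = ∏ e : E, (1 + (x e : ℂ) ^ 2) := by
  let M : E → Matrix Bool Bool ℂ := fun e => Matrix.of fun a b =>
    if a = b then 1 else -(Complex.I * φ (e, a) * x e)
  have hM : ∀ e, (M e).det = 1 + (x e : ℂ) ^ 2 := fun e => by
    have h : (φ (e, true) : ℂ) * φ (e, false) = 1 := by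
      have := hφ (e, false)
      rw [show rev (e, false) = (e, true) from rfl] at this
      rw [this]; simp
    rw [← Matrix.det_submatrix_equiv_self finTwoEquiv, Matrix.det_fin_two]
    simp [M, finTwoEquiv]
    linear_combination (-(x e : ℂ) ^ 2) * Complex.I ^ 2 * h - (x e : ℂ) ^ 2 * Complex.I_sq
  have hblock : (1 - revMatrix x φ).submatrix (Equiv.prodComm Bool E) (Equiv.prodComm Bool E) =
      Matrix.blockDiagonal M := by
    ext ⟨a, e⟩ ⟨b, e'⟩
    rw [Matrix.blockDiagonal_apply]
    simp only [Matrix.submatrix_apply, Equiv.prodComm_apply, Prod.swap, Matrix.sub_apply,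
      Matrix.one_apply, revMatrix, Matrix.of_apply, M]
    by_cases he : e = e'
    · subst he
      cases a <;> cases b <;> simp [rev]
    · have he' : ¬ e' = e := fun h => he h.symm
      simp [he, he', rev]
  rw [← Matrix.det_submatrix_equiv_self (Equiv.prodComm Bool E), hblock, Matrix.det_blockDiagonal,
    Finset.prod_congr rfl fun e _ => hM e]

lemma cos_two_mul_arctan (x : ℝ) : Real.cos (2 * Real.arctan x) = (1 - x ^ 2) / (1 + x ^ 2) := by
  have h : 0 < 1 + x ^ 2 := by positivity
  rw [Real.cos_two_mul, Real.cos_sq_arctan]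
  field_simp
  ring

lemma sin_two_mul_arctan (x : ℝ) : Real.sin (2 * Real.arctan x) = 2 * x / (1 + x ^ 2) := by
  have h : 0 < 1 + x ^ 2 := by positivity
  rw [Real.sin_two_mul, Real.sin_arctan, Real.cos_arctan]
  have h2 : √(1 + x ^ 2) * √(1 + x ^ 2) = 1 + x ^ 2 := Real.mul_self_sqrt h.le
  have h3 : √(1 + x ^ 2) ≠ 0 := (Real.sqrt_pos.mpr h).ne'
  have h4 : 2 * (x / √(1 + x ^ 2)) * (1 / √(1 + x ^ 2)) =
      2 * x / (√(1 + x ^ 2) * √(1 + x ^ 2)) := by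
    field_simp
  rw [h4, h2]

/-- The restriction of the Kasteleyn matrix to the rectangles, up to a change of basis. -/
noncomputable def rectMatrix (x : E → ℝ) (φ : Dart E → ℂˣ) : Matrix (Dart E) (Dart E) ℂ :=
  Matrix.of fun e e' => (if e' = e then (Real.cos (2 * Real.arctan (x e.1)) : ℂ) else 0) +
    if e' = rev e then Complex.I * φ e * Real.sin (2 * Real.arctan (x e.1)) else 0

/-- With J² = -x² on the block of an edge, (1 + J)/(1 - J) = (1 - x² + 2J)/(1 + x²), which is cos θ
+ (sin θ / x) J for x = tan (θ/2). -/
lemma one_sub_revMatrix_mul_rectMatrix (x : E → ℝ) {φ : Dart E → ℂˣ}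
    (hφ : ∀ d, φ (rev d) = (φ d)⁻¹) :
    (1 - revMatrix x φ) * rectMatrix x φ = 1 + revMatrix x φ := by
  ext e e'
  rw [Matrix.sub_mul, Matrix.one_mul, Matrix.sub_apply, revMatrix_mul]
  have hx : (1 + (x e.1 : ℂ) ^ 2) ≠ 0 := by
    have : (1 + x e.1 ^ 2 : ℝ) ≠ 0 := by positivity
    exact_mod_cast this
  have h : (φ e : ℂ) * φ (rev e) = 1 := by rw [hφ]; simp
  have h1 : (rev e).1 = e.1 := rfl
  simp only [rectMatrix, revMatrix, Matrix.of_apply, Matrix.add_apply, Matrix.one_apply,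
    rev_rev, h1, cos_two_mul_arctan, sin_two_mul_arctan]
  by_cases ha : e' = e
  · subst ha
    have hne := ne_rev e'
    simp only [if_true, if_neg hne]
    push_cast
    field_simp
    linear_combination (-2 * (x e'.1 : ℂ) ^ 2 * Complex.I ^ 2) * h - 2 * (x e'.1 : ℂ) ^ 2 * Complex.I_sq
  · have ha' : e ≠ e' := fun h => ha h.symm
    simp only [if_neg ha, if_neg ha']
    by_cases hb : e' = rev e
    · simp only [if_pos hb]
      push_cast
      field_simp
      ring
    · simp only [if_neg hb]
      simp

lemma kasteleynMatrix_apply (ω : CDart E → ℤˣ) (y : CEdge E → ℝ) (φ : Dart E → ℂˣ)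
    (w b : Dart E) : G.kasteleynMatrix ω y (inducedCochain φ) w b =
      (if b = w then ((ω (.perp w, true) : ℤ) : ℂ) * y (.perp w) else 0) +
      ((if b = rev w then ((ω (.par w, true) : ℤ) : ℂ) * y (.par w) * φ w else 0) +
      if b = G.rot w then ((ω (.corner w, true) : ℤ) : ℂ) * y (.corner w) else 0) := by
  rw [kasteleynMatrix, ← Equiv.sum_comp CEdge.equivSum.symm, Fintype.sum_sum_type,
    Fintype.sum_sum_type]
  have key : ∀ (f : Dart E → Dart E) (g : Dart E → ℂ),
      ∑ d, (if d = w ∧ f d = b then g d else 0) = if b = f w then g w else 0 := fun f g => by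
    simp only [ite_and, Finset.sum_ite_eq', Finset.mem_univ, if_true]
    exact if_congr eq_comm rfl rfl
  congr 1
  · exact (key id _).trans (by simp [inducedCochain, CEdge.equivSum])
  congr 1
  · exact (key rev _).trans (by simp [inducedCochain, CEdge.equivSum])
  · exact (key G.rot _).trans (by simp [inducedCochain, CEdge.equivSum])

/-- The formulas for the signs exhibit them as phases conjugated by the square roots of directions;
such a conjugation does not change the determinant. -/
lemma kasteleynMatrix_eq (x : E → ℝ) (φ : Dart E → ℂˣ) :
    G.kasteleynMatrix G.kasteleynSign (weight x) (inducedCochain φ) =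
      Matrix.diagonal G.halfDirection * (rectMatrix x φ - G.rotMatrix) *
        Matrix.diagonal fun d => (G.halfDirection d)⁻¹ := by
  ext e e'
  have h0 := G.halfDirection_ne_zero e
  rw [kasteleynMatrix_apply, Matrix.mul_diagonal, Matrix.diagonal_mul, Matrix.sub_apply,
    kasteleynSign_par, kasteleynSign_corner]
  simp only [rectMatrix, rotMatrix, Matrix.of_apply, weight]
  have hperp : G.kasteleynSign (.perp e, true) = 1 := rfl
  rw [hperp, sub_eq_add_neg, mul_add, mul_add, add_mul, add_mul, add_assoc]
  congr 1
  · split_ifs with h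
    · subst h
      simp only [Units.val_one, Int.cast_one]
      field_simp
    · simp
  congr 1
  · split_ifs with h
    · subst h
      field_simp
    · simp
  · split_ifs with h
    · subst h
      push_cast
      field_simp
    · simp

theorem kacWardDet_eq [Fintype V] [DecidableEq V] (hV : ∀ v, ∃ d, G.origin d = v) (x : E → ℝ)
    {φ : Dart E → ℂˣ} (hφ : ∀ d, φ (rev d) = (φ d)⁻¹) :
    G.kacWardDet x φ = ((2 : ℂ) ^ Fintype.card V)⁻¹ * (∏ e : E, (1 + (x e : ℂ) ^ 2)) *
      (G.kasteleynMatrix G.kasteleynSign (weight x) (inducedCochain φ)).det := by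
  -- Multiplying by 1 - R replaces the sum over all turns at a vertex by single steps to the next
  -- edge, which are the corner edges of `C_G`.
  have hfac : (1 - G.transition x φ) * (1 - G.rotMatrix) =
      (1 - revMatrix x φ) * (rectMatrix x φ - G.rotMatrix) := by
    have h1 : (G.turnMatrix - 1) * (1 - G.rotMatrix) = 1 + G.rotMatrix := by
      rw [Matrix.sub_mul, turnMatrix_mul_one_sub_rotMatrix, two_smul, Matrix.one_mul]
      abel
    rw [transition_eq, sub_neg_eq_add, Matrix.add_mul, Matrix.mul_assoc, h1,
      Matrix.mul_sub (1 - revMatrix x φ), one_sub_revMatrix_mul_rectMatrix x hφ]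
    noncomm_ring
  have hdet := congrArg Matrix.det hfac
  rw [Matrix.det_mul, Matrix.det_mul, G.det_one_sub_rotMatrix hV, det_one_sub_revMatrix x hφ] at hdet
  have hK : (G.kasteleynMatrix G.kasteleynSign (weight x) (inducedCochain φ)).det =
      (rectMatrix x φ - G.rotMatrix).det := by
    have hne : ∏ d, G.halfDirection d ≠ 0 :=
      Finset.prod_ne_zero_iff.mpr fun d _ => G.halfDirection_ne_zero d
    rw [kasteleynMatrix_eq, Matrix.det_mul, Matrix.det_mul, Matrix.det_diagonal,
      Matrix.det_diagonal, Finset.prod_inv_distrib]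
    field_simp
  rw [hK, mul_assoc, ← hdet, kacWardDet]
  field_simp

end ToricGraph

theorem theorem3p1 (Λ : Submodule ℤ ℂ) [DiscreteTopology Λ] [IsZLattice ℝ Λ]
    {V E : Type*} [Fintype V] [Fintype E] [DecidableEq V] [DecidableEq E]
    (G : ToricGraph Λ V E) (x : E → ℝ) (hx : ∀ e, x e ∈ Set.Ioo (0 : ℝ) 1) :
    ∃ ω : ToricGraph.CDart E → ℤˣ, G.cRotationSystem.IsKasteleyn ω ∧
      ∀ φ : ToricGraph.Dart E → ℂˣ, G.toRotationSystem.IsCocycle φ →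
        G.cRotationSystem.IsCocycle (ToricGraph.inducedCochain φ) ∧
        G.kacWardDet x φ =
          ((2 : ℂ) ^ Fintype.card V)⁻¹ * (∏ e : E, (1 + (x e : ℂ) ^ 2)) *
            (G.kasteleynMatrix ω (ToricGraph.weight x) (ToricGraph.inducedCochain φ)).det :=
  ⟨G.kasteleynSign, G.isKasteleyn_kasteleynSign, fun _ hφ =>
    ⟨G.isCocycle_inducedCochain hφ, G.kacWardDet_eq G.exists_origin_eq x hφ.1⟩⟩
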